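/- **Theorem.** Work in the $C^\infty$ category. Let $(N^{2n+1},\varphi,\xi,\eta,g)$ be a strictly regular Sasakian space form of constant $\varphi$-sectional curvature $c$, that is: * $\varphi$ is a $(1,1)$-tensor field, $\xi$ a vector field, $\eta$ a 1-form and $g$ a Riemannian metric on $N$ with $\varphi^2=-I+\eta\otimes\xi$, $\eta(\xi)=1$, $g(\varphi X,\varphi Y)=g(X,Y)-\eta(X)\eta(Y)$ and $g(X,\varphi Y)=d\eta(X,Y)$, where $d\eta(X,Y)=\tfrac12\big(X\eta(Y)-Y\eta(X)-\eta([X,Y])\big)$; * $N_\varphi+2\,d\eta\otimes\xi=0$, where $N_\varphi(X,Y)=[\varphi X,\varphi Y]-\varphi[\varphi X,Y]-\varphi[X,\varphi Y]+\varphi^2[X,Y]$; * for every unit tangent vector $X$ orthogonal to $\xi$ the plane spanned by $X$ and $\varphi X$ has sectional curvature $c$; * $\xi$ is strictly regular: every point has a cubic coordinate neighbourhood in which $\xi$ is the first coordinate vector field and through which every integral curve of $\xi$ passes at most once, and all (maximal) integral curves of $\xi$ are homeomorphic to each other. Assume that $\xi$ is complete, with flow $\{\phi_t\}_{t\in\mathbb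 R}$. Let $1\le r\le n$ and let $\mathbf i:M\to N$ be an $r$-dimensional (immersed) integral submanifold, i.e. an immersion of an $r$-dimensional manifold $M$ with $\mathbf i^*\eta=0$. Let $I=\mathbb R$; or, if $\phi_T=\mathrm{id}_N$ for some $T>0$, let $I=\mathbb S^1=\mathbb R/T\mathbb Z$. Put $\widetilde M=I\times M$, $\widetilde g=dt^2+\mathbf i^*g$ and $$F:\widetilde M\to N,\qquad F(t,p)=\phi_t(\mathbf i(p)).$$ Then $F:(\widetilde M,\widetilde g)\to(N,g)$ is a Riemannian immersion (a smooth immersion with $F^*g=\widetilde g$), and $F$ is proper-biharmonic if and only if $M$ is a proper-biharmonic submanifold of $N$, i.e. if and only if $\mathbf i:(M,\mathbf i^*g)\to(N,g)$ is proper-biharmonic. Here a smooth map $f$ between Riemannian manifolds is *harmonic* if its tension field $\tau(f)=\operatorname{trace}\nabla df$ vanishes identically, *biharmonic* if its bitension field $$\tau_2(f)=-\Delta^f\tau(f)-\operatorname{trace}R^N(df,\tau(f))\,df$$ vanishes identically, where $\Delta^f=-\operatorname{trace}(\nabla^f\nabla^f-\nabla^f_{\nabla})$ and $R^N(X,Y)=\nabla_X\nabla_Y-\nabla_Y\nabla_X-\nabla_{[X,Y]}$,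 and *proper-biharmonic* if it is biharmonic but not harmonic. -/

import Mathlib

open Set Function Topology
open scoped Manifold ContDiff Bundle

noncomputable section

/-! ## Riemannian geometry in linear coordinates

`E`, `F` are finite-dimensional real vector spaces, `G` and `K` are metric tensors on (open parts
of) `E` and `F`, and `f` is a map from (an open part of) `E` to `F`.  All formulas are evaluated at
a point and only depend on the germs of `G`, `K`, `f` there. -/

namespace LocalRiem

variable {E : Type*} [NormedAddCommGroup E] [NormedSpace ℝ E] [FiniteDimensional ℝ E]
  {F : Type*} [NormedAddCommGroup F] [NormedSpace ℝ F] [FiniteDimensional ℝ F]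

/-- The Gram matrix `g_ij = G x (b i) (b j)` in a basis `b` of `E`. -/
def gram (G : E → E → E → ℝ) (x : E) :
    Matrix (Fin (Module.finrank ℝ E)) (Fin (Module.finrank ℝ E)) ℝ :=
  Matrix.of fun i j => G x (Module.finBasis ℝ E i) (Module.finBasis ℝ E j)

/-- The trace `∑ g^ij B(b i, b j)` of a bilinear map `B` with respect to the inner product
`G x`. -/
def metricTrace (G : E → E → E → ℝ) (x : E) (B : E → E → F) : F :=
  ∑ i, ∑ j, (gram G x)⁻¹ i j • B (Module.finBasis ℝ E i) (Module.finBasis ℝ E j)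

/-- The Christoffel symbols
`Γ(u, v) = ∑ ½ g^kl (∂_u G(v, b l) + ∂_v G(u, b l) - ∂_{b l} G(u, v)) b k`
of the Levi-Civita connection of `G`. -/
def christoffel (G : E → E → E → ℝ) (x : E) (u v : E) : E :=
  ∑ k, ∑ l, ((gram G x)⁻¹ k l * ((1 / 2 : ℝ) *
    (fderiv ℝ (fun y => G y v (Module.finBasis ℝ E l)) x u
      + fderiv ℝ (fun y => G y u (Module.finBasis ℝ E l)) x v
      - fderiv ℝ (fun y => G y u v) x (Module.finBasis ℝ E l)))) • Module.finBasis ℝ E k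

/-- The curvature `R(u, v) w = ∇_u ∇_v w - ∇_v ∇_u w` (for constant fields `u`, `v`, `w`). -/
def curvature (G : E → E → E → ℝ) (x : E) (u v w : E) : E :=
  fderiv ℝ (fun y => christoffel G y v w) x u
    - fderiv ℝ (fun y => christoffel G y u w) x v
    + christoffel G x u (christoffel G x v w)
    - christoffel G x v (christoffel G x u w)

/-- The second fundamental form `∇df (u, v)` of a map `f : (E, G) → (F, K)`. -/
def secondFundamentalForm (G : E → E → E → ℝ) (K : F → F → F → ℝ) (f : E → F)
    (x : E) (u v : E) : F :=
  fderiv ℝ (fun y => fderiv ℝ f y v) x u - fderiv ℝ f x (christoffel G x u v)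
    + christoffel K (f x) (fderiv ℝ f x u) (fderiv ℝ f x v)

/-- The tension field `τ(f) = trace_G ∇df`. -/
def tension (G : E → E → E → ℝ) (K : F → F → F → ℝ) (f : E → F) (x : E) : F :=
  metricTrace G x (secondFundamentalForm G K f x)

/-- The covariant derivative `∇^f_u V` of a vector field `V` along `f`. -/
def covDeriv (K : F → F → F → ℝ) (f V : E → F) (x : E) (u : E) : F :=
  fderiv ℝ V x u + christoffel K (f x) (fderiv ℝ f x u) (V x)

/-- The second covariant derivative `∇^f_u ∇^f_v V - ∇^f_{∇_u v} V` of a vector field `V`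
along `f` (for constant fields `u`, `v`). -/
def covDeriv₂ (G : E → E → E → ℝ) (K : F → F → F → ℝ) (f V : E → F) (x : E) (u v : E) : F :=
  covDeriv K f (fun y => covDeriv K f V y v) x u - covDeriv K f V x (christoffel G x u v)

/-- The rough Laplacian `Δ^f V = - trace_G (∇^f ∇^f - ∇^f_∇) V` on vector fields along `f`. -/
def laplacian (G : E → E → E → ℝ) (K : F → F → F → ℝ) (f V : E → F) (x : E) : F :=
  - metricTrace G x (covDeriv₂ G K f V x)

/-- The bitension field `τ₂(f) = - Δ^f τ(f) - trace_G R(df, τ(f)) df`. -/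
def bitension (G : E → E → E → ℝ) (K : F → F → F → ℝ) (f : E → F) (x : E) : F :=
  - laplacian G K f (tension G K f) x
    - metricTrace G x (fun u v =>
        curvature K (f x) (fderiv ℝ f x u) (tension G K f x) (fderiv ℝ f x v))

end LocalRiem

/-! ## Metrics, harmonic and biharmonic maps on manifolds -/

section Manifolds

variable {E : Type*} [NormedAddCommGroup E] [NormedSpace ℝ E]
  {H : Type*} [TopologicalSpace H] (I : ModelWithCorners ℝ E H)
  {M : Type*} [TopologicalSpace M] [ChartedSpace H M]
  {E' : Type*} [NormedAddCommGroup E'] [NormedSpace ℝ E']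
  {H' : Type*} [TopologicalSpace H'] (J : ModelWithCorners ℝ E' H')
  {N : Type*} [TopologicalSpace N] [ChartedSpace H' N]

/-- Covariant 2-tensors, given by their values on pairs of tangent vectors. -/
abbrev MetricTensor (M : Type*) [TopologicalSpace M] [ChartedSpace H M] : Type _ :=
  ∀ x : M, TangentSpace I x → TangentSpace I x → ℝ

/-- The pullback `f^* h`. -/
def pullbackMetric (h : MetricTensor J N) (f : M → N) : MetricTensor I M :=
  fun x u v => h (f x) (mfderiv I J f x u) (mfderiv I J f x v)

/-- The product metric `pr₁^* g + pr₂^* h` on `M × N`. -/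
def productMetric (g : MetricTensor I M) (h : MetricTensor J N) :
    MetricTensor (I.prod J) (M × N) :=
  fun z u v => pullbackMetric (I.prod J) I g Prod.fst z u v
    + pullbackMetric (I.prod J) J h Prod.snd z u v

/-- The expression of a metric in the preferred chart at `x`. -/
def metricInChart (g : MetricTensor I M) (x : M) : E → E → E → ℝ :=
  pullbackMetric 𝓘(ℝ, E) I g (extChartAt I x).symm

variable [FiniteDimensional ℝ E] [FiniteDimensional ℝ E']

/-- The curvature tensor `R(u, v) w` at `x`, computed in the preferred chart at `x` (in which
`T_x M` is identified with the model space). -/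
def curvatureAt (g : MetricTensor I M) (x : M) (u v w : TangentSpace I x) : TangentSpace I x :=
  LocalRiem.curvature (E := E) (metricInChart I g x) (extChartAt I x x) u v w

/-- The tension field `τ(f)` of `f : (M, g) → (N, h)`, computed in the preferred charts at `x` and
`f x`. -/
def tensionField (g : MetricTensor I M) (h : MetricTensor J N) (f : M → N) (x : M) :
    TangentSpace J (f x) :=
  LocalRiem.tension (E := E) (F := E') (metricInChart I g x) (metricInChart J h (f x))
    (writtenInExtChartAt I J x f) (extChartAt I x x)

/-- The bitension field `τ₂(f)` of `f : (M, g) → (N, h)`, computed in the preferred charts at `x`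
and `f x`. -/
def bitensionField (g : MetricTensor I M) (h : MetricTensor J N) (f : M → N) (x : M) :
    TangentSpace J (f x) :=
  LocalRiem.bitension (E := E) (F := E') (metricInChart I g x) (metricInChart J h (f x))
    (writtenInExtChartAt I J x f) (extChartAt I x x)

/-- A (smooth) map is harmonic if its tension field vanishes. -/
def IsHarmonicMap (g : MetricTensor I M) (h : MetricTensor J N) (f : M → N) : Prop :=
  ∀ x, tensionField I J g h f x = 0

/-- A (smooth) map is biharmonic if its bitension field vanishes. -/
def IsBiharmonicMap (g : MetricTensor I M) (h : MetricTensor J N) (f : M → N) : Prop :=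
  ∀ x, bitensionField I J g h f x = 0

/-- Proper-biharmonic: biharmonic and not harmonic. -/
def IsProperBiharmonicMap (g : MetricTensor I M) (h : MetricTensor J N) (f : M → N) : Prop :=
  IsBiharmonicMap I J g h f ∧ ¬ IsHarmonicMap I J g h f

/-- A smooth map with injective differentials. -/
def IsSmoothImmersion (f : M → N) : Prop :=
  ContMDiff I J ∞ f ∧ ∀ x, Injective (mfderiv I J f x)

/-- A Riemannian (isometric) immersion `f : (M, g) → (N, h)`: an immersion with `f^* h = g`. -/
def IsRiemannianImmersion (g : MetricTensor I M) (h : MetricTensor J N) (f : M → N) : Prop :=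
  IsSmoothImmersion I J f ∧ ∀ x u v, pullbackMetric I J h f x u v = g x u v

end Manifolds

/-! ## The line and the circles `ℝ / Tℤ` -/

/-- The metric `dt²` on `ℝ`. -/
def lineMetric : MetricTensor 𝓘(ℝ, ℝ) ℝ := fun _ (a b : ℝ) => a * b

/-- The smooth structure of `ℝ / Tℤ`: the charts are the local inverses of the projection. -/
instance AddCircle.instChartedSpaceReal (T : ℝ) : ChartedSpace ℝ (AddCircle T) :=
  (AddCircle.isLocalHomeomorph_coe T).chartedSpace QuotientAddGroup.mk_surjective

theorem AddCircle.chart_symm_eq (T : ℝ) {e : OpenPartialHomeomorph (AddCircle T) ℝ}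
    (he : e ∈ atlas ℝ (AddCircle T)) (t : ℝ) : e.symm t = (t : AddCircle T) := by
  obtain ⟨q, rfl⟩ := he
  simp [chartAt_self_eq]

theorem AddCircle.chart_coe_eventuallyEq (T : ℝ) {e : OpenPartialHomeomorph (AddCircle T) ℝ}
    (he : e ∈ atlas ℝ (AddCircle T)) {t₀ : ℝ} (h₀ : (t₀ : AddCircle T) ∈ e.source) :
    (fun t : ℝ => e (t : AddCircle T)) =ᶠ[𝓝 t₀]
      fun t => t + (e (t₀ : AddCircle T) - t₀) := by
  have hcoe : Continuous (fun t : ℝ => (t : AddCircle T)) := AddCircle.continuous_mk' T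
  have h1 : ∀ᶠ t : ℝ in 𝓝 t₀, (t : AddCircle T) ∈ e.source :=
    hcoe.continuousAt.preimage_mem_nhds (e.open_source.mem_nhds h₀)
  have h2 : ∀ᶠ t : ℝ in 𝓝 t₀, t + (e (t₀ : AddCircle T) - t₀) ∈ e.target := by
    have hc : ContinuousAt (fun t : ℝ => t + (e (t₀ : AddCircle T) - t₀)) t₀ := by fun_prop
    refine hc.preimage_mem_nhds (e.open_target.mem_nhds ?_)
    simpa using e.map_source h₀
  filter_upwards [h1, h2] with t ht1 ht2
  refine e.symm.injOn (e.map_source ht1) ht2 ?_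
  have h3 : ((e (t₀ : AddCircle T) : ℝ) : AddCircle T) = t₀ := by
    rw [← AddCircle.chart_symm_eq T he, e.left_inv h₀]
  rw [e.left_inv ht1, AddCircle.chart_symm_eq T he, AddCircle.coe_add, AddCircle.coe_sub, h3]
  simp

instance AddCircle.instIsManifoldReal (T : ℝ) : IsManifold 𝓘(ℝ, ℝ) ∞ (AddCircle T) := by
  refine isManifold_of_contDiffOn _ _ _ fun e e' he he' t ht => ContDiffAt.contDiffWithinAt ?_
  have ht' : (t : AddCircle T) ∈ e'.source := by
    have := ht.1
    simp only [modelWithCornersSelf_coe_symm, preimage_id_eq, id_eq,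
      OpenPartialHomeomorph.trans_source, mem_inter_iff, mem_preimage] at this
    rw [← AddCircle.chart_symm_eq T he]
    exact this.2
  have hlin : ContDiffAt ℝ ∞ (fun s : ℝ => s + (e' (t : AddCircle T) - t)) t := by fun_prop
  refine hlin.congr_of_eventuallyEq ?_
  filter_upwards [AddCircle.chart_coe_eventuallyEq T he' ht'] with s hs
  simpa [AddCircle.chart_symm_eq T he] using hs

/-- The metric `dt²` on `ℝ / Tℤ` (every chart is a local inverse of the projection, so that the
tangent coordinate is `dt`). -/
def circleMetric (T : ℝ) : MetricTensor 𝓘(ℝ, ℝ) (AddCircle T) := fun _ (a b : ℝ) => a * b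

/-- `dt²` on `ℝ / Tℤ` pulls back to `dt²` on `ℝ`. -/
theorem pullbackMetric_circleMetric (T : ℝ) :
    pullbackMetric 𝓘(ℝ, ℝ) 𝓘(ℝ, ℝ) (circleMetric T) (fun t : ℝ => (t : AddCircle T)) =
      lineMetric := by
  have key : ∀ t₀ : ℝ, HasMFDerivAt 𝓘(ℝ, ℝ) 𝓘(ℝ, ℝ) (fun t : ℝ => (t : AddCircle T)) t₀
      (ContinuousLinearMap.id ℝ ℝ) := by
    intro t₀
    refine ⟨(AddCircle.continuous_mk' T).continuousAt, HasFDerivAt.hasFDerivWithinAt ?_⟩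
    have hlin : HasFDerivAt (fun s : ℝ => s + (chartAt ℝ (t₀ : AddCircle T) (t₀ : AddCircle T) - t₀))
        (ContinuousLinearMap.id ℝ ℝ) t₀ := (hasFDerivAt_id t₀).add_const _
    exact hlin.congr_of_eventuallyEq (AddCircle.chart_coe_eventuallyEq T
      (chart_mem_atlas ℝ (t₀ : AddCircle T)) (mem_chart_source ℝ (t₀ : AddCircle T)))
  funext t u v
  simp only [pullbackMetric, (key t).mfderiv]
  rfl

/-! ## Sasakian space forms -/

section Sasakian

/-- Smoothness of a vector field on a set. -/
def SmoothFieldOn {m : ℕ} {N : Type*} [TopologicalSpace N]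
    [ChartedSpace (EuclideanSpace ℝ (Fin m)) N] [IsManifold (𝓡 m) ∞ N]
    (X : ∀ p : N, TangentSpace (𝓡 m) p) (U : Set N) : Prop :=
  ContMDiffOn (𝓡 m) (𝓡 m).tangent ∞ (fun p => (⟨p, X p⟩ : TangentBundle (𝓡 m) N)) U

/-- The exterior derivative of a 1-form, with the convention
`dη(X, Y) = ½ (X (η Y) - Y (η X) - η [X, Y])`. -/
def extDerivOneForm {m : ℕ} {N : Type*} [TopologicalSpace N]
    [ChartedSpace (EuclideanSpace ℝ (Fin m)) N]
    (η : ∀ p : N, TangentSpace (𝓡 m) p →L[ℝ] ℝ) (X Y : ∀ p : N, TangentSpace (𝓡 m) p)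
    (p : N) : ℝ :=
  (1 / 2 : ℝ) * (NormedSpace.fromTangentSpace _
        (mfderiv (𝓡 m) 𝓘(ℝ, ℝ) (fun q => η q (Y q)) p (X p))
      - NormedSpace.fromTangentSpace _ (mfderiv (𝓡 m) 𝓘(ℝ, ℝ) (fun q => η q (X q)) p (Y p))
      - η p (VectorField.mlieBracket (𝓡 m) X Y p))

/-- A contact metric structure `(φ, ξ, η, g)` on a manifold of dimension `2n + 1`. -/
structure ContactMetricStructure (n : ℕ) (N : Type*) [TopologicalSpace N]
    [ChartedSpace (EuclideanSpace ℝ (Fin (2 * n + 1))) N]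
    [IsManifold (𝓡 (2 * n + 1)) ∞ N] where
  φ : ∀ p : N, TangentSpace (𝓡 (2 * n + 1)) p →L[ℝ] TangentSpace (𝓡 (2 * n + 1)) p
  ξ : ∀ p : N, TangentSpace (𝓡 (2 * n + 1)) p
  η : ∀ p : N, TangentSpace (𝓡 (2 * n + 1)) p →L[ℝ] ℝ
  g : Bundle.ContMDiffRiemannianMetric (𝓡 (2 * n + 1)) ∞ (EuclideanSpace ℝ (Fin (2 * n + 1)))
    (fun p : N => TangentSpace (𝓡 (2 * n + 1)) p)
  smooth_φ : ContMDiff (𝓡 (2 * n + 1)) ((𝓡 (2 * n + 1)).prod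
      𝓘(ℝ, EuclideanSpace ℝ (Fin (2 * n + 1)) →L[ℝ] EuclideanSpace ℝ (Fin (2 * n + 1)))) ∞
    (fun p : N => Bundle.TotalSpace.mk'
      (E := fun p : N => TangentSpace (𝓡 (2 * n + 1)) p →L[ℝ] TangentSpace (𝓡 (2 * n + 1)) p)
      (EuclideanSpace ℝ (Fin (2 * n + 1)) →L[ℝ] EuclideanSpace ℝ (Fin (2 * n + 1))) p (φ p))
  smooth_ξ : SmoothFieldOn ξ univ
  smooth_η : ContMDiff (𝓡 (2 * n + 1)) ((𝓡 (2 * n + 1)).prod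
      𝓘(ℝ, EuclideanSpace ℝ (Fin (2 * n + 1)) →L[ℝ] ℝ)) ∞
    (fun p : N => Bundle.TotalSpace.mk'
      (E := fun p : N => TangentSpace (𝓡 (2 * n + 1)) p →L[ℝ] Bundle.Trivial N ℝ p)
      (EuclideanSpace ℝ (Fin (2 * n + 1)) →L[ℝ] ℝ) p (η p))
  φ_φ : ∀ p u, φ p (φ p u) = - u + η p u • ξ p
  η_ξ : ∀ p, η p (ξ p) = 1
  g_φ_φ : ∀ p u v, g.inner p (φ p u) (φ p v) = g.inner p u v - η p u * η p v
  /-- `g(X, φ Y) = dη(X, Y)` for all local smooth vector fields. -/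
  g_φ : ∀ (U : Set N) (X Y : ∀ p : N, TangentSpace (𝓡 (2 * n + 1)) p), IsOpen U →
    SmoothFieldOn X U → SmoothFieldOn Y U → ∀ p ∈ U,
      g.inner p (X p) (φ p (Y p)) = extDerivOneForm η X Y p

namespace ContactMetricStructure

variable {n : ℕ} {N : Type*} [TopologicalSpace N]
  [ChartedSpace (EuclideanSpace ℝ (Fin (2 * n + 1))) N] [IsManifold (𝓡 (2 * n + 1)) ∞ N]

/-- The Riemannian metric as a tensor. -/
def metric (S : ContactMetricStructure n N) : MetricTensor (𝓡 (2 * n + 1)) N :=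
  fun p u v => S.g.inner p u v

/-- The Nijenhuis tensor
`N_φ(X, Y) = [φX, φY] - φ[φX, Y] - φ[X, φY] + φ²[X, Y]`. -/
def nijenhuis (S : ContactMetricStructure n N)
    (X Y : ∀ p : N, TangentSpace (𝓡 (2 * n + 1)) p) (p : N) : TangentSpace (𝓡 (2 * n + 1)) p :=
  VectorField.mlieBracket (𝓡 (2 * n + 1)) (fun q => S.φ q (X q)) (fun q => S.φ q (Y q)) p
    - S.φ p (VectorField.mlieBracket (𝓡 (2 * n + 1)) (fun q => S.φ q (X q)) Y p)
    - S.φ p (VectorField.mlieBracket (𝓡 (2 * n + 1)) X (fun q => S.φ q (Y q)) p)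
    + S.φ p (S.φ p (VectorField.mlieBracket (𝓡 (2 * n + 1)) X Y p))

/-- Sasakian (normal) contact metric structures: `N_φ + 2 dη ⊗ ξ = 0`. -/
def IsSasakian (S : ContactMetricStructure n N) : Prop :=
  ∀ (U : Set N) (X Y : ∀ p : N, TangentSpace (𝓡 (2 * n + 1)) p), IsOpen U →
    SmoothFieldOn X U → SmoothFieldOn Y U → ∀ p ∈ U,
      S.nijenhuis X Y p + (2 * extDerivOneForm S.η X Y p) • S.ξ p = 0

/-- Constant `φ`-sectional curvature `c`: the plane spanned by `u` and `φ u`, for every unit vector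
`u` orthogonal to `ξ`, has sectional curvature `c`. Here `u`, `φ u` are orthonormal. -/
def HasConstantPhiSectionalCurvature (S : ContactMetricStructure n N) (c : ℝ) : Prop :=
  ∀ (p : N) (u : TangentSpace (𝓡 (2 * n + 1)) p), S.g.inner p u u = 1 →
    S.g.inner p u (S.ξ p) = 0 →
      S.g.inner p (curvatureAt (𝓡 (2 * n + 1)) S.metric p u (S.φ p u) (S.φ p u)) u = c

end ContactMetricStructure

/-- The (image of the) maximal integral curve of `v` through `p`: all points that can be joined
to `p` by an integral curve of `v`. -/
def integralCurveThrough {m : ℕ} {N : Type*} [TopologicalSpace N]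
    [ChartedSpace (EuclideanSpace ℝ (Fin m)) N]
    (v : ∀ p : N, TangentSpace (𝓡 m) p) (p : N) : Set N :=
  {q | ∃ (γ : ℝ → N) (a b s t : ℝ), IsMIntegralCurveOn γ v (Ioo a b) ∧
    s ∈ Ioo a b ∧ t ∈ Ioo a b ∧ γ s = p ∧ γ t = q}

/-- A regular vector field: every point `p` is the centre of a cubic coordinate neighbourhood
`(e, |x_i| < a)` in which `v` is the first coordinate field and through which every integral curve
passes at most once, i.e. in at most one coordinate line of `x_0`. -/
def IsRegularField {m : ℕ} {N : Type*} [TopologicalSpace N]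
    [ChartedSpace (EuclideanSpace ℝ (Fin (m + 1))) N]
    (v : ∀ p : N, TangentSpace (𝓡 (m + 1)) p) : Prop :=
  ∀ p : N, ∃ e ∈ IsManifold.maximalAtlas (𝓡 (m + 1)) ∞ N, ∃ a > (0 : ℝ),
    p ∈ e.source ∧ e p = 0 ∧ e.target = {x | ∀ i, |x i| < a} ∧
    (∀ q ∈ e.source, mfderiv (𝓡 (m + 1)) (𝓡 (m + 1)) e q (v q) =
      (EuclideanSpace.single 0 1 : EuclideanSpace ℝ (Fin (m + 1)))) ∧
    ∀ q ∈ e.source, ∀ q' ∈ e.source, q' ∈ integralCurveThrough v q →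
      ∀ i : Fin m, e q i.succ = e q' i.succ

/-- A strictly regular vector field: it is regular and all its (maximal) integral curves are
homeomorphic to each other. -/
def IsStrictlyRegularField {m : ℕ} {N : Type*} [TopologicalSpace N]
    [ChartedSpace (EuclideanSpace ℝ (Fin (m + 1))) N]
    (v : ∀ p : N, TangentSpace (𝓡 (m + 1)) p) : Prop :=
  IsRegularField v ∧
    ∀ p q : N, Nonempty (integralCurveThrough v p ≃ₜ integralCurveThrough v q)

/-- `Φ` is the (global, smooth) flow of the vector field `v`. -/
def IsFlowOf {m : ℕ} {N : Type*} [TopologicalSpace N]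
    [ChartedSpace (EuclideanSpace ℝ (Fin m)) N]
    (Φ : Flow ℝ N) (v : ∀ p : N, TangentSpace (𝓡 m) p) : Prop :=
  ContMDiff (𝓘(ℝ, ℝ).prod (𝓡 m)) (𝓡 m) ∞ (fun z : ℝ × N => Φ z.1 z.2) ∧
    ∀ p : N, IsMIntegralCurve (fun t => Φ t p) v

/-- An `r`-dimensional (immersed) integral submanifold of the contact distribution `η = 0`. -/
def ContactMetricStructure.IsIntegralSubmanifold {n : ℕ} {N : Type*} [TopologicalSpace N]
    [ChartedSpace (EuclideanSpace ℝ (Fin (2 * n + 1))) N] [IsManifold (𝓡 (2 * n + 1)) ∞ N]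
    (S : ContactMetricStructure n N) {r : ℕ} {M : Type*} [TopologicalSpace M]
    [ChartedSpace (EuclideanSpace ℝ (Fin r)) M] (i : M → N) : Prop :=
  IsSmoothImmersion (𝓡 r) (𝓡 (2 * n + 1)) i ∧
    ∀ (p : M) (u : TangentSpace (𝓡 r) p),
      S.η (i p) (mfderiv (𝓡 r) (𝓡 (2 * n + 1)) i p u) = 0

end Sasakian

end

/-! The field `ξ` is a unit Killing field. The contact condition with `ξ` in one slot gives `L_ξ η =
0`, hence `L_ξ dη = 0`; normality with `ξ` in one slot gives `L_ξ φ = 0`; and `g = dη(φ·, ·) + η ⊗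
η` is built from these tensors, so `L_ξ g = 0` (`isKillingAt_of_isSasakianAt`). The flow `Φ_t`
therefore consists of isometries (`metricAt_flow`). It also preserves `ξ`, and its orbits are
geodesics, because `g(∇_ξ ξ, w) = -g(∇_w ξ, ξ) = 0` (`geodesic_of_isSasakianAt`).

Let `F(t, p) = Φ_t (i p)`. Then `dF(∂_t) = ξ` and `dF(v) = dΦ_t (di v)`. Both vectors are
`dΦ_t`-images, of `ξ` and of `di v`, and these are orthogonal because `i^* η = 0`; so `F^* g = dt² +
i^* g` (`isRiemannianImmersion_suspension`).

In the tension field the `∂_t` term of the trace is `∇_ξ ξ = 0`, and the slice `{t} × M` contributes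
the tension field of `Φ_t ∘ i`. Thus `τ(F) = dΦ_t τ(i)` (`tension_suspension`). In the bitension
field the `∂_t` direction contributes `∇_t ∇_t τ(F) - R(ξ, τ(F)) ξ`. Along an orbit `τ(F) = dΦ_t V`
with `V` fixed, which is a variation field of geodesics, so it satisfies the Jacobi equation and
this contribution vanishes (`cov_cov_jacobi`). The slice directions again give the bitension field
of `Φ_t ∘ i`, so `τ₂(F) = dΦ_t τ₂(i)` (`bitension_suspension`). Since `dΦ_t` is injective, `τ` and
`τ₂` of `F` vanish exactly where those of `i` do (`isProperBiharmonicMap_suspension_iff`).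

The fields `τ` and `τ₂` at a point are defined in the preferred charts there, so the computation is
local, in vector spaces. At a point with time coordinate `s` the flow is restarted: `Φ_t = Φ_{t-s} ∘
Φ_s`. The factor `Φ_{t-s}` is read in the single chart at `F(s, p)`, where it is the identity for `t
= s`, and `Φ_s` is absorbed as an isometry between two charts. -/

noncomputable section

set_option maxSynthPendingDepth 3
set_option linter.unusedSectionVars false

/-! ### Levi-Civita connection and metric trace in terms of continuous bilinear forms -/

namespace LocalRiem

section Christoffel

variable {E : Type*} [NormedAddCommGroup E] [NormedSpace ℝ E]
  {F : Type*} [NormedAddCommGroup F] [NormedSpace ℝ F]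

/-- The covariant 2-tensor field given by a field of continuous bilinear forms. -/
abbrev ofForm (B : E → E →L[ℝ] E →L[ℝ] ℝ) : E → E → E → ℝ := fun y u v => B y u v

/-- `B` is smooth at `x`, and `B x` is an inner product. -/
structure IsMetricAt (B : E → E →L[ℝ] E →L[ℝ] ℝ) (x : E) : Prop where
  smooth : ContDiffAt ℝ ∞ B x
  symm : ∀ u v, B x u v = B x v u
  pos : ∀ u, u ≠ 0 → 0 < B x u u

/-- The musical isomorphism `♯`, the inverse of `u ↦ B x (u, ·)`. -/
def sharp (B : E → E →L[ℝ] E →L[ℝ] ℝ) (x : E) : (E →L[ℝ] ℝ) →L[ℝ] E := (B x).inverse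

/-- The Christoffel symbols of the first kind. -/
def christoffelFst (B : E → E →L[ℝ] E →L[ℝ] ℝ) (x : E) : E →L[ℝ] E →L[ℝ] E →L[ℝ] ℝ :=
  (1 / 2 : ℝ) • (fderiv ℝ B x + (fderiv ℝ B x).flip
    - (ContinuousLinearMap.flipₗᵢ ℝ E E ℝ).toContinuousLinearEquiv.toContinuousLinearMap ∘L
      (fderiv ℝ B x).flip)

theorem christoffelFst_apply (B : E → E →L[ℝ] E →L[ℝ] ℝ) (x u v w : E) :
    christoffelFst B x u v w =
      (1 / 2 : ℝ) * (fderiv ℝ B x u v w + fderiv ℝ B x v u w - fderiv ℝ B x w u v) := by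
  simp [christoffelFst]

/-- The Christoffel symbols as a field of continuous bilinear maps. -/
def christoffelForm (B : E → E →L[ℝ] E →L[ℝ] ℝ) (x : E) : E →L[ℝ] E →L[ℝ] E :=
  (ContinuousLinearMap.compL ℝ E (E →L[ℝ] ℝ) E (sharp B x)) ∘L christoffelFst B x

theorem christoffelForm_apply (B : E → E →L[ℝ] E →L[ℝ] ℝ) (x u v : E) :
    christoffelForm B x u v = sharp B x (christoffelFst B x u v) := rfl

theorem fderiv_clm_apply₂ {X : Type*} [NormedAddCommGroup X] [NormedSpace ℝ X]
    {B : X → E →L[ℝ] E →L[ℝ] F} {x : X} (hB : DifferentiableAt ℝ B x) (u : X) (v w : E) :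
    fderiv ℝ (fun y => B y v w) x u = fderiv ℝ B x u v w := by
  rw [fderiv_clm_apply (hB.clm_apply (differentiableAt_const v)) (differentiableAt_const w),
    fderiv_clm_apply hB (differentiableAt_const v)]
  simp

variable [FiniteDimensional ℝ E] [FiniteDimensional ℝ F]

namespace IsMetricAt

variable {B : E → E →L[ℝ] E →L[ℝ] ℝ} {x : E}

theorem isInvertible (h : IsMetricAt B x) : (B x).IsInvertible := by
  have hinj : Injective (B x) := by
    rw [injective_iff_map_eq_zero]
    intro u hu
    by_contra h0
    have := h.pos u h0
    simp [hu] at this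
  have hfin : Module.finrank ℝ E = Module.finrank ℝ (E →L[ℝ] ℝ) := by
    rw [← Subspace.dual_finrank_eq (K := ℝ) (V := E)]
    exact LinearEquiv.finrank_eq LinearMap.toContinuousLinearMap
  let e : E ≃ₗ[ℝ] (E →L[ℝ] ℝ) :=
    LinearEquiv.ofInjectiveOfFinrankEq ((B x : E →L[ℝ] (E →L[ℝ] ℝ)) : E →ₗ[ℝ] _) hinj hfin
  exact ⟨e.toContinuousLinearEquiv, by ext; rfl⟩

theorem apply_sharp (h : IsMetricAt B x) (α : E →L[ℝ] ℝ) : B x (sharp B x α) = α :=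
  ContinuousLinearMap.IsInvertible.self_apply_inverse h.isInvertible α

theorem eq_of_forall_apply_eq (h : IsMetricAt B x) {u v : E} (huv : ∀ w, B x u w = B x v w) :
    u = v := by
  by_contra hne
  have := h.pos (u - v) (sub_ne_zero.2 hne)
  simp [huv] at this

theorem sharp_eq (h : IsMetricAt B x) {α : E →L[ℝ] ℝ} {u : E} (hu : ∀ w, B x u w = α w) :
    sharp B x α = u :=
  h.eq_of_forall_apply_eq fun w => by rw [h.apply_sharp, hu]

theorem apply_christoffelForm (h : IsMetricAt B x) (u v w : E) :
    B x (christoffelForm B x u v) w =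
      (1 / 2 : ℝ) * (fderiv ℝ B x u v w + fderiv ℝ B x v u w - fderiv ℝ B x w u v) := by
  rw [christoffelForm_apply, h.apply_sharp, christoffelFst_apply]

theorem contDiffAt_sharp (h : IsMetricAt B x) : ContDiffAt ℝ ∞ (sharp B) x :=
  h.isInvertible.contDiffAt_map_inverse.comp x h.smooth

theorem contDiffAt_fderiv (h : IsMetricAt B x) : ContDiffAt ℝ ∞ (fderiv ℝ B) x :=
  h.smooth.fderiv_right (by simp)

theorem contDiffAt_christoffelFst (h : IsMetricAt B x) :
    ContDiffAt ℝ ∞ (christoffelFst B) x := by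
  have h1 := h.contDiffAt_fderiv
  have h2 : ContDiffAt ℝ ∞ (fun y => (fderiv ℝ B y).flip) x :=
    (ContinuousLinearMap.flipₗᵢ ℝ E E (E →L[ℝ] ℝ)).contDiff.contDiffAt.comp x h1
  exact ((h1.add h2).sub (contDiffAt_const.clm_comp h2)).const_smul (1 / 2 : ℝ)

theorem contDiffAt_christoffelForm (h : IsMetricAt B x) :
    ContDiffAt ℝ ∞ (christoffelForm B) x :=
  ((ContinuousLinearMap.compL ℝ E (E →L[ℝ] ℝ) E).contDiff.contDiffAt.comp x
    h.contDiffAt_sharp).clm_comp h.contDiffAt_christoffelFst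

/-- The Koszul formula contains `fderiv ℝ B x w u v`, whose symmetry in `u`, `v` comes from
differentiating the symmetry of `B`; this is why the metric is assumed near `x`. -/
theorem christoffelForm_symm (h : ∀ᶠ y in 𝓝 x, IsMetricAt B y) (u v : E) :
    christoffelForm B x u v = christoffelForm B x v u := by
  have hx := h.self_of_nhds
  have hd := hx.smooth.differentiableAt (by simp)
  refine hx.eq_of_forall_apply_eq fun w => ?_
  rw [hx.apply_christoffelForm, hx.apply_christoffelForm]
  have : fderiv ℝ B x w u v = fderiv ℝ B x w v u := by
    rw [← fderiv_clm_apply₂ hd, ← fderiv_clm_apply₂ hd]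
    congr 1
    refine Filter.EventuallyEq.fderiv_eq ?_
    filter_upwards [h] with y hy using hy.symm u v
  rw [this]; ring

/-- The relation `g(♯e^l, e_k) = δ_kl` says that the coordinates of the vectors `♯e^l` form an
inverse of the Gram matrix. It replaces matrix entries by `sharp`, which is smooth in the point and
independent of the basis. -/
theorem gram_inv (h : IsMetricAt B x) (i j : Fin (Module.finrank ℝ E)) :
    (gram (ofForm B) x)⁻¹ i j = (Module.finBasis ℝ E).repr
      (sharp B x (LinearMap.toContinuousLinearMap ((Module.finBasis ℝ E).coord j))) i := by
  set b := Module.finBasis ℝ E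
  suffices hs : gram (ofForm B) x * Matrix.of (fun i j => b.repr (sharp B x
      (LinearMap.toContinuousLinearMap (b.coord j))) i) = 1 by
    rw [Matrix.inv_eq_right_inv hs]; rfl
  ext k l
  have : B x (sharp B x (LinearMap.toContinuousLinearMap (b.coord l))) (b k) =
      b.coord l (b k) := by rw [h.apply_sharp]; rfl
  rw [← b.sum_repr (sharp B x (LinearMap.toContinuousLinearMap (b.coord l)))] at this
  simp only [map_sum, map_smul, sum_apply, smul_apply,
    smul_eq_mul, Module.Basis.coord_apply, Module.Basis.repr_self] at this
  rw [Matrix.mul_apply, Matrix.one_apply]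
  simp only [gram, Matrix.of_apply]
  rw [Finsupp.single_apply] at this
  rw [← this]
  refine Finset.sum_congr rfl fun m _ => ?_
  rw [h.symm, mul_comm]

theorem christoffel_eq (h : IsMetricAt B x) (u v : E) :
    christoffel (ofForm B) x u v = christoffelForm B x u v := by
  have hd := h.smooth.differentiableAt (by simp)
  set b := Module.finBasis ℝ E with hb
  -- A covector is `α = ∑ α(b l) e^l`; applying `♯` raises the index of the symbols of the first
  -- kind.
  have key : christoffelForm B x u v = ∑ l, christoffelFst B x u v (b l) •
      sharp B x (LinearMap.toContinuousLinearMap (b.coord l)) := by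
    refine h.eq_of_forall_apply_eq fun w => ?_
    rw [christoffelForm_apply, h.apply_sharp]
    simp only [map_sum, map_smul, h.apply_sharp, sum_apply,
      smul_apply]
    conv_lhs => rw [← b.sum_repr w]
    simp [-Module.Basis.sum_repr, mul_comm]
  rw [key, christoffel, Finset.sum_comm]
  refine Finset.sum_congr rfl fun l _ => ?_
  conv_rhs => rw [← b.sum_repr (sharp B x (LinearMap.toContinuousLinearMap (b.coord l)))]
  rw [Finset.smul_sum]
  refine Finset.sum_congr rfl fun k _ => ?_
  rw [h.gram_inv, smul_smul, christoffelFst_apply, fderiv_clm_apply₂ hd, fderiv_clm_apply₂ hd,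
    fderiv_clm_apply₂ hd, mul_comm]

end IsMetricAt

/-- Bilinearity of a map of two variables. -/
structure IsBilin (b : E → E → F) : Prop where
  add_left : ∀ u u' v, b (u + u') v = b u v + b u' v
  smul_left : ∀ (a : ℝ) u v, b (a • u) v = a • b u v
  add_right : ∀ u v v', b u (v + v') = b u v + b u v'
  smul_right : ∀ (a : ℝ) u v, b u (a • v) = a • b u v

theorem IsBilin.exists_linearMap {b : E → E → F} (h : IsBilin b) :
    ∃ L : E →ₗ[ℝ] E →ₗ[ℝ] F, ∀ u v, b u v = L u v :=
  ⟨LinearMap.mk₂ ℝ b h.add_left h.smul_left h.add_right h.smul_right, fun _ _ => rfl⟩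

/-- The trace computed with a basis and its dual basis. -/
theorem IsMetricAt.metricTrace_eq {B : E → E →L[ℝ] E →L[ℝ] ℝ} {x : E} (h : IsMetricAt B x)
    {ι : Type*} [Fintype ι] (c : Module.Basis ι ℝ E) {b : E → E → F} (hb : IsBilin b) :
    metricTrace (ofForm B) x b =
      ∑ k, b (sharp B x (LinearMap.toContinuousLinearMap (c.coord k))) (c k) := by
  obtain ⟨L, hL⟩ := hb.exists_linearMap
  set e := Module.finBasis ℝ E with he
  have h1 : metricTrace (ofForm B) x b =
      ∑ j, L (sharp B x (LinearMap.toContinuousLinearMap (e.coord j))) (e j) := by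
    rw [metricTrace, Finset.sum_comm]
    refine Finset.sum_congr rfl fun j _ => ?_
    conv_rhs => rw [← e.sum_repr (sharp B x (LinearMap.toContinuousLinearMap (e.coord j)))]
    simp [-Module.Basis.sum_repr, h.gram_inv, hL, he]
  -- Change of dual basis, `c^k = ∑ c^k(e_j) e^j`. Together with `e_j = ∑ c^k(e_j) c_k` it shows
  -- that the contraction does not depend on the basis.
  have h2 : ∀ k, LinearMap.toContinuousLinearMap (c.coord k) =
      ∑ j, c.repr (e j) k • LinearMap.toContinuousLinearMap (e.coord j) := by
    intro k
    ext w
    conv_lhs => rw [← e.sum_repr w]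
    simp [-Module.Basis.sum_repr, mul_comm]
  rw [h1]
  simp only [hL, h2, map_sum, map_smul, LinearMap.sum_apply, LinearMap.smul_apply]
  rw [Finset.sum_comm]
  refine Finset.sum_congr rfl fun j _ => ?_
  conv_lhs => rw [← c.sum_repr (e j)]
  simp [-Module.Basis.sum_repr]

theorem metricTrace_map (G : E → E → E → ℝ) (x : E) (b : E → E → F)
    {F' : Type*} [NormedAddCommGroup F'] [NormedSpace ℝ F'] [FiniteDimensional ℝ F']
    (A : F →L[ℝ] F') :
    metricTrace G x (fun u v => A (b u v)) = A (metricTrace G x b) := by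
  simp [metricTrace]

theorem metricTrace_add (G : E → E → E → ℝ) (x : E) (b b' : E → E → F) :
    metricTrace G x (fun u v => b u v + b' u v) = metricTrace G x b + metricTrace G x b' := by
  simp [metricTrace, Finset.sum_add_distrib]

theorem metricTrace_neg (G : E → E → E → ℝ) (x : E) (b : E → E → F) :
    metricTrace G x (fun u v => - b u v) = - metricTrace G x b := by
  simp [metricTrace]

end Christoffel

end LocalRiem

/-! ### Connections along maps: Ricci identity and naturality -/

namespace LocalRiem

section Connection

variable {D : Type*} [NormedAddCommGroup D] [NormedSpace ℝ D]
  {E : Type*} [NormedAddCommGroup E] [NormedSpace ℝ E]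
  {F : Type*} [NormedAddCommGroup F] [NormedSpace ℝ F]

/-- The covariant derivative along `f` of a connection with Christoffel symbols `Γ`. -/
def cov (Γ : F → F →L[ℝ] F →L[ℝ] F) (f V : E → F) (x u : E) : F :=
  fderiv ℝ V x u + Γ (f x) (fderiv ℝ f x u) (V x)

/-- The curvature of a connection with Christoffel symbols `Γ`. -/
def curv (Γ : F → F →L[ℝ] F →L[ℝ] F) (x u v w : F) : F :=
  fderiv ℝ Γ x u v w - fderiv ℝ Γ x v u w + Γ x u (Γ x v w) - Γ x v (Γ x u w)

theorem contDiffAt_fderiv_apply {f : E → F} {x : E} (hf : ContDiffAt ℝ ∞ f x) {v : E → E}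
    (hv : ContDiffAt ℝ ∞ v x) : ContDiffAt ℝ ∞ (fun y => fderiv ℝ f y (v y)) x :=
  (hf.fderiv_right (m := ∞) (by simp)).clm_apply hv

theorem fderiv_fderiv_apply {f : E → F} {x : E} (hf : ContDiffAt ℝ ∞ f x) (u v : E) :
    fderiv ℝ (fun y => fderiv ℝ f y v) x u = fderiv ℝ (fderiv ℝ f) x u v := by
  have h : DifferentiableAt ℝ (fderiv ℝ f) x :=
    (hf.fderiv_right (m := ∞) (by simp)).differentiableAt (by simp)
  rw [fderiv_clm_apply h (differentiableAt_const v)]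
  simp

theorem fderiv_fderiv_symm {f : E → F} {x : E} (hf : ContDiffAt ℝ ∞ f x) (u v : E) :
    fderiv ℝ (fderiv ℝ f) x u v = fderiv ℝ (fderiv ℝ f) x v u :=
  (hf.isSymmSndFDerivAt (by simpa using WithTop.coe_le_coe.2 (le_top : (2 : ℕ∞) ≤ ⊤))).eq u v

section

variable {Γ : F → F →L[ℝ] F →L[ℝ] F} {f V : E → F} {x : E}

theorem contDiffAt_cov (hΓ : ContDiffAt ℝ ∞ Γ (f x)) (hf : ContDiffAt ℝ ∞ f x)
    (hV : ContDiffAt ℝ ∞ V x) {v : E → E} (hv : ContDiffAt ℝ ∞ v x) :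
    ContDiffAt ℝ ∞ (fun y => cov Γ f V y (v y)) x :=
  (contDiffAt_fderiv_apply hV hv).add
    (((hΓ.comp x hf).clm_apply (contDiffAt_fderiv_apply hf hv)).clm_apply hV)

theorem cov_congr {f' V' : E → F} (hf : f =ᶠ[𝓝 x] f') (hV : V =ᶠ[𝓝 x] V') (u : E) :
    cov Γ f V x u = cov Γ f' V' x u := by
  rw [cov, cov, hf.fderiv_eq, hV.fderiv_eq, hf.eq_of_nhds, hV.eq_of_nhds]

/-- The chain rule for covariant derivatives. It is used to restrict to time lines and to slices,
and to read `ξ ∘ f` as the pullback of the field `ξ`. -/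
theorem cov_comp {c : D → E} {s : D} (hf : DifferentiableAt ℝ f (c s))
    (hV : DifferentiableAt ℝ V (c s)) (hc : DifferentiableAt ℝ c s) (w : D) :
    cov Γ (fun t => f (c t)) (fun t => V (c t)) s w = cov Γ f V (c s) (fderiv ℝ c s w) := by
  have h1 := fderiv_comp s hf hc
  have h2 := fderiv_comp s hV hc
  rw [Function.comp_def] at h1 h2
  rw [cov, cov, h1, h2]
  rfl

/-- In this expansion every term that is not symmetric in `u`, `v`, even after pairing, belongs to
the curvature. It yields both the Ricci identity and the bilinearity of the second covariant
derivative. -/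
theorem cov_cov (hΓ : ContDiffAt ℝ ∞ Γ (f x)) (hf : ContDiffAt ℝ ∞ f x)
    (hV : ContDiffAt ℝ ∞ V x) (u v : E) :
    cov Γ f (fun y => cov Γ f V y v) x u =
      fderiv ℝ (fderiv ℝ V) x u v + fderiv ℝ Γ (f x) (fderiv ℝ f x u) (fderiv ℝ f x v) (V x)
      + Γ (f x) (fderiv ℝ (fderiv ℝ f) x u v) (V x)
      + Γ (f x) (fderiv ℝ f x v) (fderiv ℝ V x u)
      + Γ (f x) (fderiv ℝ f x u) (fderiv ℝ V x v + Γ (f x) (fderiv ℝ f x v) (V x)) := by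
  have dΓ : DifferentiableAt ℝ Γ (f x) := hΓ.differentiableAt (by simp)
  have df : DifferentiableAt ℝ f x := hf.differentiableAt (by simp)
  have dV : DifferentiableAt ℝ V x := hV.differentiableAt (by simp)
  have dfv : DifferentiableAt ℝ (fun y => fderiv ℝ f y v) x :=
    (contDiffAt_fderiv_apply hf contDiffAt_const).differentiableAt (by simp)
  have dVv : DifferentiableAt ℝ (fun y => fderiv ℝ V y v) x :=
    (contDiffAt_fderiv_apply hV contDiffAt_const).differentiableAt (by simp)
  have dΓf : DifferentiableAt ℝ (fun y => Γ (f y)) x := dΓ.comp x df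
  have h1 : fderiv ℝ (fun y => Γ (f y)) x u = fderiv ℝ Γ (f x) (fderiv ℝ f x u) := by
    have := fderiv_comp x dΓ df
    rw [Function.comp_def] at this
    rw [this]; rfl
  have dΓfv : DifferentiableAt ℝ (fun y => Γ (f y) (fderiv ℝ f y v)) x := dΓf.clm_apply dfv
  have h2 : fderiv ℝ (fun y => cov Γ f V y v) x u =
      fderiv ℝ (fderiv ℝ V) x u v
      + (fderiv ℝ Γ (f x) (fderiv ℝ f x u) (fderiv ℝ f x v) (V x)
      + Γ (f x) (fderiv ℝ (fderiv ℝ f) x u v) (V x)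
      + Γ (f x) (fderiv ℝ f x v) (fderiv ℝ V x u)) := by
    simp only [cov]
    rw [fderiv_fun_add dVv (dΓfv.clm_apply dV), fderiv_clm_apply dΓfv dV, fderiv_clm_apply dΓf dfv]
    simp only [add_apply, ContinuousLinearMap.comp_apply, ContinuousLinearMap.flip_apply, h1,
      fderiv_fderiv_apply hf, fderiv_fderiv_apply hV]
    abel
  rw [cov, h2]
  simp only [cov]
  abel

/-- The Ricci identity along a map. -/
theorem cov_cov_sub (hΓ : ContDiffAt ℝ ∞ Γ (f x)) (hf : ContDiffAt ℝ ∞ f x)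
    (hV : ContDiffAt ℝ ∞ V x) (u v : E) :
    cov Γ f (fun y => cov Γ f V y v) x u - cov Γ f (fun y => cov Γ f V y u) x v =
      curv Γ (f x) (fderiv ℝ f x u) (fderiv ℝ f x v) (V x) := by
  rw [cov_cov hΓ hf hV, cov_cov hΓ hf hV, fderiv_fderiv_symm hV v u, fderiv_fderiv_symm hf v u,
    curv]
  simp only [map_add]
  abel

/-- Symmetry of the second fundamental form with respect to a torsion free connection. -/
theorem cov_fderiv_symm (hΓ : ∀ a b, Γ (f x) a b = Γ (f x) b a) (hf : ContDiffAt ℝ ∞ f x)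
    (u v : E) :
    cov Γ f (fun y => fderiv ℝ f y v) x u = cov Γ f (fun y => fderiv ℝ f y u) x v := by
  rw [cov, cov, fderiv_fderiv_apply hf, fderiv_fderiv_apply hf, fderiv_fderiv_symm hf, hΓ]

end

section Naturality

variable {F' : Type*} [NormedAddCommGroup F'] [NormedSpace ℝ F']

/-- The map `ψ` transports the connection `Γ` to `Γ'` at the point `y`. -/
def IsAffineAt (Γ : F → F →L[ℝ] F →L[ℝ] F) (Γ' : F' → F' →L[ℝ] F' →L[ℝ] F') (ψ : F → F')
    (y : F) : Prop :=
  ∀ u v, fderiv ℝ (fderiv ℝ ψ) y u v + Γ' (ψ y) (fderiv ℝ ψ y u) (fderiv ℝ ψ y v) =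
    fderiv ℝ ψ y (Γ y u v)

variable {Γ : F → F →L[ℝ] F →L[ℝ] F} {Γ' : F' → F' →L[ℝ] F' →L[ℝ] F'} {ψ : F → F'}

/-- The product rule for `dψ(V)` produces the Hessian of `ψ` on `(df u, V)`; the affine condition
trades this Hessian and the `Γ'` term for `dψ(Γ(df u, V))`. -/
theorem IsAffineAt.cov_eq {f V : E → F} {x : E} (h : IsAffineAt Γ Γ' ψ (f x))
    (hψ : ContDiffAt ℝ ∞ ψ (f x)) (hf : DifferentiableAt ℝ f x) (hV : DifferentiableAt ℝ V x)
    (u : E) :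
    cov Γ' (fun y => ψ (f y)) (fun y => fderiv ℝ ψ (f y) (V y)) x u =
      fderiv ℝ ψ (f x) (cov Γ f V x u) := by
  have dψ : DifferentiableAt ℝ ψ (f x) := hψ.differentiableAt (by simp)
  have ddψ : DifferentiableAt ℝ (fderiv ℝ ψ) (f x) :=
    (hψ.fderiv_right (m := ∞) (by simp)).differentiableAt (by simp)
  have h1 := fderiv_comp x dψ hf
  have h2 := fderiv_comp x ddψ hf
  rw [Function.comp_def] at h1 h2
  have hd : DifferentiableAt ℝ (fun y => fderiv ℝ ψ (f y)) x := ddψ.comp x hf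
  rw [cov, fderiv_clm_apply hd hV, h1, h2, cov, map_add,
    ← h (fderiv ℝ f x u) (V x)]
  simp only [add_apply, ContinuousLinearMap.comp_apply, ContinuousLinearMap.flip_apply]
  abel

theorem fderiv_comp_apply {f : E → F} {x : E} (hψ : DifferentiableAt ℝ ψ (f x))
    (hf : DifferentiableAt ℝ f x) (v : E) :
    fderiv ℝ (fun y => ψ (f y)) x v = fderiv ℝ ψ (f x) (fderiv ℝ f x v) := by
  have h1 := fderiv_comp x hψ hf
  rw [Function.comp_def] at h1
  rw [h1]; rfl

/-- By the Ricci identity both sides are commutators of second covariant derivatives: of the field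
`dψ(w)` along `ψ` on the left, and of the constant field `w` along the identity on the right.
Naturality of `cov`, applied twice, matches them. -/
theorem curv_of_isAffineAt {y : F} (h : ∀ᶠ z in 𝓝 y, IsAffineAt Γ Γ' ψ z)
    (hψ : ∀ᶠ z in 𝓝 y, ContDiffAt ℝ ∞ ψ z) (hΓ : ContDiffAt ℝ ∞ Γ y)
    (hΓ' : ContDiffAt ℝ ∞ Γ' (ψ y)) (u v w : F) :
    curv Γ' (ψ y) (fderiv ℝ ψ y u) (fderiv ℝ ψ y v) (fderiv ℝ ψ y w) =
      fderiv ℝ ψ y (curv Γ y u v w) := by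
  have hy := hψ.self_of_nhds
  have h1 : ∀ v, (fun z => cov Γ' ψ (fun y => fderiv ℝ ψ y w) z v) =ᶠ[𝓝 y]
      fun z => fderiv ℝ ψ z (cov Γ id (fun _ => w) z v) := by
    intro v
    filter_upwards [h, hψ] with z hz hψz
    exact hz.cov_eq (f := id) (V := fun _ => w) hψz differentiableAt_id (differentiableAt_const _) v
  have h2 : ∀ u v, cov Γ' ψ (fun z => cov Γ' ψ (fun y => fderiv ℝ ψ y w) z v) y u =
      fderiv ℝ ψ y (cov Γ id (fun z => cov Γ id (fun _ => w) z v) y u) := by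
    intro u v
    rw [cov_congr Filter.EventuallyEq.rfl (h1 v)]
    have hd : ContDiffAt ℝ ∞ (fun z => cov Γ id (fun _ => w) z v) y :=
      contDiffAt_cov (f := id) hΓ contDiffAt_id contDiffAt_const contDiffAt_const
    exact h.self_of_nhds.cov_eq (f := id) hy differentiableAt_id (hd.differentiableAt (by simp)) u
  rw [← cov_cov_sub hΓ' hy (contDiffAt_fderiv_apply hy contDiffAt_const), h2, h2, ← map_sub,
    cov_cov_sub (f := id) hΓ contDiffAt_id contDiffAt_const]
  simp

end Naturality

end Connection

section Isometry

variable {E : Type*} [NormedAddCommGroup E] [NormedSpace ℝ E] [FiniteDimensional ℝ E]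
  {F : Type*} [NormedAddCommGroup F] [NormedSpace ℝ F] [FiniteDimensional ℝ F]

/-- `ψ` preserves the inner products at `y`. -/
def IsIsometryAt (K K' : F → F →L[ℝ] F →L[ℝ] ℝ) (ψ : F → F) (y : F) : Prop :=
  ∀ u v, K' (ψ y) (fderiv ℝ ψ y u) (fderiv ℝ ψ y v) = K y u v

variable {K K' : F → F →L[ℝ] F →L[ℝ] ℝ} {ψ : F → F} {y : F}

theorem IsIsometryAt.surjective_fderiv (h : IsIsometryAt K K' ψ y) (hK : IsMetricAt K y) :
    Surjective (fderiv ℝ ψ y) := by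
  have hinj : Injective (fderiv ℝ ψ y) := by
    rw [injective_iff_map_eq_zero]
    intro u hu
    by_contra h0
    have := hK.pos u h0
    rw [← h u u, hu] at this
    simp at this
  exact (LinearMap.injective_iff_surjective (f := (fderiv ℝ ψ y : F →ₗ[ℝ] F))).1 hinj

/-- Local isometries are affine for the Levi-Civita connections. -/
theorem IsIsometryAt.isAffineAt (h : ∀ᶠ z in 𝓝 y, IsIsometryAt K K' ψ z) (hψ : ContDiffAt ℝ ∞ ψ y)
    (hK : IsMetricAt K y) (hK' : IsMetricAt K' (ψ y)) :
    IsAffineAt (christoffelForm K) (christoffelForm K') ψ y := by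
  have dψ : DifferentiableAt ℝ ψ y := hψ.differentiableAt (by simp)
  have dK : DifferentiableAt ℝ K y := hK.smooth.differentiableAt (by simp)
  have dK' : DifferentiableAt ℝ K' (ψ y) := hK'.smooth.differentiableAt (by simp)
  have dv : ∀ v, DifferentiableAt ℝ (fun z => fderiv ℝ ψ z v) y := fun v =>
    (contDiffAt_fderiv_apply hψ contDiffAt_const).differentiableAt (by simp)
  -- Derivative of the identity `K = ψ^* K'` in the direction `w`. In the Koszul combination of
  -- three such formulas the Hessian of `ψ` survives only in `K'(∇dψ(u, v), dψ w)`.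
  have key : ∀ w u v, fderiv ℝ K y w u v =
      fderiv ℝ K' (ψ y) (fderiv ℝ ψ y w) (fderiv ℝ ψ y u) (fderiv ℝ ψ y v)
      + K' (ψ y) (fderiv ℝ (fderiv ℝ ψ) y w u) (fderiv ℝ ψ y v)
      + K' (ψ y) (fderiv ℝ ψ y u) (fderiv ℝ (fderiv ℝ ψ) y w v) := by
    intro w u v
    rw [← fderiv_clm_apply₂ dK]
    have he : (fun z => K z u v) =ᶠ[𝓝 y]
        fun z => K' (ψ z) (fderiv ℝ ψ z u) (fderiv ℝ ψ z v) := by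
      filter_upwards [h] with z hz using (hz u v).symm
    have dK'ψ : DifferentiableAt ℝ (fun z => K' (ψ z)) y := dK'.comp y dψ
    rw [he.fderiv_eq, fderiv_clm_apply (dK'ψ.clm_apply (dv u)) (dv v),
      fderiv_clm_apply dK'ψ (dv u)]
    simp only [add_apply, ContinuousLinearMap.comp_apply, ContinuousLinearMap.flip_apply,
      fderiv_fderiv_apply hψ, fderiv_comp_apply dK' dψ]
    ring
  intro u v
  refine hK'.eq_of_forall_apply_eq fun w' => ?_
  -- An injective endomorphism in finite dimension is onto, so testing against vectors `dψ w` is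
  -- enough.
  obtain ⟨w, rfl⟩ := h.self_of_nhds.surjective_fderiv hK w'
  have h0 := h.self_of_nhds (christoffelForm K y u v) w
  rw [h0, hK.apply_christoffelForm, key, key, key, map_add, add_apply,
    hK'.apply_christoffelForm, fderiv_fderiv_symm hψ w u, fderiv_fderiv_symm hψ w v,
    fderiv_fderiv_symm hψ v u, hK'.symm (fderiv ℝ ψ y v) (fderiv ℝ (fderiv ℝ ψ) y u w)]
  have := hK'.symm (fderiv ℝ ψ y u) (fderiv ℝ (fderiv ℝ ψ) y v w)
  rw [this]
  ring

end Isometry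

end LocalRiem

/-! ### Locality, smoothness and isometry invariance of tension and bitension -/

namespace LocalRiem

section Congr

variable {E : Type*} [NormedAddCommGroup E] [NormedSpace ℝ E] [FiniteDimensional ℝ E]
  {F : Type*} [NormedAddCommGroup F] [NormedSpace ℝ F] [FiniteDimensional ℝ F]
  {G G' : E → E → E → ℝ} {K K' : F → F → F → ℝ} {f f' : E → F} {x : E}

theorem christoffel_congr (h : G =ᶠ[𝓝 x] G') : christoffel G x = christoffel G' x := by
  funext u v
  have h1 : ∀ a b, fderiv ℝ (fun y => G y a b) x = fderiv ℝ (fun y => G' y a b) x := fun a b =>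
    Filter.EventuallyEq.fderiv_eq (h.mono fun y hy => by simp only [hy])
  have h2 : gram G x = gram G' x := by simp only [gram, h.eq_of_nhds]
  simp only [christoffel, h1, h2]

theorem curvature_congr (h : G =ᶠ[𝓝 x] G') : curvature G x = curvature G' x := by
  funext u v w
  have h1 : ∀ a b, fderiv ℝ (fun y => christoffel G y a b) x =
      fderiv ℝ (fun y => christoffel G' y a b) x := fun a b =>
    Filter.EventuallyEq.fderiv_eq
      (h.eventuallyEq_nhds.mono fun y hy => by simp only [christoffel_congr hy])
  simp only [curvature, h1, christoffel_congr h]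

theorem metricTrace_congr (h : G x = G' x) (b : E → E → F) :
    metricTrace G x b = metricTrace G' x b := by
  simp only [metricTrace, gram, h]

theorem tension_congr (hG : G =ᶠ[𝓝 x] G') (hK : K =ᶠ[𝓝 (f x)] K') (hf : f =ᶠ[𝓝 x] f') :
    tension G K f x = tension G' K' f' x := by
  have h1 : ∀ v, fderiv ℝ (fun y => fderiv ℝ f y v) x = fderiv ℝ (fun y => fderiv ℝ f' y v) x :=
    fun v => Filter.EventuallyEq.fderiv_eq
      (hf.eventuallyEq_nhds.mono fun y hy => by simp only [hy.fderiv_eq])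
  rw [tension, tension, metricTrace_congr hG.eq_of_nhds]
  congr 1
  funext u v
  simp only [secondFundamentalForm, h1, christoffel_congr hG,
    christoffel_congr (hf.eq_of_nhds ▸ hK), hf.fderiv_eq, hf.eq_of_nhds]

theorem covDeriv_congr {V V' : E → F} (hK : K =ᶠ[𝓝 (f x)] K') (hf : f =ᶠ[𝓝 x] f')
    (hV : V =ᶠ[𝓝 x] V') : covDeriv K f V x = covDeriv K' f' V' x := by
  funext u
  simp only [covDeriv, hV.fderiv_eq, christoffel_congr (hf.eq_of_nhds ▸ hK), hf.fderiv_eq, hf.eq_of_nhds,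
    hV.eq_of_nhds]

/-- The bitension field differentiates the tension field, so the latter has to agree on a
neighbourhood. Continuity of `f` carries the agreement of `K` and `K'` from `f x` to the nearby
points `f y`. -/
theorem bitension_congr (hc : ContinuousAt f x) (hG : G =ᶠ[𝓝 x] G') (hK : K =ᶠ[𝓝 (f x)] K')
    (hf : f =ᶠ[𝓝 x] f') : bitension G K f x = bitension G' K' f' x := by
  have hK' : ∀ᶠ y in 𝓝 x, K =ᶠ[𝓝 (f y)] K' := hc.eventually hK.eventuallyEq_nhds
  have hτ : tension G K f =ᶠ[𝓝 x] tension G' K' f' := by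
    filter_upwards [hG.eventuallyEq_nhds, hK', hf.eventuallyEq_nhds] with y h1 h2 h3
    exact tension_congr h1 h2 h3
  have h1 : ∀ v, (fun y => covDeriv K f (tension G K f) y v) =ᶠ[𝓝 x]
      fun y => covDeriv K' f' (tension G' K' f') y v := by
    intro v
    filter_upwards [hτ.eventuallyEq_nhds, hK', hf.eventuallyEq_nhds] with y h1 h2 h3
    rw [covDeriv_congr h2 h3 h1]
  have h2 : covDeriv₂ G K f (tension G K f) x = covDeriv₂ G' K' f' (tension G' K' f') x := by
    funext u v
    simp only [covDeriv₂, covDeriv_congr hK hf (h1 v), covDeriv_congr hK hf hτ,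
      christoffel_congr hG]
  simp only [bitension, laplacian, metricTrace_congr hG.eq_of_nhds, h2,
    curvature_congr (hf.eq_of_nhds ▸ hK), hf.fderiv_eq, hf.eq_of_nhds, hτ.eq_of_nhds]

end Congr

section Forms

variable {E : Type*} [NormedAddCommGroup E] [NormedSpace ℝ E]
  {F : Type*} [NormedAddCommGroup F] [NormedSpace ℝ F]

/-- The second fundamental form of a map with respect to two connections. -/
def sff (Γ : E → E →L[ℝ] E →L[ℝ] E) (Γ' : F → F →L[ℝ] F →L[ℝ] F) (f : E → F) (x u v : E) : F :=
  cov Γ' f (fun y => fderiv ℝ f y v) x u - fderiv ℝ f x (Γ x u v)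

/-- The second covariant derivative along a map with respect to two connections. -/
def cov₂ (Γ : E → E →L[ℝ] E →L[ℝ] E) (Γ' : F → F →L[ℝ] F →L[ℝ] F) (f V : E → F) (x u v : E) : F :=
  cov Γ' f (fun y => cov Γ' f V y v) x u - cov Γ' f V x (Γ x u v)

variable {Γ : E → E →L[ℝ] E →L[ℝ] E} {Γ' : F → F →L[ℝ] F →L[ℝ] F} {f V : E → F} {x : E}

/-- Bilinearity is what permits computing a metric trace in a basis adapted to a product. -/
theorem isBilin_sff (hf : ContDiffAt ℝ ∞ f x) : IsBilin (sff Γ Γ' f x) := by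
  constructor <;> intros <;> simp only [sff, cov, fderiv_fderiv_apply hf] <;>
    simp only [map_add, map_smul, add_apply, smul_apply, smul_sub, smul_add] <;> abel

theorem isBilin_cov₂ (hΓ' : ContDiffAt ℝ ∞ Γ' (f x)) (hf : ContDiffAt ℝ ∞ f x)
    (hV : ContDiffAt ℝ ∞ V x) : IsBilin (cov₂ Γ Γ' f V x) := by
  constructor <;> intros <;> simp only [cov₂, cov_cov hΓ' hf hV] <;>
    simp only [cov, map_add, map_smul,
    add_apply, smul_apply, smul_sub, smul_add] <;> abel

theorem isBilin_curv (Γ' : F → F →L[ℝ] F →L[ℝ] F) (y w : F) (A : E →L[ℝ] F) :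
    IsBilin (fun u v => curv Γ' y (A u) w (A v)) := by
  constructor <;> intros <;> simp only [curv, map_add, map_smul, add_apply, smul_apply,
    smul_sub, smul_add] <;> abel

theorem IsBilin.sub {b b' : E → E → F} (h : IsBilin b) (h' : IsBilin b') :
    IsBilin (fun u v => b u v - b' u v) := by
  constructor <;> intros
  · rw [h.add_left, h'.add_left]; abel
  · rw [h.smul_left, h'.smul_left, smul_sub]
  · rw [h.add_right, h'.add_right]; abel
  · rw [h.smul_right, h'.smul_right, smul_sub]

end Forms

section Tension

variable {E : Type*} [NormedAddCommGroup E] [NormedSpace ℝ E] [FiniteDimensional ℝ E]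
  {F : Type*} [NormedAddCommGroup F] [NormedSpace ℝ F] [FiniteDimensional ℝ F]

/-- `f` is a smooth map of Riemannian spaces at `x`. -/
structure IsSmoothMapAt (B : E → E →L[ℝ] E →L[ℝ] ℝ) (K : F → F →L[ℝ] F →L[ℝ] ℝ) (f : E → F)
    (x : E) : Prop where
  dom : IsMetricAt B x
  cod : IsMetricAt K (f x)
  smooth : ContDiffAt ℝ ∞ f x

variable {B : E → E →L[ℝ] E →L[ℝ] ℝ} {K K' : F → F →L[ℝ] F →L[ℝ] ℝ} {f V : E → F} {x : E}

theorem curvature_eq {y : F} (h : ∀ᶠ z in 𝓝 y, IsMetricAt K z) (u v w : F) :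
    curvature (ofForm K) y u v w = curv (christoffelForm K) y u v w := by
  have h1 : ∀ a b c, fderiv ℝ (fun z => christoffel (ofForm K) z a b) y c =
      fderiv ℝ (christoffelForm K) y c a b := by
    intro a b c
    rw [← fderiv_clm_apply₂
      (h.self_of_nhds.contDiffAt_christoffelForm.differentiableAt (by simp))]
    congr 1
    refine Filter.EventuallyEq.fderiv_eq ?_
    filter_upwards [h] with z hz using hz.christoffel_eq a b
  simp only [curvature, h1, h.self_of_nhds.christoffel_eq, curv]

theorem IsSmoothMapAt.secondFundamentalForm_eq (h : IsSmoothMapAt B K f x) (u v : E) :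
    secondFundamentalForm (ofForm B) (ofForm K) f x u v =
      sff (christoffelForm B) (christoffelForm K) f x u v := by
  rw [secondFundamentalForm, sff, cov, h.dom.christoffel_eq, h.cod.christoffel_eq]
  abel

theorem IsSmoothMapAt.tension_eq (h : IsSmoothMapAt B K f x) :
    tension (ofForm B) (ofForm K) f x =
      metricTrace (ofForm B) x (sff (christoffelForm B) (christoffelForm K) f x) := by
  rw [tension]
  congr 1
  funext u v
  exact h.secondFundamentalForm_eq u v

/-- Near `x` the tension field is a finite sum whose coefficients `g^ij` are smooth, being
coordinates of `sharp` on the dual basis. Smoothness is needed because the bitension field contains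
two further derivatives. -/
theorem contDiffAt_tension (h : ∀ᶠ y in 𝓝 x, IsSmoothMapAt B K f y) :
    ContDiffAt ℝ ∞ (tension (ofForm B) (ofForm K) f) x := by
  have hx := h.self_of_nhds
  have he : tension (ofForm B) (ofForm K) f =ᶠ[𝓝 x] fun y => ∑ i, ∑ j,
      LinearMap.toContinuousLinearMap ((Module.finBasis ℝ E).coord i)
        (sharp B y (LinearMap.toContinuousLinearMap ((Module.finBasis ℝ E).coord j))) •
      (cov (christoffelForm K) f (fun y => fderiv ℝ f y (Module.finBasis ℝ E j)) y
          (Module.finBasis ℝ E i)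
        - fderiv ℝ f y
          (christoffelForm B y (Module.finBasis ℝ E i) (Module.finBasis ℝ E j))) := by
    filter_upwards [h] with y hy
    rw [hy.tension_eq, metricTrace]
    refine Finset.sum_congr rfl fun i _ => Finset.sum_congr rfl fun j _ => ?_
    rw [hy.dom.gram_inv]
    rfl
  refine ContDiffAt.congr_of_eventuallyEq ?_ he
  refine ContDiffAt.sum fun i _ => ContDiffAt.sum fun j _ => ContDiffAt.smul ?_ ?_
  · exact (ContinuousLinearMap.contDiff _).contDiffAt.comp x
      (hx.dom.contDiffAt_sharp.clm_apply contDiffAt_const)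
  · refine (contDiffAt_cov hx.cod.contDiffAt_christoffelForm hx.smooth
      (contDiffAt_fderiv_apply hx.smooth contDiffAt_const) contDiffAt_const).sub ?_
    exact contDiffAt_fderiv_apply hx.smooth
      ((hx.dom.contDiffAt_christoffelForm.clm_apply contDiffAt_const).clm_apply contDiffAt_const)

/-- The Laplacian and the curvature term are put under one trace, so that they can be compared
direction by direction. The curvature differentiates the Christoffel symbols in all directions of
the target; hence the assumption on `K` near `f x`, not only along `f`. -/
theorem bitension_eq (h : ∀ᶠ y in 𝓝 x, IsSmoothMapAt B K f y)
    (hK : ∀ᶠ z in 𝓝 (f x), IsMetricAt K z) :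
    bitension (ofForm B) (ofForm K) f x =
      metricTrace (ofForm B) x (fun u v =>
        cov₂ (christoffelForm B) (christoffelForm K) f (tension (ofForm B) (ofForm K) f) x u v
        - curv (christoffelForm K) (f x) (fderiv ℝ f x u) (tension (ofForm B) (ofForm K) f x)
          (fderiv ℝ f x v)) := by
  have h1 : ∀ V : E → F, ∀ᶠ y in 𝓝 x, ∀ v,
      covDeriv (ofForm K) f V y v = cov (christoffelForm K) f V y v := by
    intro V
    filter_upwards [h] with y hy v
    rw [covDeriv, cov, hy.cod.christoffel_eq]
  have h2 : ∀ V : E → F, ∀ u v, covDeriv₂ (ofForm B) (ofForm K) f V x u v =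
      cov₂ (christoffelForm B) (christoffelForm K) f V x u v := by
    intro V u v
    rw [covDeriv₂, cov₂, (h1 _).self_of_nhds, (h1 _).self_of_nhds,
      h.self_of_nhds.dom.christoffel_eq]
    congr 1
    exact cov_congr Filter.EventuallyEq.rfl ((h1 V).mono fun y hy => hy v) u
  rw [bitension, laplacian, neg_neg, sub_eq_add_neg, ← metricTrace_neg, ← metricTrace_add]
  congr 1
  funext u v
  rw [h2, curvature_eq hK, sub_eq_add_neg]

theorem isBilin_bitension (h : ∀ᶠ y in 𝓝 x, IsSmoothMapAt B K f y) :
    IsBilin (fun u v =>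
        cov₂ (christoffelForm B) (christoffelForm K) f (tension (ofForm B) (ofForm K) f) x u v
        - curv (christoffelForm K) (f x) (fderiv ℝ f x u) (tension (ofForm B) (ofForm K) f x)
          (fderiv ℝ f x v)) :=
  (isBilin_cov₂ h.self_of_nhds.cod.contDiffAt_christoffelForm h.self_of_nhds.smooth
    (contDiffAt_tension h)).sub (isBilin_curv _ _ _ _)

/-- `ψ` is a smooth isometric map from `K` to `K'` at `y`. -/
structure IsSmoothIsometryAt (K K' : F → F →L[ℝ] F →L[ℝ] ℝ) (ψ : F → F) (y : F) : Prop where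
  dom : IsMetricAt K y
  cod : IsMetricAt K' (ψ y)
  smooth : ContDiffAt ℝ ∞ ψ y
  isometry : IsIsometryAt K K' ψ y

theorem isAffineAt_of_isSmoothIsometryAt {ψ : F → F} {y : F}
    (h : ∀ᶠ z in 𝓝 y, IsSmoothIsometryAt K K' ψ z) :
    IsAffineAt (christoffelForm K) (christoffelForm K') ψ y :=
  IsIsometryAt.isAffineAt (h.mono fun _ hz => hz.isometry) h.self_of_nhds.smooth
    h.self_of_nhds.dom h.self_of_nhds.cod

section

variable {ψ : F → F}

theorem IsSmoothMapAt.comp_isometry (h : IsSmoothMapAt B K f x)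
    (hψ : IsSmoothIsometryAt K K' ψ (f x)) : IsSmoothMapAt B K' (fun y => ψ (f y)) x :=
  ⟨h.dom, hψ.cod, hψ.smooth.comp x h.smooth⟩

/-- The tension field is natural under local isometries of the target. -/
theorem tension_comp_isometry (h : ∀ᶠ y in 𝓝 x, IsSmoothMapAt B K f y)
    (hψ : ∀ᶠ z in 𝓝 (f x), IsSmoothIsometryAt K K' ψ z) :
    tension (ofForm B) (ofForm K') (fun y => ψ (f y)) x =
      fderiv ℝ ψ (f x) (tension (ofForm B) (ofForm K) f x) := by
  have hx := h.self_of_nhds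
  have hψx := hψ.self_of_nhds
  have dψ := hψx.smooth.differentiableAt (by simp)
  have df := hx.smooth.differentiableAt (by simp)
  rw [(hx.comp_isometry hψx).tension_eq, hx.tension_eq, ← metricTrace_map]
  congr 1
  funext u v
  rw [sff, sff, map_sub, fderiv_comp_apply dψ df,
    ← (isAffineAt_of_isSmoothIsometryAt hψ).cov_eq hψx.smooth df
      ((contDiffAt_fderiv_apply hx.smooth contDiffAt_const).differentiableAt (by simp))]
  congr 1
  refine cov_congr Filter.EventuallyEq.rfl ?_ u
  filter_upwards [h, hx.smooth.continuousAt.eventually hψ] with y hy hψy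
  exact fderiv_comp_apply (hψy.smooth.differentiableAt (by simp))
    (hy.smooth.differentiableAt (by simp)) v

/-- The bitension field is natural under local isometries of the target. -/
theorem bitension_comp_isometry (h : ∀ᶠ y in 𝓝 x, IsSmoothMapAt B K f y)
    (hψ : ∀ᶠ z in 𝓝 (f x), IsSmoothIsometryAt K K' ψ z)
    (hK' : ∀ᶠ z in 𝓝 (ψ (f x)), IsMetricAt K' z) :
    bitension (ofForm B) (ofForm K') (fun y => ψ (f y)) x =
      fderiv ℝ ψ (f x) (bitension (ofForm B) (ofForm K) f x) := by
  have hx := h.self_of_nhds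
  have hψx := hψ.self_of_nhds
  have dψ := hψx.smooth.differentiableAt (by simp)
  have df := hx.smooth.differentiableAt (by simp)
  have hev := hx.smooth.continuousAt.eventually hψ.eventually_nhds
  have hK : ∀ᶠ z in 𝓝 (f x), IsMetricAt K z := hψ.mono fun z hz => hz.dom
  have hcomp : ∀ᶠ y in 𝓝 x, IsSmoothMapAt B K' (fun y => ψ (f y)) y := by
    filter_upwards [h, hev] with y hy hψy using hy.comp_isometry hψy.self_of_nhds
  -- Naturality of the tension field is needed as an equality of germs, and likewise for its first
  -- covariant derivative, before differentiating again.
  have hτ : tension (ofForm B) (ofForm K') (fun y => ψ (f y)) =ᶠ[𝓝 x]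
      fun y => fderiv ℝ ψ (f y) (tension (ofForm B) (ofForm K) f y) := by
    filter_upwards [h.eventually_nhds, hev] with y hy hψy
    exact tension_comp_isometry hy hψy
  have hτs := contDiffAt_tension h
  have hcov : ∀ v, (fun y => cov (christoffelForm K') (fun y => ψ (f y))
      (tension (ofForm B) (ofForm K') (fun y => ψ (f y))) y v) =ᶠ[𝓝 x]
      fun y => fderiv ℝ ψ (f y) (cov (christoffelForm K) f
        (tension (ofForm B) (ofForm K) f) y v) := by
    intro v
    filter_upwards [h.eventually_nhds, hev, hτ.eventuallyEq_nhds] with y hy hψy hτy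
    rw [cov_congr Filter.EventuallyEq.rfl hτy]
    exact (isAffineAt_of_isSmoothIsometryAt hψy).cov_eq hψy.self_of_nhds.smooth
      (hy.self_of_nhds.smooth.differentiableAt (by simp))
      ((contDiffAt_tension hy).differentiableAt (by simp)) v
  rw [bitension_eq hcomp hK', bitension_eq h hK, ← metricTrace_map]
  congr 1
  funext u v
  have hA := isAffineAt_of_isSmoothIsometryAt hψ
  rw [map_sub, hτ.eq_of_nhds, fderiv_comp_apply dψ df, fderiv_comp_apply dψ df,
    curv_of_isAffineAt (hψ.eventually_nhds.mono fun z hz => isAffineAt_of_isSmoothIsometryAt hz)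
      (hψ.mono fun z hz => hz.smooth) hψx.dom.contDiffAt_christoffelForm
      hψx.cod.contDiffAt_christoffelForm]
  congr 1
  rw [cov₂, cov₂, map_sub, cov_congr Filter.EventuallyEq.rfl (hcov v), (hcov _).eq_of_nhds]
  congr 1
  refine hA.cov_eq hψx.smooth df ?_ u
  exact (contDiffAt_cov hx.cod.contDiffAt_christoffelForm hx.smooth hτs
    contDiffAt_const).differentiableAt (by simp)

end

end Tension

end LocalRiem

/-! ### Product metrics and the suspension of a map by an isometric geodesic flow -/

namespace LocalRiem

section Product

variable {E : Type*} [NormedAddCommGroup E] [NormedSpace ℝ E]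

/-- The product metric `dt² + B` on `ℝ × E`. -/
def prodForm (B : E → E →L[ℝ] E →L[ℝ] ℝ) (z : ℝ × E) : (ℝ × E) →L[ℝ] (ℝ × E) →L[ℝ] ℝ :=
  (ContinuousLinearMap.mul ℝ ℝ).bilinearComp (ContinuousLinearMap.fst ℝ ℝ E)
      (ContinuousLinearMap.fst ℝ ℝ E)
    + ((ContinuousLinearMap.compL ℝ (ℝ × E) E ℝ).flip (ContinuousLinearMap.snd ℝ ℝ E)) ∘L
      (B z.2) ∘L (ContinuousLinearMap.snd ℝ ℝ E)

theorem prodForm_apply (B : E → E →L[ℝ] E →L[ℝ] ℝ) (z u v : ℝ × E) :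
    prodForm B z u v = u.1 * v.1 + B z.2 u.2 v.2 := rfl

variable {B : E → E →L[ℝ] E →L[ℝ] ℝ} {z : ℝ × E}

theorem IsMetricAt.prodForm (h : IsMetricAt B z.2) : IsMetricAt (prodForm B) z where
  smooth := contDiffAt_const.add
    (contDiffAt_const.clm_comp ((h.smooth.comp z contDiffAt_snd).clm_comp contDiffAt_const))
  symm u v := by rw [prodForm_apply, prodForm_apply, h.symm, mul_comm]
  pos u hu := by
    rw [prodForm_apply]
    by_cases h2 : u.2 = 0
    · have h1 : u.1 ≠ 0 := fun h1 => hu (Prod.ext h1 h2)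
      simpa [h2] using h1
    · have := h.pos _ h2
      nlinarith [mul_self_nonneg u.1]

theorem IsMetricAt.fderiv_prodForm (h : IsMetricAt B z.2) (w u v : ℝ × E) :
    fderiv ℝ (LocalRiem.prodForm B) z w u v = fderiv ℝ B z.2 w.2 u.2 v.2 := by
  have d1 := h.prodForm.smooth.differentiableAt (by simp)
  have dB : DifferentiableAt ℝ B z.2 := h.smooth.differentiableAt (by simp)
  rw [← fderiv_clm_apply₂ d1, ← fderiv_clm_apply₂ dB]
  have d2 : DifferentiableAt ℝ (fun y => B y u.2 v.2) z.2 :=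
    (dB.clm_apply (differentiableAt_const _)).clm_apply (differentiableAt_const _)
  have h1 : HasFDerivAt (fun y : ℝ × E => B y.2 u.2 v.2)
      ((fderiv ℝ (fun y => B y u.2 v.2) z.2) ∘L ContinuousLinearMap.snd ℝ ℝ E) z :=
    d2.hasFDerivAt.comp z hasFDerivAt_snd
  simp only [prodForm_apply]
  rw [(h1.const_add (u.1 * v.1)).fderiv]
  rfl

variable [FiniteDimensional ℝ E]

/-- The coefficients of `dt² + B` do not depend on `t`, and the `dt²` block is constant, so the
Koszul formula only sees `B`. -/
theorem IsMetricAt.christoffelForm_prodForm (h : IsMetricAt B z.2) (u v : ℝ × E) :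
    christoffelForm (LocalRiem.prodForm B) z u v = (0, christoffelForm B z.2 u.2 v.2) := by
  refine h.prodForm.eq_of_forall_apply_eq fun w => ?_
  rw [h.prodForm.apply_christoffelForm, prodForm_apply, h.apply_christoffelForm]
  simp only [h.fderiv_prodForm]
  ring

/-- In a basis adapted to the product, `♯` respects the two blocks and `♯dt = ∂_t`. -/
theorem IsMetricAt.metricTrace_prodForm (h : IsMetricAt B z.2) {F : Type*} [NormedAddCommGroup F]
    [NormedSpace ℝ F] [FiniteDimensional ℝ F] {b : ℝ × E → ℝ × E → F} (hb : IsBilin b) :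
    metricTrace (ofForm (LocalRiem.prodForm B)) z b =
      b (1, 0) (1, 0) + metricTrace (ofForm B) z.2 (fun u v => b (0, u) (0, v)) := by
  set e := Module.finBasis ℝ E with he
  have hb' : IsBilin (fun u v : E => b (0, u) (0, v)) := by
    constructor <;> intros
    · rw [← hb.add_left]; simp
    · rw [← hb.smul_left]; simp
    · rw [← hb.add_right]; simp
    · rw [← hb.smul_right]; simp
  rw [h.prodForm.metricTrace_eq ((Module.Basis.singleton Unit ℝ).prod e) hb,
    h.metricTrace_eq e hb', Fintype.sum_sum_type]
  congr 1
  · have h1 : sharp (LocalRiem.prodForm B) z (LinearMap.toContinuousLinearMap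
        (((Module.Basis.singleton Unit ℝ).prod e).coord (Sum.inl ()))) = (1, 0) :=
      h.prodForm.sharp_eq fun w => by simp [prodForm_apply]
    simp [h1]
  · refine Finset.sum_congr rfl fun k _ => ?_
    have h1 : sharp (LocalRiem.prodForm B) z (LinearMap.toContinuousLinearMap
        (((Module.Basis.singleton Unit ℝ).prod e).coord (Sum.inr k))) =
        (0, sharp B z.2 (LinearMap.toContinuousLinearMap (e.coord k))) :=
      h.prodForm.sharp_eq fun w => by simp [prodForm_apply, h.apply_sharp]
    simp [h1]

end Product

section CovComp

variable {D : Type*} [NormedAddCommGroup D] [NormedSpace ℝ D]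
  {E : Type*} [NormedAddCommGroup E] [NormedSpace ℝ E]
  {F : Type*} [NormedAddCommGroup F] [NormedSpace ℝ F]
  {Γ : F → F →L[ℝ] F →L[ℝ] F} {f V : E → F}

/-- Since `c` has the same derivative everywhere, it sends constant fields to constant fields, and
the chain rule can be iterated without a correction term. The maps in question are `t ↦ (t, x)` and
`x ↦ (s, x)`. -/
theorem cov_cov_comp {c : D → E} {A : D →L[ℝ] E} (hc : ∀ s, HasFDerivAt c A s) {s : D}
    (hΓ : ContDiffAt ℝ ∞ Γ (f (c s))) (hf : ∀ᶠ y in 𝓝 (c s), ContDiffAt ℝ ∞ f y)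
    (hV : ∀ᶠ y in 𝓝 (c s), ContDiffAt ℝ ∞ V y) (w w' : D) :
    cov Γ (fun t => f (c t)) (fun t => cov Γ (fun t => f (c t)) (fun t => V (c t)) t w') s w =
      cov Γ f (fun y => cov Γ f V y (A w')) (c s) (A w) := by
  have h1 : (fun t => cov Γ (fun t => f (c t)) (fun t => V (c t)) t w') =ᶠ[𝓝 s]
      fun t => cov Γ f V (c t) (A w') := by
    filter_upwards [(hc s).continuousAt.eventually hf, (hc s).continuousAt.eventually hV]
      with t h1 h2
    rw [cov_comp (h1.differentiableAt (by simp)) (h2.differentiableAt (by simp))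
      (hc t).differentiableAt, (hc t).fderiv]
  have h2 : ContDiffAt ℝ ∞ (fun y => cov Γ f V y (A w')) (c s) :=
    contDiffAt_cov hΓ hf.self_of_nhds hV.self_of_nhds contDiffAt_const
  rw [cov_congr Filter.EventuallyEq.rfl h1,
    cov_comp (V := fun y => cov Γ f V y (A w')) (hf.self_of_nhds.differentiableAt (by simp))
      (h2.differentiableAt (by simp))
      (hc s).differentiableAt, (hc s).fderiv]

theorem hasFDerivAt_mk_right (s : ℝ) (x : E) :
    HasFDerivAt (fun y : E => (s, y)) (ContinuousLinearMap.inr ℝ ℝ E) x :=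
  hasFDerivAt_prodMk_right s x

theorem fderiv_comp_mk_right {Ψ : ℝ × E → F} {s : ℝ} {y : E}
    (h : DifferentiableAt ℝ Ψ (s, y)) (v : E) :
    fderiv ℝ (fun y => Ψ (s, y)) y v = fderiv ℝ Ψ (s, y) (0, v) := by
  have h1 : HasFDerivAt (fun y => Ψ (s, y))
      ((fderiv ℝ Ψ (s, y)) ∘L (ContinuousLinearMap.inr ℝ ℝ E)) y :=
    HasFDerivAt.comp y (f := fun y => (s, y)) h.hasFDerivAt (hasFDerivAt_mk_right s y)
  rw [h1.fderiv]; rfl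

end CovComp

section Suspension

variable {E : Type*} [NormedAddCommGroup E] [NormedSpace ℝ E] [FiniteDimensional ℝ E]
  {F : Type*} [NormedAddCommGroup F] [NormedSpace ℝ F] [FiniteDimensional ℝ F]

/-- Near the point `z` of `ℝ × F`, `Ψ` is the flow of a geodesic vector field `ξ` and consists of
isometries of `K`. -/
structure IsGeodesicFlowAt (K : F → F →L[ℝ] F →L[ℝ] ℝ) (ξ : F → F) (Ψ : ℝ × F → F) (z : ℝ × F) :
    Prop where
  smooth : ContDiffAt ℝ ∞ Ψ z
  dom : IsMetricAt K z.2
  cod : IsMetricAt K (Ψ z)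
  isometry : ∀ u v, K (Ψ z) (fderiv ℝ Ψ z (0, u)) (fderiv ℝ Ψ z (0, v)) = K z.2 u v
  velocity : fderiv ℝ Ψ z (1, 0) = ξ (Ψ z)
  smooth_field : ContDiffAt ℝ ∞ ξ (Ψ z)
  geodesic : fderiv ℝ ξ (Ψ z) (ξ (Ψ z)) + christoffelForm K (Ψ z) (ξ (Ψ z)) (ξ (Ψ z)) = 0

variable {B : E → E →L[ℝ] E →L[ℝ] ℝ} {K : F → F →L[ℝ] F →L[ℝ] ℝ} {ξ : F → F} {Ψ : ℝ × F → F}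
  {j : E → F}

theorem IsGeodesicFlowAt.isSmoothIsometryAt {s : ℝ} {y : F} (h : IsGeodesicFlowAt K ξ Ψ (s, y)) :
    IsSmoothIsometryAt K K (fun y => Ψ (s, y)) y where
  dom := h.dom
  cod := h.cod
  smooth := h.smooth.comp y (f := fun y => (s, y)) (contDiffAt_const.prodMk contDiffAt_id)
  isometry u v := by
    rw [fderiv_comp_mk_right (h.smooth.differentiableAt (by simp)),
      fderiv_comp_mk_right (h.smooth.differentiableAt (by simp))]
    exact h.isometry u v

/-- Covariant derivatives of the velocity field along the flow lines vanish. -/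
theorem IsGeodesicFlowAt.cov_velocity {X : Type*} [NormedAddCommGroup X] [NormedSpace ℝ X]
    {f : X → F} {x : X} {z : ℝ × F} (h : IsGeodesicFlowAt K ξ Ψ z) (hf : DifferentiableAt ℝ f x)
    (hfx : f x = Ψ z) {u : X} (hu : fderiv ℝ f x u = ξ (f x)) :
    cov (christoffelForm K) f (fun y => ξ (f y)) x u = 0 := by
  have h1 := cov_comp (Γ := christoffelForm K) (f := id) (V := ξ) (c := f) (s := x)
    differentiableAt_id (by rw [hfx]; exact h.smooth_field.differentiableAt (by simp)) hf u
  simp only [id_eq] at h1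
  rw [h1, hu, hfx, cov]
  simpa using h.geodesic

section

variable {z : ℝ × E}

theorem contDiffAt_suspension (hj : ContDiffAt ℝ ∞ j z.2)
    (hΨ : ContDiffAt ℝ ∞ Ψ (z.1, j z.2)) : ContDiffAt ℝ ∞ (fun z : ℝ × E => Ψ (z.1, j z.2)) z :=
  hΨ.comp z (f := fun z : ℝ × E => (z.1, j z.2))
    (contDiffAt_fst.prodMk (hj.comp z contDiffAt_snd))

theorem fderiv_suspension (hj : ContDiffAt ℝ ∞ j z.2)
    (hΨ : ContDiffAt ℝ ∞ Ψ (z.1, j z.2)) (a : ℝ × E) :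
    fderiv ℝ (fun z : ℝ × E => Ψ (z.1, j z.2)) z a =
      fderiv ℝ Ψ (z.1, j z.2) (a.1, fderiv ℝ j z.2 a.2) := by
  have h1 : HasFDerivAt (fun z : ℝ × E => (z.1, j z.2)) ((ContinuousLinearMap.fst ℝ ℝ E).prod
      ((fderiv ℝ j z.2) ∘L (ContinuousLinearMap.snd ℝ ℝ E))) z :=
    hasFDerivAt_fst.prodMk
      ((hj.differentiableAt (by simp)).hasFDerivAt.comp z hasFDerivAt_snd)
  have h2 := HasFDerivAt.comp z (f := fun z : ℝ × E => (z.1, j z.2))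
    (hΨ.differentiableAt (by simp)).hasFDerivAt h1
  rw [Function.comp_def] at h2
  rw [h2.fderiv]; rfl

theorem continuousAt_suspension (hj : ContDiffAt ℝ ∞ j z.2) :
    ContinuousAt (fun z : ℝ × E => (z.1, j z.2)) z :=
  continuousAt_fst.prodMk (ContinuousAt.comp (f := Prod.snd) hj.continuousAt continuousAt_snd)

theorem eventually_isSmoothMapAt_suspension (hj : ∀ᶠ x in 𝓝 z.2, IsSmoothMapAt B K j x)
    (hΨ : ∀ᶠ w in 𝓝 (z.1, j z.2), IsGeodesicFlowAt K ξ Ψ w) :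
    ∀ᶠ w in 𝓝 z, IsSmoothMapAt (prodForm B) K (fun z : ℝ × E => Ψ (z.1, j z.2)) w := by
  filter_upwards [continuousAt_snd.eventually hj,
    (continuousAt_suspension hj.self_of_nhds.smooth).eventually hΨ] with w h1 h2
  exact ⟨h1.dom.prodForm, h2.cod, contDiffAt_suspension h1.smooth h2.smooth⟩

theorem eventually_fderiv_suspension_one (hj : ∀ᶠ x in 𝓝 z.2, IsSmoothMapAt B K j x)
    (hΨ : ∀ᶠ w in 𝓝 (z.1, j z.2), IsGeodesicFlowAt K ξ Ψ w) :
    ∀ᶠ w in 𝓝 z, fderiv ℝ (fun z : ℝ × E => Ψ (z.1, j z.2)) w (1, 0) = ξ (Ψ (w.1, j w.2)) := by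
  filter_upwards [continuousAt_snd.eventually hj,
    (continuousAt_suspension hj.self_of_nhds.smooth).eventually hΨ] with w h1 h2
  rw [fderiv_suspension h1.smooth h2.smooth, map_zero]
  exact h2.velocity

/-- The tension field of the suspension of `j` by an isometric geodesic flow. -/
theorem tension_suspension {s : ℝ} {x : E} (hj : ∀ᶠ x in 𝓝 x, IsSmoothMapAt B K j x)
    (hΨ : ∀ᶠ w in 𝓝 (s, j x), IsGeodesicFlowAt K ξ Ψ w) :
    tension (ofForm (prodForm B)) (ofForm K) (fun z : ℝ × E => Ψ (z.1, j z.2)) (s, x) =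
      fderiv ℝ Ψ (s, j x) (0, tension (ofForm B) (ofForm K) j x) := by
  have hf := eventually_isSmoothMapAt_suspension (z := (s, x)) hj hΨ
  have hf1 := eventually_fderiv_suspension_one (z := (s, x)) hj hΨ
  set f : ℝ × E → F := fun z : ℝ × E => Ψ (z.1, j z.2) with hfdef
  have hfz := hf.self_of_nhds
  have hjx := hj.self_of_nhds
  have hiso : ∀ᶠ y in 𝓝 (j x), IsSmoothIsometryAt K K (fun y => Ψ (s, y)) y := by
    have : ContinuousAt (fun y : F => (s, y)) (j x) := by fun_prop
    exact (this.eventually hΨ).mono fun y hy => hy.isSmoothIsometryAt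
  have hfx : IsSmoothMapAt B K (fun x => f (s, x)) x := hjx.comp_isometry hiso.self_of_nhds
  rw [hfz.tension_eq, hjx.dom.metricTrace_prodForm (z := (s, x)) (isBilin_sff hfz.smooth)]
  -- The `∂_t` term is `∇_ξ ξ`, which vanishes because the orbits are geodesics.
  have h1 : sff (christoffelForm (prodForm B)) (christoffelForm K) f (s, x) (1, 0) (1, 0) = 0 := by
    rw [sff, hjx.dom.christoffelForm_prodForm (z := (s, x)),
      cov_congr Filter.EventuallyEq.rfl hf1,
      hΨ.self_of_nhds.cov_velocity (f := f) (hfz.smooth.differentiableAt (by simp)) rfl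
        hf1.self_of_nhds]
    simp [Prod.mk_zero_zero]
  -- The slice at time `s` is totally geodesic in the product, so these terms are the second
  -- fundamental form of `Ψ(s, ·) ∘ j`.
  have h2 : ∀ u v, sff (christoffelForm (prodForm B)) (christoffelForm K) f (s, x) (0, u) (0, v) =
      sff (christoffelForm B) (christoffelForm K) (fun x => f (s, x)) x u v := by
    intro u v
    have hc : ContinuousAt (fun y : E => (s, y)) x := by fun_prop
    have he : (fun y => fderiv ℝ (fun x => f (s, x)) y v) =ᶠ[𝓝 x]
        fun y => fderiv ℝ f (s, y) (0, v) := by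
      filter_upwards [hc.eventually hf] with y hy
      exact fderiv_comp_mk_right (hy.smooth.differentiableAt (by simp)) v
    have h3 := cov_comp (Γ := christoffelForm K) (f := f) (V := fun z => fderiv ℝ f z (0, v))
      (c := fun y : E => (s, y)) (s := x) (hfz.smooth.differentiableAt (by simp))
      ((contDiffAt_fderiv_apply hfz.smooth contDiffAt_const).differentiableAt (by simp))
      (hasFDerivAt_mk_right s x).differentiableAt u
    rw [(hasFDerivAt_mk_right s x).fderiv] at h3
    rw [sff, sff, hjx.dom.christoffelForm_prodForm (z := (s, x)),
      fderiv_comp_mk_right (hfz.smooth.differentiableAt (by simp)),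
      cov_congr Filter.EventuallyEq.rfl he, h3]
    rfl
  have h4 : (fun u v => sff (christoffelForm (prodForm B)) (christoffelForm K) f (s, x)
      (0, u) (0, v)) = sff (christoffelForm B) (christoffelForm K) (fun x => f (s, x)) x := by
    funext u v
    exact h2 u v
  have h5 : metricTrace (ofForm B) x (fun u v => sff (christoffelForm (prodForm B))
      (christoffelForm K) f (s, x) (0, u) (0, v)) =
      fderiv ℝ Ψ (s, j x) (0, tension (ofForm B) (ofForm K) j x) := by
    rw [h4, ← hfx.tension_eq, ← fderiv_comp_mk_right
      (hΨ.self_of_nhds.smooth.differentiableAt (by simp))]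
    exact tension_comp_isometry (f := j) (ψ := fun y => Ψ (s, y)) hj hiso
  rw [h1, h5, zero_add]

/-- The field `dΨ(0, V)` along a flow line is a Jacobi field. -/
theorem cov_cov_jacobi {y : ℝ × F} (hΨ : ∀ᶠ w in 𝓝 y, IsGeodesicFlowAt K ξ Ψ w)
    (hK : ∀ᶠ w in 𝓝 (Ψ y), IsMetricAt K w) (V : F) :
    cov (christoffelForm K) Ψ
      (fun w => cov (christoffelForm K) Ψ (fun w => fderiv ℝ Ψ w (0, V)) w (1, 0)) y (1, 0) =
    curv (christoffelForm K) (Ψ y) (ξ (Ψ y)) (fderiv ℝ Ψ y (0, V)) (ξ (Ψ y)) := by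
  have hy := hΨ.self_of_nhds
  have hξ : ContDiffAt ℝ ∞ (fun w => ξ (Ψ w)) y := hy.smooth_field.comp y hy.smooth
  -- Absence of torsion exchanges the derivatives: `∇_t (dΨ V) = ∇_V (dΨ ∂_t) = ∇_V ξ`.
  have h1 : (fun w => cov (christoffelForm K) Ψ (fun w => fderiv ℝ Ψ w (0, V)) w (1, 0)) =ᶠ[𝓝 y]
      fun w => cov (christoffelForm K) Ψ (fun w => ξ (Ψ w)) w (0, V) := by
    filter_upwards [hΨ.eventually_nhds, hy.smooth.continuousAt.eventually hK.eventually_nhds]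
      with w hw hKw
    rw [cov_fderiv_symm (IsMetricAt.christoffelForm_symm hKw) hw.self_of_nhds.smooth]
    exact cov_congr Filter.EventuallyEq.rfl (hw.mono fun w' hw' => hw'.velocity) _
  have h2 : (fun w => cov (christoffelForm K) Ψ (fun w => ξ (Ψ w)) w (1, 0)) =ᶠ[𝓝 y]
      fun _ => 0 := by
    filter_upwards [hΨ] with w hw
    exact hw.cov_velocity (hw.smooth.differentiableAt (by simp)) rfl hw.velocity
  -- In the Ricci identity the term `∇_V ∇_t ξ` vanishes, as `∇_t ξ = 0` on a neighbourhood; what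
  -- remains is `∇_t ∇_V ξ = R(ξ, dΨ V) ξ`.
  have h3 := cov_cov_sub hy.cod.contDiffAt_christoffelForm hy.smooth hξ (1, 0) (0, V)
  rw [cov_congr Filter.EventuallyEq.rfl h2 (0, V)] at h3
  rw [cov_congr Filter.EventuallyEq.rfl h1, ← hy.velocity]
  rw [hy.velocity] at h3 ⊢
  rw [← h3]
  simp [cov]

/-- The bitension field of the suspension of `j` by an isometric geodesic flow. -/
theorem bitension_suspension {s : ℝ} {x : E} (hj : ∀ᶠ x in 𝓝 x, IsSmoothMapAt B K j x)
    (hΨ : ∀ᶠ w in 𝓝 (s, j x), IsGeodesicFlowAt K ξ Ψ w)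
    (h0 : ∀ᶠ y in 𝓝 (j x), Ψ (s, y) = y) :
    bitension (ofForm (prodForm B)) (ofForm K) (fun z : ℝ × E => Ψ (z.1, j z.2)) (s, x) =
      bitension (ofForm B) (ofForm K) j x := by
  have hf := eventually_isSmoothMapAt_suspension (z := (s, x)) hj hΨ
  have hf1 := (eventually_fderiv_suspension_one (z := (s, x)) hj hΨ).self_of_nhds
  have hjx := hj.self_of_nhds
  have hτ : tension (ofForm (prodForm B)) (ofForm K) (fun z : ℝ × E => Ψ (z.1, j z.2)) =ᶠ[𝓝 (s, x)]
      fun z => fderiv ℝ Ψ (z.1, j z.2) (0, tension (ofForm B) (ofForm K) j z.2) := by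
    filter_upwards [(continuousAt_snd (p := (s, x))).eventually hj.eventually_nhds,
      (continuousAt_suspension (z := (s, x)) hjx.smooth).eventually hΨ.eventually_nhds]
      with w h1 h2 using tension_suspension h1 h2
  set f : ℝ × E → F := fun z : ℝ × E => Ψ (z.1, j z.2) with hfdef
  set τ := tension (ofForm (prodForm B)) (ofForm K) f with hτdef
  set σ := tension (ofForm B) (ofForm K) j with hσdef
  have hfz := hf.self_of_nhds
  have hΨz := hΨ.self_of_nhds
  have hΨ0 : Ψ (s, j x) = j x := h0.self_of_nhds
  have hK : ∀ᶠ y in 𝓝 (j x), IsMetricAt K y := by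
    have : ContinuousAt (fun y : F => (s, y)) (j x) := by fun_prop
    exact (this.eventually hΨ).mono fun y hy => hy.dom
  have hcx : ContinuousAt (fun y : E => (s, y)) x := by fun_prop
  have hτs : ∀ᶠ w in 𝓝 (s, x), ContDiffAt ℝ ∞ τ w :=
    hf.eventually_nhds.mono fun w hw => contDiffAt_tension hw
  have hfs : ∀ᶠ w in 𝓝 (s, x), ContDiffAt ℝ ∞ f w := hf.mono fun w hw => hw.smooth
  have hσs : ContDiffAt ℝ ∞ σ x := contDiffAt_tension hj
  have hfj : (fun x => f (s, x)) =ᶠ[𝓝 x] j := hjx.smooth.continuousAt.eventually h0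
  -- At time `s` the flow is the identity near `j x`, so on this slice `f` and `τ` coincide with `j`
  -- and `σ`.
  have hd0 : ∀ᶠ y in 𝓝 (j x), ∀ v, fderiv ℝ Ψ (s, y) (0, v) = v := by
    have : ContinuousAt (fun y : F => (s, y)) (j x) := by fun_prop
    filter_upwards [this.eventually hΨ, h0.eventually_nhds] with y hy h0y v
    rw [← fderiv_comp_mk_right (hy.smooth.differentiableAt (by simp)),
      Filter.EventuallyEq.fderiv_eq (f := id) h0y]
    simp
  have hτσ : (fun x => τ (s, x)) =ᶠ[𝓝 x] σ := by
    filter_upwards [hcx.eventually hτ, hjx.smooth.continuousAt.eventually hd0] with y h1 h2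
    rw [h1]; exact h2 _
  have hdf : ∀ v, fderiv ℝ f (s, x) (0, v) = fderiv ℝ j x v := by
    intro v
    rw [← fderiv_comp_mk_right (hfz.smooth.differentiableAt (by simp)), hfj.fderiv_eq]
  have hΓ : ContDiffAt ℝ ∞ (christoffelForm K) (f (s, x)) := hfz.cod.contDiffAt_christoffelForm
  rw [bitension_eq hf (by rw [hfj.eq_of_nhds]; exact hK), bitension_eq hj hK,
    hjx.dom.metricTrace_prodForm (z := (s, x)) (isBilin_bitension hf)]
  have hτ0 : τ (s, x) = fderiv ℝ Ψ (s, j x) (0, σ x) := hτ.eq_of_nhds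
  -- The time direction contributes `∇_t ∇_t τ - R(ξ, τ) ξ`, which is zero by the Jacobi equation.
  have h1 : cov₂ (christoffelForm (prodForm B)) (christoffelForm K) f τ (s, x) (1, 0) (1, 0)
      - curv (christoffelForm K) (f (s, x)) (fderiv ℝ f (s, x) (1, 0)) (τ (s, x))
        (fderiv ℝ f (s, x) (1, 0)) = 0 := by
    have hcov0 : cov (christoffelForm K) f τ (s, x) 0 = 0 := by simp [cov]
    have hc : ∀ t : ℝ, HasFDerivAt (fun t : ℝ => (t, x)) (ContinuousLinearMap.inl ℝ ℝ E) t :=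
      fun t => hasFDerivAt_prodMk_left t x
    have hd : ∀ t : ℝ, HasFDerivAt (fun t : ℝ => (t, j x)) (ContinuousLinearMap.inl ℝ ℝ F) t :=
      fun t => hasFDerivAt_prodMk_left t (j x)
    -- Along the line `t ↦ (t, x)` the field `τ` is `dΨ(0, σ x)` with `σ x` fixed. Hence its second
    -- time derivative can be taken along the flow line of `j x`, where `cov_cov_jacobi` applies.
    have e1 := cov_cov_comp (Γ := christoffelForm K) (f := f) (V := τ) hc (s := s) hΓ hfs hτs 1 1
    have hW : ∀ᶠ w in 𝓝 (s, j x), ContDiffAt ℝ ∞ (fun w => fderiv ℝ Ψ w (0, σ x)) w :=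
      hΨ.mono fun w hw => contDiffAt_fderiv_apply hw.smooth contDiffAt_const
    have e2 := cov_cov_comp (Γ := christoffelForm K) (f := Ψ)
      (V := fun w => fderiv ℝ Ψ w (0, σ x)) hd (s := s) hΓ (hΨ.mono fun w hw => hw.smooth) hW 1 1
    have e3 : ∀ᶠ t in 𝓝 s, τ (t, x) = fderiv ℝ Ψ (t, j x) (0, σ x) :=
      (hc s).continuousAt.eventually hτ
    have e4 : (fun t => cov (christoffelForm K) (fun t => f (t, x)) (fun t => τ (t, x)) t 1)
        =ᶠ[𝓝 s] fun t => cov (christoffelForm K) (fun t => Ψ (t, j x))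
          (fun t => fderiv ℝ Ψ (t, j x) (0, σ x)) t 1 := by
      filter_upwards [e3.eventually_nhds] with t ht
      exact cov_congr Filter.EventuallyEq.rfl ht 1
    have e5 := cov_congr (Γ := christoffelForm K) (f := fun t => f (t, x))
      (f' := fun t => Ψ (t, j x)) Filter.EventuallyEq.rfl e4 1
    rw [e1, e2] at e5
    simp only [ContinuousLinearMap.inl_apply] at e5
    rw [cov₂, hjx.dom.christoffelForm_prodForm (z := (s, x)), e5,
      cov_cov_jacobi hΨ (by rw [hΨ0]; exact hK), hf1, hτ0]
    simp only [map_zero, Prod.mk_zero_zero, hcov0]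
    simp [hfdef]
  -- The slice directions involve only `f` and `τ` restricted to time `s`, that is, the germs of `j`
  -- and `σ`.
  have h2 : ∀ u v, cov₂ (christoffelForm (prodForm B)) (christoffelForm K) f τ (s, x) (0, u) (0, v)
      - curv (christoffelForm K) (f (s, x)) (fderiv ℝ f (s, x) (0, u)) (τ (s, x))
        (fderiv ℝ f (s, x) (0, v)) =
      cov₂ (christoffelForm B) (christoffelForm K) j σ x u v
      - curv (christoffelForm K) (j x) (fderiv ℝ j x u) (σ x) (fderiv ℝ j x v) := by
    intro u v
    have e1 := cov_cov_comp (Γ := christoffelForm K) (f := f) (V := τ)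
      (c := fun y : E => (s, y)) (hasFDerivAt_mk_right s) (s := x) hΓ hfs hτs u v
    have e2 : ∀ᶠ y in 𝓝 x, ∀ w, cov (christoffelForm K) (fun x => f (s, x)) (fun x => τ (s, x)) y w
        = cov (christoffelForm K) j σ y w := by
      filter_upwards [hfj.eventuallyEq_nhds, hτσ.eventuallyEq_nhds] with y h1 h2 w
      exact cov_congr h1 h2 w
    have e3 := cov_comp (Γ := christoffelForm K) (f := f) (V := τ) (c := fun y : E => (s, y))
      (s := x) (hfz.smooth.differentiableAt (by simp))
      (hτs.self_of_nhds.differentiableAt (by simp)) (hasFDerivAt_mk_right s x).differentiableAt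
      (christoffelForm B x u v)
    rw [(hasFDerivAt_mk_right s x).fderiv] at e3
    rw [cov_congr hfj (e2.mono fun y hy => hy v)] at e1
    rw [e2.self_of_nhds] at e3
    simp only [ContinuousLinearMap.inr_apply] at e1 e3
    rw [cov₂, cov₂, hjx.dom.christoffelForm_prodForm (z := (s, x)), ← e1, e3, hdf, hdf,
      hfj.eq_of_nhds, hτσ.eq_of_nhds]
  rw [h1, zero_add]
  congr 1
  funext u v
  exact h2 u v

end

end Suspension

end LocalRiem

/-! ### The characteristic field of a Sasakian structure is a geodesic Killing field -/

namespace LocalRiem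

section Killing

variable {F : Type*} [NormedAddCommGroup F] [NormedSpace ℝ F]

/-- The Killing equation `L_ξ K = 0` at `y`. -/
def IsKillingAt (K : F → F →L[ℝ] F →L[ℝ] ℝ) (ξ : F → F) (y : F) : Prop :=
  ∀ u v, fderiv ℝ K y (ξ y) u v + K y (fderiv ℝ ξ y u) v + K y u (fderiv ℝ ξ y v) = 0

/-- The coordinate expression of a Sasakian structure at `y`. -/
structure IsSasakianAt (K : F → F →L[ℝ] F →L[ℝ] ℝ) (φ : F → F →L[ℝ] F) (ξ : F → F)
    (η : F → F →L[ℝ] ℝ) (y : F) : Prop where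
  metric : IsMetricAt K y
  smooth_φ : ContDiffAt ℝ ∞ φ y
  smooth_ξ : ContDiffAt ℝ ∞ ξ y
  smooth_η : ContDiffAt ℝ ∞ η y
  φ_φ : ∀ u, φ y (φ y u) = - u + η y u • ξ y
  η_ξ : η y (ξ y) = 1
  η_φ : ∀ u, η y (φ y u) = 0
  K_ξ : ∀ u, K y (ξ y) u = η y u
  K_φ_φ : ∀ u v, K y (φ y u) (φ y v) = K y u v - η y u * η y v
  contact : ∀ u v, K y u (φ y v) = (1 / 2 : ℝ) * (fderiv ℝ η y u v - fderiv ℝ η y v u)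
  normal : ∀ v, φ y (fderiv ℝ φ y (ξ y) v - fderiv ℝ ξ y (φ y v) + φ y (fderiv ℝ ξ y v)) = 0

variable {K : F → F →L[ℝ] F →L[ℝ] ℝ} {φ : F → F →L[ℝ] F} {ξ : F → F} {η : F → F →L[ℝ] ℝ} {y : F}

/-- `L_ξ η = 0`. -/
theorem lie_eta (h : ∀ᶠ z in 𝓝 y, IsSasakianAt K φ ξ η z) (u : F) :
    fderiv ℝ η y (ξ y) u + η y (fderiv ℝ ξ y u) = 0 := by
  have hy := h.self_of_nhds
  -- `dη(ξ, u) = g(ξ, φ u) = η(φ u) = 0`; by Cartan's formula with `η(ξ) = 1` this is `L_ξ η = 0`.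
  have h1 := hy.contact (ξ y) u
  rw [hy.K_ξ, hy.η_φ] at h1
  have h2 : fderiv ℝ (fun z => η z (ξ z)) y u = 0 := by
    rw [Filter.EventuallyEq.fderiv_eq (f := fun _ => (1 : ℝ)) (h.mono fun z hz => hz.η_ξ)]
    simp
  rw [fderiv_clm_apply (hy.smooth_η.differentiableAt (by simp))
    (hy.smooth_ξ.differentiableAt (by simp))] at h2
  simp only [add_apply, ContinuousLinearMap.comp_apply, ContinuousLinearMap.flip_apply] at h2
  linarith

/-- `L_ξ φ = 0`. -/
theorem lie_phi (h : ∀ᶠ z in 𝓝 y, IsSasakianAt K φ ξ η z) (v : F) :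
    fderiv ℝ φ y (ξ y) v = fderiv ℝ ξ y (φ y v) - φ y (fderiv ℝ ξ y v) := by
  have hy := h.self_of_nhds
  have dφ := hy.smooth_φ.differentiableAt (by simp)
  have h1 : fderiv ℝ (fun z => η z (φ z v)) y (ξ y) = 0 := by
    rw [Filter.EventuallyEq.fderiv_eq (f := fun _ => (0 : ℝ)) (h.mono fun z hz => hz.η_φ v)]
    simp
  rw [fderiv_clm_apply (hy.smooth_η.differentiableAt (by simp))
    (dφ.clm_apply (differentiableAt_const v)), fderiv_clm_apply dφ (differentiableAt_const v)] at h1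
  simp only [add_apply, ContinuousLinearMap.comp_apply, ContinuousLinearMap.flip_apply,
    fderiv_fun_const, Pi.zero_apply, zero_apply, map_zero, zero_add] at h1
  have h2 := lie_eta h (φ y v)
  -- Normality only says that `φ` kills `(L_ξ φ) v`. As `φ² = -I + η ⊗ ξ`, it remains to see that
  -- `η` kills it too, which follows from `η ∘ φ = 0` and `L_ξ η = 0`.
  have h3 := congrArg (φ y) (hy.normal v)
  rw [hy.φ_φ, map_zero] at h3
  have h4 : η y (fderiv ℝ φ y (ξ y) v - fderiv ℝ ξ y (φ y v) + φ y (fderiv ℝ ξ y v)) = 0 := by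
    rw [map_add, map_sub, hy.η_φ]
    linarith
  rw [h4, zero_smul, add_zero, neg_eq_zero] at h3
  rw [← sub_eq_zero, ← h3]
  abel

/-- `L_ξ dη = 0`. -/
theorem lie_dEta (h : ∀ᶠ z in 𝓝 y, IsSasakianAt K φ ξ η z) (u v : F) :
    fderiv ℝ (fderiv ℝ η) y (ξ y) u v - fderiv ℝ (fderiv ℝ η) y (ξ y) v u
      + (fderiv ℝ η y (fderiv ℝ ξ y u) v - fderiv ℝ η y v (fderiv ℝ ξ y u))
      + (fderiv ℝ η y u (fderiv ℝ ξ y v) - fderiv ℝ η y (fderiv ℝ ξ y v) u) = 0 := by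
  have hy := h.self_of_nhds
  have dη := hy.smooth_η.differentiableAt (by simp)
  have dξ := hy.smooth_ξ.differentiableAt (by simp)
  have ddη : DifferentiableAt ℝ (fderiv ℝ η) y :=
    (hy.smooth_η.fderiv_right (m := ∞) (by simp)).differentiableAt (by simp)
  -- Derivative of `(L_ξ η)(u) = 0` in the direction `v`. Antisymmetrising in `u`, `v` eliminates
  -- the second derivatives of `ξ`.
  have key : ∀ u v, fderiv ℝ (fderiv ℝ η) y v (ξ y) u + fderiv ℝ η y (fderiv ℝ ξ y v) u
      + fderiv ℝ η y v (fderiv ℝ ξ y u) + η y (fderiv ℝ (fderiv ℝ ξ) y v u) = 0 := by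
    intro u v
    have h1 : fderiv ℝ (fun z => fderiv ℝ η z (ξ z) u + η z (fderiv ℝ ξ z u)) y v = 0 := by
      rw [Filter.EventuallyEq.fderiv_eq (f := fun _ => (0 : ℝ))
        (h.eventually_nhds.mono fun z hz => lie_eta hz u)]
      simp
    have d1 : DifferentiableAt ℝ (fun z => fderiv ℝ η z (ξ z)) y := ddη.clm_apply dξ
    have d2 : DifferentiableAt ℝ (fun z => fderiv ℝ ξ z u) y :=
      (contDiffAt_fderiv_apply hy.smooth_ξ contDiffAt_const).differentiableAt (by simp)
    rw [fderiv_fun_add (d1.clm_apply (differentiableAt_const u)) (dη.clm_apply d2),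
      fderiv_clm_apply d1 (differentiableAt_const u), fderiv_clm_apply ddη dξ,
      fderiv_clm_apply dη d2] at h1
    simp only [add_apply, ContinuousLinearMap.comp_apply, ContinuousLinearMap.flip_apply,
      fderiv_fun_const, Pi.zero_apply, zero_apply, map_zero, zero_add,
      fderiv_fderiv_apply hy.smooth_ξ] at h1
    linarith
  have h1 := key u v
  have h2 := key v u
  rw [fderiv_fderiv_symm hy.smooth_η, fderiv_fderiv_symm hy.smooth_ξ] at h1
  rw [fderiv_fderiv_symm hy.smooth_η] at h2
  linarith

/-- The contact condition and the compatibility of `g` with `φ` give `g = dη(φ·, ·) + η ⊗ η`, and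
`L_ξ` annihilates `dη`, `φ` and `η`. -/
theorem isKillingAt_of_isSasakianAt (h : ∀ᶠ z in 𝓝 y, IsSasakianAt K φ ξ η z) :
    IsKillingAt K ξ y := by
  intro u v
  have hy := h.self_of_nhds
  have dK := hy.metric.smooth.differentiableAt (by simp)
  have dη := hy.smooth_η.differentiableAt (by simp)
  have dφ := hy.smooth_φ.differentiableAt (by simp)
  have ddη : DifferentiableAt ℝ (fderiv ℝ η) y :=
    (hy.smooth_η.fderiv_right (m := ∞) (by simp)).differentiableAt (by simp)
  have hK : ∀ᶠ z in 𝓝 y, ∀ u v, K z u v =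
      (1 / 2 : ℝ) * (fderiv ℝ η z (φ z u) v - fderiv ℝ η z v (φ z u)) + η z u * η z v := by
    filter_upwards [h] with z hz u v
    rw [← hz.contact, hz.K_φ_φ]
    ring
  have dφu : DifferentiableAt ℝ (fun z => φ z u) y := dφ.clm_apply (differentiableAt_const u)
  have d1 : DifferentiableAt ℝ (fun z => fderiv ℝ η z (φ z u)) y := ddη.clm_apply dφu
  have d1' : DifferentiableAt ℝ (fun z => fderiv ℝ η z (φ z u) v) y :=
    d1.clm_apply (differentiableAt_const v)
  have d2 : DifferentiableAt ℝ (fun z => fderiv ℝ η z v) y :=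
    ddη.clm_apply (differentiableAt_const v)
  have d2' : DifferentiableAt ℝ (fun z => fderiv ℝ η z v (φ z u)) y := d2.clm_apply dφu
  have dηv : ∀ v, DifferentiableAt ℝ (fun z => η z v) y := fun v =>
    dη.clm_apply (differentiableAt_const v)
  have fηv : ∀ v, fderiv ℝ (fun z => η z v) y (ξ y) = fderiv ℝ η y (ξ y) v := by
    intro v
    rw [fderiv_clm_apply dη (differentiableAt_const v)]
    simp
  have h1 : fderiv ℝ K y (ξ y) u v = (1 / 2 : ℝ) *
      ((fderiv ℝ (fderiv ℝ η) y (ξ y) (φ y u) v + fderiv ℝ η y (fderiv ℝ φ y (ξ y) u) v)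
      - (fderiv ℝ (fderiv ℝ η) y (ξ y) v (φ y u) + fderiv ℝ η y v (fderiv ℝ φ y (ξ y) u)))
      + (fderiv ℝ η y (ξ y) u * η y v + η y u * fderiv ℝ η y (ξ y) v) := by
    rw [← fderiv_clm_apply₂ dK, Filter.EventuallyEq.fderiv_eq (hK.mono fun z hz => hz u v),
      fderiv_fun_add ((d1'.fun_sub d2').const_mul _) ((dηv u).fun_mul (dηv v)),
      fderiv_const_mul (d1'.fun_sub d2'), fderiv_fun_sub d1' d2', fderiv_fun_mul (dηv u) (dηv v),
      fderiv_clm_apply d1 (differentiableAt_const v), fderiv_clm_apply ddη dφu,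
      fderiv_clm_apply d2 dφu, fderiv_clm_apply ddη (differentiableAt_const v),
      fderiv_clm_apply dφ (differentiableAt_const u)]
    simp only [add_apply, sub_apply, smul_apply, ContinuousLinearMap.comp_apply,
      ContinuousLinearMap.flip_apply, fderiv_fun_const, Pi.zero_apply, zero_apply, map_zero,
      zero_add, smul_eq_mul, fηv]
    ring
  have h2 := lie_dEta h (φ y u) v
  have e1 := lie_eta h u
  have e2 := lie_eta h v
  rw [h1, hK.self_of_nhds, hK.self_of_nhds, lie_phi h]
  simp only [map_sub, sub_apply]
  rw [eq_neg_of_add_eq_zero_left e1, eq_neg_of_add_eq_zero_left e2]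
  linarith

variable [FiniteDimensional ℝ F]

/-- Unit Killing fields are geodesic. -/
theorem geodesic_of_isSasakianAt (h : ∀ᶠ z in 𝓝 y, IsSasakianAt K φ ξ η z) :
    fderiv ℝ ξ y (ξ y) + christoffelForm K y (ξ y) (ξ y) = 0 := by
  have hy := h.self_of_nhds
  have dK := hy.metric.smooth.differentiableAt (by simp)
  have dξ := hy.smooth_ξ.differentiableAt (by simp)
  refine hy.metric.eq_of_forall_apply_eq fun w => ?_
  -- The Killing equation on `(ξ, w)` is compared with the derivative along `w` of `g(ξ, ξ) = 1`.
  have h1 := isKillingAt_of_isSasakianAt h (ξ y) w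
  have h2 : fderiv ℝ (fun z => K z (ξ z) (ξ z)) y w = 0 := by
    rw [Filter.EventuallyEq.fderiv_eq (f := fun _ => (1 : ℝ))
      (h.mono fun z hz => by rw [hz.K_ξ, hz.η_ξ])]
    simp
  have d1 : DifferentiableAt ℝ (fun z => K z (ξ z)) y := dK.clm_apply dξ
  rw [fderiv_clm_apply d1 dξ, fderiv_clm_apply dK dξ] at h2
  simp only [add_apply, ContinuousLinearMap.comp_apply, ContinuousLinearMap.flip_apply] at h2
  have h3 := hy.metric.symm (ξ y) (fderiv ℝ ξ y w)
  rw [map_add, add_apply, hy.metric.apply_christoffelForm, map_zero, zero_apply]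
  linarith

/-- Infinitesimally, the flow of a Killing field preserves the metric. -/
theorem hasDerivAt_metric_flow {Ψ : ℝ × F → F} {s : ℝ} (hK : IsMetricAt K y)
    (hξ : ContDiffAt ℝ ∞ ξ y) (hk : IsKillingAt K ξ y) (hΨ : ContDiffAt ℝ ∞ Ψ (s, y))
    (h0 : ∀ᶠ z in 𝓝 y, Ψ (s, z) = z)
    (hv : ∀ᶠ w in 𝓝 (s, y), fderiv ℝ Ψ w (1, 0) = ξ (Ψ w)) (u v : F) :
    HasDerivAt (fun t => K (Ψ (t, y)) (fderiv ℝ Ψ (t, y) (0, u)) (fderiv ℝ Ψ (t, y) (0, v))) 0 s := by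
  have hΨ0 : Ψ (s, y) = y := h0.self_of_nhds
  have dΨ := hΨ.differentiableAt (by simp)
  have d0 : ∀ v, fderiv ℝ Ψ (s, y) (0, v) = v := by
    intro v
    rw [← fderiv_comp_mk_right dΨ, Filter.EventuallyEq.fderiv_eq (f := id) h0]
    simp
  have hc : HasFDerivAt (fun t : ℝ => (t, y)) (ContinuousLinearMap.inl ℝ ℝ F) s :=
    hasFDerivAt_prodMk_left s y
  have dξ : DifferentiableAt ℝ ξ (Ψ (s, y)) := by
    rw [hΨ0]; exact hξ.differentiableAt (by simp)
  have dK : DifferentiableAt ℝ K (Ψ (s, y)) := by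
    rw [hΨ0]; exact hK.smooth.differentiableAt (by simp)
  -- Mixed second derivatives of `Ψ` commute, so the time derivative of `dΨ(0, u)` is the space
  -- derivative of the velocity `ξ ∘ Ψ`.
  have h1 : ∀ u, HasDerivAt (fun t => fderiv ℝ Ψ (t, y) (0, u)) (fderiv ℝ ξ y u) s := by
    intro u
    have d1 : DifferentiableAt ℝ (fun w => fderiv ℝ Ψ w (0, u)) (s, y) :=
      (contDiffAt_fderiv_apply hΨ contDiffAt_const).differentiableAt (by simp)
    have h2 := (d1.hasFDerivAt.comp s (f := fun t => (t, y)) hc).hasDerivAt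
    refine h2.congr_deriv ?_
    rw [ContinuousLinearMap.comp_apply, ContinuousLinearMap.inl_apply, fderiv_fderiv_apply hΨ,
      fderiv_fderiv_symm hΨ, ← fderiv_fderiv_apply hΨ, Filter.EventuallyEq.fderiv_eq hv,
      fderiv_comp_apply dξ dΨ, d0, hΨ0]
  have h2 : HasDerivAt (fun t => Ψ (t, y)) (ξ y) s := by
    have h3 := (dΨ.hasFDerivAt.comp s (f := fun t => (t, y)) hc).hasDerivAt
    refine h3.congr_deriv ?_
    rw [ContinuousLinearMap.comp_apply, ContinuousLinearMap.inl_apply, hv.self_of_nhds, hΨ0]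
  have h3 : HasDerivAt (fun t => K (Ψ (t, y))) (fderiv ℝ K y (ξ y)) s := by
    have h4 := dK.hasFDerivAt.comp_hasDerivAt s (f := fun t => Ψ (t, y)) h2
    rw [hΨ0] at h4
    exact h4
  have h4 := (h3.clm_apply (h1 u)).clm_apply (h1 v)
  refine h4.congr_deriv ?_
  have := hk u v
  simp only [d0, hΨ0, add_apply]
  linarith

end Killing

end LocalRiem

/-! ### Vector fields and Lie brackets read in the preferred charts -/

section Charts

open VectorField

variable {E : Type*} [NormedAddCommGroup E] [NormedSpace ℝ E]
  {H : Type*} [TopologicalSpace H] (I : ModelWithCorners ℝ E H)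
  {M : Type*} [TopologicalSpace M] [ChartedSpace H M]

/-- The derivative of the inverse of the preferred chart at `x₀`, at the point `y`. -/
def chartFrame (x₀ : M) (y : E) : E →L[ℝ] E := mfderiv 𝓘(ℝ, E) I (extChartAt I x₀).symm y

/-- The expression of a vector field in the preferred chart at `x₀`. -/
def coordRep (x₀ : M) (V : ∀ q : M, TangentSpace I q) : E → E :=
  fun y => mpullback 𝓘(ℝ, E) I (extChartAt I x₀).symm V y

/-- The vector field which is constant in the preferred chart at `x₀`. -/
def coordField (x₀ : M) (u : E) (q : M) : TangentSpace I q :=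
  mpullback I 𝓘(ℝ, E) (extChartAt I x₀) (fun _ : E => u) q

variable [I.Boundaryless] [IsManifold I ∞ M]

/-- The regularity under which Lie brackets commute with pullback; over `ℝ` it is just `C²`. -/
instance isManifold_minSmoothness_two : IsManifold I (minSmoothness ℝ 2) M := by
  rw [minSmoothness_of_isRCLikeNormedField]
  infer_instance

variable {I} {x₀ : M} {y : E}

theorem contMDiffAt_extChartAt_symm_of_mem (hy : y ∈ (extChartAt I x₀).target) :
    ContMDiffAt 𝓘(ℝ, E) I ∞ (extChartAt I x₀).symm y :=
  (contMDiffOn_extChartAt_symm x₀).contMDiffAt ((isOpen_extChartAt_target x₀).mem_nhds hy)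

theorem isInvertible_chartFrame (hy : y ∈ (extChartAt I x₀).target) :
    (chartFrame I x₀ y).IsInvertible := by
  have := isInvertible_mfderivWithin_extChartAt_symm hy
  rw [I.range_eq_univ, mfderivWithin_univ] at this
  exact this

theorem chartFrame_coordRep (hy : y ∈ (extChartAt I x₀).target) (V : ∀ q : M, TangentSpace I q) :
    chartFrame I x₀ y (coordRep I x₀ V y) = V ((extChartAt I x₀).symm y) :=
  ContinuousLinearMap.IsInvertible.self_apply_inverse (isInvertible_chartFrame hy) _

theorem mfderiv_extChartAt_chartFrame (hy : y ∈ (extChartAt I x₀).target) (u : E) :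
    mfderiv I 𝓘(ℝ, E) (extChartAt I x₀) ((extChartAt I x₀).symm y) (chartFrame I x₀ y u) = u := by
  have := mfderiv_extChartAt_comp_mfderivWithin_extChartAt_symm hy
  rw [I.range_eq_univ, mfderivWithin_univ] at this
  exact DFunLike.congr_fun this u

theorem coordField_symm (hy : y ∈ (extChartAt I x₀).target) (u : E) :
    coordField I x₀ u ((extChartAt I x₀).symm y) = chartFrame I x₀ y u := by
  have h1 := mfderiv_extChartAt_chartFrame hy u
  have h2 := isInvertible_mfderiv_extChartAt (I := I) ((extChartAt I x₀).map_target hy)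
  have h3 : (mfderiv I 𝓘(ℝ, E) (extChartAt I x₀) ((extChartAt I x₀).symm y)).inverse u =
      chartFrame I x₀ y u := by
    conv_lhs => rw [← h1]
    exact ContinuousLinearMap.IsInvertible.inverse_apply_self h2 _
  exact h3

theorem coordRep_coordField (hy : y ∈ (extChartAt I x₀).target) (u : E) :
    coordRep I x₀ (coordField I x₀ u) y = u := by
  have h := isInvertible_chartFrame hy
  have h1 : (chartFrame I x₀ y).inverse (chartFrame I x₀ y u) = u :=
    ContinuousLinearMap.IsInvertible.inverse_apply_self h u
  rw [← coordField_symm hy] at h1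
  exact h1

theorem eventually_mem_target (hy : y ∈ (extChartAt I x₀).target) :
    ∀ᶠ z in 𝓝 y, z ∈ (extChartAt I x₀).target :=
  (isOpen_extChartAt_target x₀).mem_nhds hy

theorem contDiffAt_comp_symm {F : Type*} [NormedAddCommGroup F] [NormedSpace ℝ F]
    (hy : y ∈ (extChartAt I x₀).target) {h : M → F}
    (hh : ContMDiffAt I 𝓘(ℝ, F) ∞ h ((extChartAt I x₀).symm y)) :
    ContDiffAt ℝ ∞ (fun z => h ((extChartAt I x₀).symm z)) y :=
  contMDiffAt_iff_contDiffAt.1 (hh.comp y (contMDiffAt_extChartAt_symm_of_mem hy))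

theorem mfderiv_chartFrame {F : Type*} [NormedAddCommGroup F] [NormedSpace ℝ F]
    (hy : y ∈ (extChartAt I x₀).target) {h : M → F}
    (hh : ContMDiffAt I 𝓘(ℝ, F) ∞ h ((extChartAt I x₀).symm y)) (u : E) :
    mfderiv I 𝓘(ℝ, F) h ((extChartAt I x₀).symm y) (chartFrame I x₀ y u) =
      fderiv ℝ (fun z => h ((extChartAt I x₀).symm z)) y u := by
  have h1 := mfderiv_comp y (hh.mdifferentiableAt (by simp))
    ((contMDiffAt_extChartAt_symm_of_mem hy).mdifferentiableAt (by simp))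
  rw [mfderiv_eq_fderiv] at h1
  exact (DFunLike.congr_fun h1 u).symm

variable [CompleteSpace E]

theorem contMDiffAt_coordField {q : M} (hq : q ∈ (extChartAt I x₀).source) (u : E) :
    ContMDiffAt I I.tangent ∞
      (fun p => (⟨p, coordField I x₀ u p⟩ : TangentBundle I M)) q := by
  refine ContMDiffAt.mpullback_vectorField_preimage (m := ∞) (n := ∞) (V := fun _ : E => u) ?_ ?_
    (isInvertible_mfderiv_extChartAt hq) (by simp)
  · exact contMDiffAt_vectorSpace_iff_contDiffAt.2 contDiffAt_const
  · exact contMDiffAt_extChartAt' (by simpa using hq)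

theorem contDiffAt_coordRep (hy : y ∈ (extChartAt I x₀).target) {V : ∀ q : M, TangentSpace I q}
    (hV : ContMDiffAt I I.tangent ∞ (fun p => (⟨p, V p⟩ : TangentBundle I M))
      ((extChartAt I x₀).symm y)) :
    ContDiffAt ℝ ∞ (coordRep I x₀ V) y := by
  have h : ContMDiffAt 𝓘(ℝ, E) 𝓘(ℝ, E).tangent ∞
      (fun z => (⟨z, coordRep (E := E) I x₀ V z⟩ : TangentBundle 𝓘(ℝ, E) E)) y :=
    ContMDiffAt.mpullback_vectorField_preimage hV (contMDiffAt_extChartAt_symm_of_mem hy)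
      (isInvertible_chartFrame (E := E) hy) (by simp)
  exact (contMDiffAt_vectorSpace_iff_contDiffAt (𝕜 := ℝ) (E := E) (V := coordRep I x₀ V)).1 h

/-- Brackets are natural under pullback by the inverse chart, and in a vector space they are given
by the usual formula. -/
theorem coordRep_mlieBracket (hy : y ∈ (extChartAt I x₀).target)
    {V W : ∀ q : M, TangentSpace I q}
    (hV : ContMDiffAt I I.tangent ∞ (fun p => (⟨p, V p⟩ : TangentBundle I M))
      ((extChartAt I x₀).symm y))
    (hW : ContMDiffAt I I.tangent ∞ (fun p => (⟨p, W p⟩ : TangentBundle I M))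
      ((extChartAt I x₀).symm y)) :
    coordRep I x₀ (mlieBracket I V W) y =
      fderiv ℝ (coordRep I x₀ W) y (coordRep I x₀ V y)
        - fderiv ℝ (coordRep I x₀ V) y (coordRep I x₀ W y) := by
  have h := mpullback_mlieBracket (hV.mdifferentiableAt (by simp))
    (hW.mdifferentiableAt (by simp)) (contMDiffAt_extChartAt_symm_of_mem hy)
    (by rw [minSmoothness_of_isRCLikeNormedField]; exact WithTop.coe_le_coe.2 le_top)
  have h2 := congrFun (mlieBracketWithin_eq_lieBracketWithin (𝕜 := ℝ) (E := E) (V := coordRep I x₀ V)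
    (W := coordRep I x₀ W) (s := univ)) y
  have h3 : mlieBracketWithin 𝓘(ℝ, E) (coordRep I x₀ V) (coordRep I x₀ W) univ y =
      mlieBracket 𝓘(ℝ, E) (coordRep I x₀ V) (coordRep I x₀ W) y := rfl
  have h4 := congrFun (lieBracketWithin_univ (𝕜 := ℝ) (V := coordRep I x₀ V)
    (W := coordRep I x₀ W)) y
  exact h.trans (h3.symm.trans (h2.trans h4))

end Charts

/-! ### Contact metric algebra and the Sasakian structure in a chart -/

namespace ContactMetricStructure

open VectorField LocalRiem

variable {n : ℕ} {N : Type*} [TopologicalSpace N]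
  [ChartedSpace (EuclideanSpace ℝ (Fin (2 * n + 1))) N] [IsManifold (𝓡 (2 * n + 1)) ∞ N]
  (S : ContactMetricStructure n N)

theorem ξ_ne_zero (p : N) : S.ξ p ≠ 0 := by
  intro h
  have := S.η_ξ p
  rw [h, map_zero] at this
  exact zero_ne_one this

theorem φ_φ_ξ (p : N) : S.φ p (S.φ p (S.ξ p)) = 0 := by
  rw [S.φ_φ, S.η_ξ, one_smul, neg_add_cancel]

/-- Two ways of computing `φ³ u` from `φ² = -I + η ⊗ ξ`. -/
theorem η_φ_smul_ξ (p : N) (u : TangentSpace (𝓡 (2 * n + 1)) p) :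
    S.η p (S.φ p u) • S.ξ p = S.η p u • S.φ p (S.ξ p) := by
  have h1 := S.φ_φ p (S.φ p u)
  have h2 := congrArg (S.φ p) (S.φ_φ p u)
  rw [h1, map_add, map_neg, map_smul] at h2
  exact add_left_cancel h2

/-- By the preceding identity `φ ξ = a ξ` with `a = η(φ ξ)`; then `φ² ξ = 0` gives `a² = 0`. -/
theorem φ_ξ (p : N) : S.φ p (S.ξ p) = 0 := by
  have h1 := S.η_φ_smul_ξ p (S.ξ p)
  rw [S.η_ξ, one_smul] at h1
  have h2 := S.φ_φ_ξ p
  set a := S.η p (S.φ p (S.ξ p)) with ha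
  rw [← h1, map_smul, ← h1, smul_smul] at h2
  rcases smul_eq_zero.1 h2 with h | h
  · rw [← h1, mul_self_eq_zero.1 h, zero_smul]
  · exact absurd h (S.ξ_ne_zero p)

theorem η_φ (p : N) (u : TangentSpace (𝓡 (2 * n + 1)) p) : S.η p (S.φ p u) = 0 := by
  have h1 := S.η_φ_smul_ξ p u
  rw [S.φ_ξ, smul_zero] at h1
  exact (smul_eq_zero.1 h1).resolve_right (S.ξ_ne_zero p)

/-- The compatibility condition with first argument `ξ`, whose left side vanishes because `φ ξ = 0`.
-/
theorem inner_ξ (p : N) (u : TangentSpace (𝓡 (2 * n + 1)) p) :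
    S.g.inner p (S.ξ p) u = S.η p u := by
  have h := S.g_φ_φ p (S.ξ p) u
  rw [S.φ_ξ, S.η_ξ, map_zero, one_mul] at h
  have h0 : (0 : TangentSpace (𝓡 (2 * n + 1)) p →L[ℝ] ℝ) (S.φ p u) = 0 := rfl
  rw [h0] at h
  linarith

/-- The inner product at `q`, on the model space. -/
def metricAt (q : N) :
    EuclideanSpace ℝ (Fin (2 * n + 1)) →L[ℝ] EuclideanSpace ℝ (Fin (2 * n + 1)) →L[ℝ] ℝ :=
  S.g.inner q

/-- The endomorphism `φ` at `q`, on the model space. -/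
def φAt (q : N) : EuclideanSpace ℝ (Fin (2 * n + 1)) →L[ℝ] EuclideanSpace ℝ (Fin (2 * n + 1)) :=
  S.φ q

/-- The contact form at `q`, on the model space. -/
def ηAt (q : N) : EuclideanSpace ℝ (Fin (2 * n + 1)) →L[ℝ] ℝ := S.η q

/-- The vector `ξ` at `q`, in the model space. -/
def ξAt (q : N) : EuclideanSpace ℝ (Fin (2 * n + 1)) := S.ξ q

theorem φAt_φAt (q : N) (u : EuclideanSpace ℝ (Fin (2 * n + 1))) :
    S.φAt q (S.φAt q u) = - u + S.ηAt q u • S.ξAt q := S.φ_φ q u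

theorem ηAt_ξAt (q : N) : S.ηAt q (S.ξAt q) = 1 := S.η_ξ q

theorem ηAt_φAt (q : N) (u : EuclideanSpace ℝ (Fin (2 * n + 1))) : S.ηAt q (S.φAt q u) = 0 :=
  S.η_φ q u

theorem metricAt_ξAt (q : N) (u : EuclideanSpace ℝ (Fin (2 * n + 1))) :
    S.metricAt q (S.ξAt q) u = S.ηAt q u := S.inner_ξ q u

theorem metricAt_φAt_φAt (q : N) (u v : EuclideanSpace ℝ (Fin (2 * n + 1))) :
    S.metricAt q (S.φAt q u) (S.φAt q v) = S.metricAt q u v - S.ηAt q u * S.ηAt q v :=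
  S.g_φ_φ q u v

theorem metricAt_symm (q : N) (u v : EuclideanSpace ℝ (Fin (2 * n + 1))) :
    S.metricAt q u v = S.metricAt q v u := S.g.symm q u v

theorem metricAt_pos (q : N) {u : EuclideanSpace ℝ (Fin (2 * n + 1))} (hu : u ≠ 0) :
    0 < S.metricAt q u u := S.g.pos q u hu

/-- The metric in the preferred chart at `x₀`. -/
def chartMetric (x₀ : N) (y : EuclideanSpace ℝ (Fin (2 * n + 1))) :
    EuclideanSpace ℝ (Fin (2 * n + 1)) →L[ℝ] EuclideanSpace ℝ (Fin (2 * n + 1)) →L[ℝ] ℝ :=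
  (S.metricAt ((extChartAt (𝓡 (2 * n + 1)) x₀).symm y)).bilinearComp
    (chartFrame (𝓡 (2 * n + 1)) x₀ y) (chartFrame (𝓡 (2 * n + 1)) x₀ y)

/-- The tensor field `φ` in the preferred chart at `x₀`. -/
def chartφ (x₀ : N) (y : EuclideanSpace ℝ (Fin (2 * n + 1))) :
    EuclideanSpace ℝ (Fin (2 * n + 1)) →L[ℝ] EuclideanSpace ℝ (Fin (2 * n + 1)) :=
  (chartFrame (𝓡 (2 * n + 1)) x₀ y).inverse ∘L
    (S.φAt ((extChartAt (𝓡 (2 * n + 1)) x₀).symm y)) ∘L (chartFrame (𝓡 (2 * n + 1)) x₀ y)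

/-- The contact form in the preferred chart at `x₀`. -/
def chartη (x₀ : N) (y : EuclideanSpace ℝ (Fin (2 * n + 1))) :
    EuclideanSpace ℝ (Fin (2 * n + 1)) →L[ℝ] ℝ :=
  (S.ηAt ((extChartAt (𝓡 (2 * n + 1)) x₀).symm y)) ∘L (chartFrame (𝓡 (2 * n + 1)) x₀ y)

theorem metricInChart_eq (x₀ : N) :
    metricInChart (𝓡 (2 * n + 1)) S.metric x₀ = ofForm (S.chartMetric x₀) := rfl

variable {x₀ : N} {y : EuclideanSpace ℝ (Fin (2 * n + 1))}

theorem chartMetric_apply (u v : EuclideanSpace ℝ (Fin (2 * n + 1))) :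
    S.chartMetric x₀ y u v = S.metricAt ((extChartAt (𝓡 (2 * n + 1)) x₀).symm y)
      (chartFrame (𝓡 (2 * n + 1)) x₀ y u) (chartFrame (𝓡 (2 * n + 1)) x₀ y v) := rfl

theorem chartη_apply (u : EuclideanSpace ℝ (Fin (2 * n + 1))) :
    S.chartη x₀ y u = S.ηAt ((extChartAt (𝓡 (2 * n + 1)) x₀).symm y)
      (chartFrame (𝓡 (2 * n + 1)) x₀ y u) := rfl

theorem chartFrame_chartφ (hy : y ∈ (extChartAt (𝓡 (2 * n + 1)) x₀).target)
    (u : EuclideanSpace ℝ (Fin (2 * n + 1))) :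
    chartFrame (𝓡 (2 * n + 1)) x₀ y (S.chartφ x₀ y u) =
      S.φAt ((extChartAt (𝓡 (2 * n + 1)) x₀).symm y) (chartFrame (𝓡 (2 * n + 1)) x₀ y u) :=
  ContinuousLinearMap.IsInvertible.self_apply_inverse (isInvertible_chartFrame hy) _

theorem chartFrame_injective (hy : y ∈ (extChartAt (𝓡 (2 * n + 1)) x₀).target) :
    Injective (chartFrame (𝓡 (2 * n + 1)) x₀ y) := fun u v huv => by
  have h := isInvertible_chartFrame hy
  rw [← h.inverse_apply_self u, huv, h.inverse_apply_self]

/-- The vector field `φ X` for `X` constant in the chart at `x₀`. -/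
theorem coordRep_φ_coordField (hy : y ∈ (extChartAt (𝓡 (2 * n + 1)) x₀).target)
    (u : EuclideanSpace ℝ (Fin (2 * n + 1))) :
    coordRep (𝓡 (2 * n + 1)) x₀ (fun q => S.φ q (coordField (𝓡 (2 * n + 1)) x₀ u q)) y =
      S.chartφ x₀ y u := by
  refine chartFrame_injective hy ?_
  rw [chartFrame_coordRep hy, S.chartFrame_chartφ hy, ← coordField_symm hy]
  rfl

theorem chartFrame_coordRep_ξ (hy : y ∈ (extChartAt (𝓡 (2 * n + 1)) x₀).target) :
    chartFrame (𝓡 (2 * n + 1)) x₀ y (coordRep (𝓡 (2 * n + 1)) x₀ S.ξ y) =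
      S.ξAt ((extChartAt (𝓡 (2 * n + 1)) x₀).symm y) := chartFrame_coordRep hy S.ξ

theorem contMDiffAt_φ {q : N} {X : ∀ p : N, TangentSpace (𝓡 (2 * n + 1)) p}
    (hX : ContMDiffAt (𝓡 (2 * n + 1)) (𝓡 (2 * n + 1)).tangent ∞
      (fun p => (⟨p, X p⟩ : TangentBundle (𝓡 (2 * n + 1)) N)) q) :
    ContMDiffAt (𝓡 (2 * n + 1)) (𝓡 (2 * n + 1)).tangent ∞
      (fun p => (⟨p, S.φ p (X p)⟩ : TangentBundle (𝓡 (2 * n + 1)) N)) q :=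
  ContMDiffAt.clm_bundle_apply (S.smooth_φ.contMDiffAt) hX

theorem contMDiffAt_η {q : N} {X : ∀ p : N, TangentSpace (𝓡 (2 * n + 1)) p}
    (hX : ContMDiffAt (𝓡 (2 * n + 1)) (𝓡 (2 * n + 1)).tangent ∞
      (fun p => (⟨p, X p⟩ : TangentBundle (𝓡 (2 * n + 1)) N)) q) :
    ContMDiffAt (𝓡 (2 * n + 1)) 𝓘(ℝ, ℝ) ∞ (fun p => S.η p (X p)) q := by
  have h : ContMDiffAt (𝓡 (2 * n + 1)) ((𝓡 (2 * n + 1)).prod 𝓘(ℝ, ℝ)) ∞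
      (fun p => Bundle.TotalSpace.mk' ℝ (E := Bundle.Trivial N ℝ) p (S.η p (X p))) q :=
    ContMDiffAt.clm_bundle_apply (S.smooth_η.contMDiffAt) hX
  rw [Bundle.contMDiffAt_totalSpace] at h
  exact h.2

theorem contMDiffAt_metric {q : N} {X Y : ∀ p : N, TangentSpace (𝓡 (2 * n + 1)) p}
    (hX : ContMDiffAt (𝓡 (2 * n + 1)) (𝓡 (2 * n + 1)).tangent ∞
      (fun p => (⟨p, X p⟩ : TangentBundle (𝓡 (2 * n + 1)) N)) q)
    (hY : ContMDiffAt (𝓡 (2 * n + 1)) (𝓡 (2 * n + 1)).tangent ∞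
      (fun p => (⟨p, Y p⟩ : TangentBundle (𝓡 (2 * n + 1)) N)) q) :
    ContMDiffAt (𝓡 (2 * n + 1)) 𝓘(ℝ, ℝ) ∞ (fun p => S.g.inner p (X p) (Y p)) q := by
  have h : ContMDiffAt (𝓡 (2 * n + 1)) ((𝓡 (2 * n + 1)).prod 𝓘(ℝ, ℝ)) ∞
      (fun p => Bundle.TotalSpace.mk' ℝ (E := Bundle.Trivial N ℝ) p
        (S.g.inner p (X p) (Y p))) q :=
    ContMDiffAt.clm_bundle_apply₂ (F₁ := EuclideanSpace ℝ (Fin (2 * n + 1)))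
      (F₂ := EuclideanSpace ℝ (Fin (2 * n + 1))) (S.g.contMDiff.contMDiffAt) hX hY
  rw [Bundle.contMDiffAt_totalSpace] at h
  exact h.2

theorem contMDiffAt_ξ (q : N) : ContMDiffAt (𝓡 (2 * n + 1)) (𝓡 (2 * n + 1)).tangent ∞
    (fun p => (⟨p, S.ξ p⟩ : TangentBundle (𝓡 (2 * n + 1)) N)) q :=
  S.smooth_ξ.contMDiffAt Filter.univ_mem

/-- Smoothness of operator valued maps on open sets can be tested on vectors. -/
theorem _root_.contDiffAt_clm_of_forall_mem {D E F : Type*} [NormedAddCommGroup D] [NormedSpace ℝ D]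
    [NormedAddCommGroup E] [NormedSpace ℝ E] [NormedAddCommGroup F] [NormedSpace ℝ F]
    [FiniteDimensional ℝ E] {s : Set D} (hs : IsOpen s) {f : D → E →L[ℝ] F}
    (h : ∀ u, ∀ z ∈ s, ContDiffAt ℝ ∞ (fun z => f z u) z) {z : D} (hz : z ∈ s) :
    ContDiffAt ℝ ∞ f z :=
  (contDiffOn_clm_apply.2 fun u z hz => (h u z hz).contDiffWithinAt).contDiffAt (hs.mem_nhds hz)

/-- On a fixed vector `u` the chart expression is `η` of the coordinate field of `u`, which is
smooth; in finite dimension this suffices. The metric and `φ` are treated in the same way. -/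
theorem contDiffAt_chartη (hy : y ∈ (extChartAt (𝓡 (2 * n + 1)) x₀).target) :
    ContDiffAt ℝ ∞ (S.chartη x₀) y := by
  refine contDiffAt_clm_of_forall_mem (isOpen_extChartAt_target x₀) (fun u z hz => ?_) hy
  refine (contDiffAt_comp_symm hz (S.contMDiffAt_η (contMDiffAt_coordField
    ((extChartAt (𝓡 (2 * n + 1)) x₀).map_target hz) u))).congr_of_eventuallyEq ?_
  filter_upwards [eventually_mem_target hz] with w hw
  rw [S.chartη_apply, ← coordField_symm hw]
  rfl

theorem contDiffAt_chartMetric (hy : y ∈ (extChartAt (𝓡 (2 * n + 1)) x₀).target) :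
    ContDiffAt ℝ ∞ (S.chartMetric x₀) y := by
  refine contDiffAt_clm_of_forall_mem (isOpen_extChartAt_target x₀) (fun u z hz => ?_) hy
  refine contDiffAt_clm_of_forall_mem (isOpen_extChartAt_target x₀) (fun v z hz => ?_) hz
  refine (contDiffAt_comp_symm hz (S.contMDiffAt_metric
    (contMDiffAt_coordField ((extChartAt (𝓡 (2 * n + 1)) x₀).map_target hz) u)
    (contMDiffAt_coordField ((extChartAt (𝓡 (2 * n + 1)) x₀).map_target hz)
      v))).congr_of_eventuallyEq ?_
  filter_upwards [eventually_mem_target hz] with w hw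
  rw [S.chartMetric_apply, ← coordField_symm hw, ← coordField_symm hw]
  rfl

theorem contDiffAt_chartφ (hy : y ∈ (extChartAt (𝓡 (2 * n + 1)) x₀).target) :
    ContDiffAt ℝ ∞ (S.chartφ x₀) y := by
  refine contDiffAt_clm_of_forall_mem (isOpen_extChartAt_target x₀) (fun u z hz => ?_) hy
  refine (contDiffAt_coordRep hz (S.contMDiffAt_φ (contMDiffAt_coordField
    ((extChartAt (𝓡 (2 * n + 1)) x₀).map_target hz) u))).congr_of_eventuallyEq ?_
  filter_upwards [eventually_mem_target hz] with w hw
  rw [S.coordRep_φ_coordField hw]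

theorem isMetricAt_chartMetric (hy : y ∈ (extChartAt (𝓡 (2 * n + 1)) x₀).target) :
    IsMetricAt (S.chartMetric x₀) y where
  smooth := S.contDiffAt_chartMetric hy
  symm _ _ := S.metricAt_symm _ _ _
  pos _ hu := S.metricAt_pos _ fun h => hu (chartFrame_injective hy (h.trans (map_zero _).symm))

/-- The condition on `dη` is applied to coordinate fields, whose bracket is zero, so only the two
derivative terms remain. -/
theorem chart_contact (hy : y ∈ (extChartAt (𝓡 (2 * n + 1)) x₀).target)
    (u v : EuclideanSpace ℝ (Fin (2 * n + 1))) :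
    S.chartMetric x₀ y u (S.chartφ x₀ y v) =
      (1 / 2 : ℝ) * (fderiv ℝ (S.chartη x₀) y u v - fderiv ℝ (S.chartη x₀) y v u) := by
  have hs : ∀ u, SmoothFieldOn (coordField (𝓡 (2 * n + 1)) x₀ u)
      (extChartAt (𝓡 (2 * n + 1)) x₀).source := fun u q hq =>
    (contMDiffAt_coordField hq u).contMDiffWithinAt
  have hq := (extChartAt (𝓡 (2 * n + 1)) x₀).map_target hy
  have h1 := S.g_φ _ _ _ (isOpen_extChartAt_source x₀) (hs u) (hs v) _ hq
  have hη : ∀ u v, mfderiv (𝓡 (2 * n + 1)) 𝓘(ℝ, ℝ)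
      (fun q => S.η q (coordField (𝓡 (2 * n + 1)) x₀ v q))
      ((extChartAt (𝓡 (2 * n + 1)) x₀).symm y) (chartFrame (𝓡 (2 * n + 1)) x₀ y u) =
      fderiv ℝ (S.chartη x₀) y u v := by
    intro u v
    rw [mfderiv_chartFrame hy (S.contMDiffAt_η (contMDiffAt_coordField hq v))]
    have h2 : (fun z => S.η ((extChartAt (𝓡 (2 * n + 1)) x₀).symm z)
        (coordField (𝓡 (2 * n + 1)) x₀ v ((extChartAt (𝓡 (2 * n + 1)) x₀).symm z))) =ᶠ[𝓝 y]
        fun z => S.chartη x₀ z v := by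
      filter_upwards [eventually_mem_target hy] with w hw
      rw [S.chartη_apply, ← coordField_symm hw]
      rfl
    have h3 : fderiv ℝ (fun z => S.chartη x₀ z v) y u = fderiv ℝ (S.chartη x₀) y u v := by
      rw [fderiv_clm_apply ((S.contDiffAt_chartη hy).differentiableAt (by simp))
        (differentiableAt_const v)]
      simp
    rw [h2.fderiv_eq]
    exact h3
  have hb : mlieBracket (𝓡 (2 * n + 1)) (coordField (𝓡 (2 * n + 1)) x₀ u)
      (coordField (𝓡 (2 * n + 1)) x₀ v) ((extChartAt (𝓡 (2 * n + 1)) x₀).symm y) = 0 := by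
    rw [← chartFrame_coordRep hy (mlieBracket _ _ _),
      coordRep_mlieBracket hy (contMDiffAt_coordField hq u) (contMDiffAt_coordField hq v)]
    have hc : ∀ u, coordRep (𝓡 (2 * n + 1)) x₀ (coordField (𝓡 (2 * n + 1)) x₀ u) =ᶠ[𝓝 y]
        fun _ => u := fun u =>
      (eventually_mem_target hy).mono fun w hw => coordRep_coordField hw u
    rw [(hc u).fderiv_eq, (hc v).fderiv_eq, fderiv_fun_const, fderiv_fun_const]
    exact (congrArg _ (sub_zero _)).trans (map_zero _)
  rw [extDerivOneForm, hb, map_zero, coordField_symm hy, coordField_symm hy, sub_zero] at h1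
  rw [S.chartMetric_apply, S.chartFrame_chartφ hy, ← hη u v, ← hη v u]
  exact h1

/-- The normality condition for the pair `(ξ, X)`: the brackets with `φ ξ = 0` drop out, and so does
`dη(ξ, X) = η(φ X) = 0`. -/
theorem φ_normal (hS : S.IsSasakian) {U : Set N} {X : ∀ p : N, TangentSpace (𝓡 (2 * n + 1)) p}
    (hU : IsOpen U) (hX : SmoothFieldOn X U) {p : N} (hp : p ∈ U) :
    S.φ p (S.φ p (mlieBracket (𝓡 (2 * n + 1)) S.ξ X p)) =
      S.φ p (mlieBracket (𝓡 (2 * n + 1)) S.ξ (fun q => S.φ q (X q)) p) := by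
  have hξ : SmoothFieldOn S.ξ U := S.smooth_ξ.mono (subset_univ U)
  have h1 := hS U S.ξ X hU hξ hX p hp
  rw [← S.g_φ U S.ξ X hU hξ hX p hp, S.inner_ξ, S.η_φ, mul_zero, zero_smul, add_zero,
    nijenhuis] at h1
  have h0 : (fun q => S.φ q (S.ξ q)) = (0 : ∀ q : N, TangentSpace (𝓡 (2 * n + 1)) q) :=
    funext fun q => S.φ_ξ q
  rw [h0, mlieBracket_zero_left, mlieBracket_zero_left] at h1
  simp only [Pi.zero_apply, map_zero, sub_zero, zero_sub] at h1
  exact (neg_add_eq_zero.1 h1).symm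

/-- For a constant field `v` in the chart, `[ξ, v] = -dξ(v)` and `[ξ, φ v] = dφ(ξ) v - dξ(φ v)`;
these are inserted into `φ_normal`. -/
theorem chart_normal (hS : S.IsSasakian) (hy : y ∈ (extChartAt (𝓡 (2 * n + 1)) x₀).target)
    (v : EuclideanSpace ℝ (Fin (2 * n + 1))) :
    S.chartφ x₀ y (fderiv ℝ (S.chartφ x₀) y (coordRep (𝓡 (2 * n + 1)) x₀ S.ξ y) v
      - fderiv ℝ (coordRep (𝓡 (2 * n + 1)) x₀ S.ξ) y (S.chartφ x₀ y v)
      + S.chartφ x₀ y (fderiv ℝ (coordRep (𝓡 (2 * n + 1)) x₀ S.ξ) y v)) = 0 := by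
  have hq := (extChartAt (𝓡 (2 * n + 1)) x₀).map_target hy
  have hX := contMDiffAt_coordField (I := 𝓡 (2 * n + 1)) hq v
  have h1 := S.φ_normal hS (X := coordField (𝓡 (2 * n + 1)) x₀ v) (isOpen_extChartAt_source x₀)
    (fun q hq => (contMDiffAt_coordField hq v).contMDiffWithinAt) hq
  have hb := coordRep_mlieBracket hy (S.contMDiffAt_ξ _) hX
  have hb' := coordRep_mlieBracket hy (S.contMDiffAt_ξ _) (S.contMDiffAt_φ hX)
  have h3 : S.φAt ((extChartAt (𝓡 (2 * n + 1)) x₀).symm y)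
      (S.φAt ((extChartAt (𝓡 (2 * n + 1)) x₀).symm y)
        (chartFrame (𝓡 (2 * n + 1)) x₀ y (coordRep (𝓡 (2 * n + 1)) x₀
          (mlieBracket (𝓡 (2 * n + 1)) S.ξ (coordField (𝓡 (2 * n + 1)) x₀ v)) y))) =
      S.φAt ((extChartAt (𝓡 (2 * n + 1)) x₀).symm y)
        (chartFrame (𝓡 (2 * n + 1)) x₀ y (coordRep (𝓡 (2 * n + 1)) x₀
          (mlieBracket (𝓡 (2 * n + 1)) S.ξ
            (fun q => S.φ q (coordField (𝓡 (2 * n + 1)) x₀ v q))) y)) := by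
    rw [chartFrame_coordRep hy, chartFrame_coordRep hy]
    exact h1
  rw [hb, hb', ← S.chartFrame_chartφ hy, ← S.chartFrame_chartφ hy, ← S.chartFrame_chartφ hy] at h3
  have h2 := chartFrame_injective hy h3
  have hc : coordRep (𝓡 (2 * n + 1)) x₀ (coordField (𝓡 (2 * n + 1)) x₀ v) =ᶠ[𝓝 y] fun _ => v :=
    (eventually_mem_target hy).mono fun w hw => coordRep_coordField hw v
  have hφ : coordRep (𝓡 (2 * n + 1)) x₀ (fun q => S.φ q (coordField (𝓡 (2 * n + 1)) x₀ v q)) =ᶠ[𝓝 y]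
      fun z => S.chartφ x₀ z v :=
    (eventually_mem_target hy).mono fun w hw => S.coordRep_φ_coordField hw v
  rw [hc.fderiv_eq, hφ.fderiv_eq, hc.eq_of_nhds, hφ.eq_of_nhds,
    fderiv_clm_apply ((S.contDiffAt_chartφ hy).differentiableAt (by simp))
      (differentiableAt_const v)] at h2
  simp only [fderiv_fun_const, Pi.zero_apply, zero_apply, zero_sub, map_neg, add_apply,
    ContinuousLinearMap.comp_apply, ContinuousLinearMap.flip_apply, map_zero, zero_add] at h2
  rw [map_add, ← h2]
  exact neg_add_cancel _

theorem isSasakianAt_chart (hS : S.IsSasakian)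
    (hy : y ∈ (extChartAt (𝓡 (2 * n + 1)) x₀).target) :
    IsSasakianAt (S.chartMetric x₀) (S.chartφ x₀) (coordRep (𝓡 (2 * n + 1)) x₀ S.ξ)
      (S.chartη x₀) y where
  metric := S.isMetricAt_chartMetric hy
  smooth_φ := S.contDiffAt_chartφ hy
  smooth_ξ := contDiffAt_coordRep hy (S.contMDiffAt_ξ _)
  smooth_η := S.contDiffAt_chartη hy
  φ_φ u := by
    refine chartFrame_injective hy ?_
    rw [S.chartFrame_chartφ hy, S.chartFrame_chartφ hy, S.φAt_φAt, map_add, map_neg, map_smul,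
      S.chartFrame_coordRep_ξ hy, S.chartη_apply]
  η_ξ := by rw [S.chartη_apply, S.chartFrame_coordRep_ξ hy, S.ηAt_ξAt]
  η_φ u := by rw [S.chartη_apply, S.chartFrame_chartφ hy, S.ηAt_φAt]
  K_ξ u := by
    rw [S.chartMetric_apply, S.chartFrame_coordRep_ξ hy, S.metricAt_ξAt, S.chartη_apply]
  K_φ_φ u v := by
    rw [S.chartMetric_apply, S.chartFrame_chartφ hy, S.chartFrame_chartφ hy, S.metricAt_φAt_φAt,
      S.chartMetric_apply, S.chartη_apply, S.chartη_apply]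
  contact := S.chart_contact hy
  normal := S.chart_normal hS hy

end ContactMetricStructure

/-! ### Smooth maps and their differentials read in charts -/

section Charts

variable {E : Type*} [NormedAddCommGroup E] [NormedSpace ℝ E]
  {H : Type*} [TopologicalSpace H] {I : ModelWithCorners ℝ E H}
  {M : Type*} [TopologicalSpace M] [ChartedSpace H M] [I.Boundaryless] [IsManifold I ∞ M]
  {E' : Type*} [NormedAddCommGroup E'] [NormedSpace ℝ E']
  {H' : Type*} [TopologicalSpace H'] {J : ModelWithCorners ℝ E' H'}
  {N : Type*} [TopologicalSpace N] [ChartedSpace H' N] [J.Boundaryless] [IsManifold J ∞ N]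
  {f : M → N} {x : M} {x' : N} {y : E}

theorem contMDiffAt_extChartAt_of_mem {q : N} (hq : q ∈ (extChartAt J x').source) :
    ContMDiffAt J 𝓘(ℝ, E') ∞ (extChartAt J x') q :=
  contMDiffAt_extChartAt' (by simpa using hq)

theorem contDiffAt_written (hy : y ∈ (extChartAt I x).target)
    (hf : ContMDiffAt I J ∞ f ((extChartAt I x).symm y))
    (hfy : f ((extChartAt I x).symm y) ∈ (extChartAt J x').source) :
    ContDiffAt ℝ ∞ (fun z => extChartAt J x' (f ((extChartAt I x).symm z))) y :=
  contDiffAt_comp_symm (h := fun q => extChartAt J x' (f q)) hy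
    (ContMDiffAt.comp _ (contMDiffAt_extChartAt_of_mem hfy) hf)

/-- The derivative of a map read in charts. -/
theorem chartFrame_fderiv (hy : y ∈ (extChartAt I x).target)
    (hf : ContMDiffAt I J ∞ f ((extChartAt I x).symm y))
    (hfy : f ((extChartAt I x).symm y) ∈ (extChartAt J x').source) (u : E) :
    chartFrame J x' (extChartAt J x' (f ((extChartAt I x).symm y)))
      (fderiv ℝ (fun z => extChartAt J x' (f ((extChartAt I x).symm z))) y u) =
    mfderiv I J f ((extChartAt I x).symm y) (chartFrame I x y u) := by
  have hs := contMDiffAt_extChartAt_symm_of_mem hy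
  have h1 := contDiffAt_written hy hf hfy
  have h2 := contMDiffAt_extChartAt_symm_of_mem ((extChartAt J x').map_source hfy)
  have e1 := mfderiv_comp y (hf.mdifferentiableAt (by simp)) (hs.mdifferentiableAt (by simp))
  have e2 := mfderiv_comp y (h2.mdifferentiableAt (by simp))
    (h1.contMDiffAt.mdifferentiableAt (by simp))
  have e3 : (extChartAt J x').symm ∘ (fun z => extChartAt J x' (f ((extChartAt I x).symm z)))
      =ᶠ[𝓝 y] f ∘ (extChartAt I x).symm := by
    have hc : ContinuousAt (f ∘ (extChartAt I x).symm) y :=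
      ContinuousAt.comp hf.continuousAt hs.continuousAt
    filter_upwards [hc.eventually ((isOpen_extChartAt_source x').mem_nhds hfy)] with z hz
    exact (extChartAt J x').left_inv hz
  rw [e3.mfderiv_eq, mfderiv_eq_fderiv] at e2
  exact DFunLike.congr_fun (e2.symm.trans e1) u

end Charts

/-! ### The flow of `ξ` is isometric, globally and in charts -/

namespace ContactMetricStructure

open LocalRiem

variable {n : ℕ} {N : Type*} [TopologicalSpace N]
  [ChartedSpace (EuclideanSpace ℝ (Fin (2 * n + 1))) N] [IsManifold (𝓡 (2 * n + 1)) ∞ N]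
  (S : ContactMetricStructure n N) {Φ : Flow ℝ N}

/-- The differential of the time `t` map of a flow, on the model space. -/
def _root_.Flow.differential (Φ : Flow ℝ N) (t : ℝ) (q : N) :
    EuclideanSpace ℝ (Fin (2 * n + 1)) →L[ℝ] EuclideanSpace ℝ (Fin (2 * n + 1)) :=
  mfderiv (𝓡 (2 * n + 1)) (𝓡 (2 * n + 1)) (fun q => Φ t q) q

/-- A flow in the preferred chart at `x₀`, starting at time `s₀`. -/
def _root_.Flow.inChart (Φ : Flow ℝ N) (x₀ : N) (s₀ : ℝ)
    (w : ℝ × EuclideanSpace ℝ (Fin (2 * n + 1))) : EuclideanSpace ℝ (Fin (2 * n + 1)) :=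
  extChartAt (𝓡 (2 * n + 1)) x₀ (Φ (w.1 - s₀) ((extChartAt (𝓡 (2 * n + 1)) x₀).symm w.2))

variable {S}

theorem _root_.IsFlowOf.contMDiff_time (hΦ : IsFlowOf Φ S.ξ) (t : ℝ) :
    ContMDiff (𝓡 (2 * n + 1)) (𝓡 (2 * n + 1)) ∞ (fun q => Φ t q) :=
  hΦ.1.comp (contMDiff_const.prodMk contMDiff_id)

theorem _root_.Flow.differential_zero (Φ : Flow ℝ N) (q : N)
    (u : EuclideanSpace ℝ (Fin (2 * n + 1))) : Φ.differential (n := n) 0 q u = u := by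
  have h : (fun q => Φ 0 q) = (id : N → N) := funext fun q => Φ.map_zero_apply q
  rw [Flow.differential, h]
  exact DFunLike.congr_fun mfderiv_id u

theorem _root_.IsFlowOf.differential_add (hΦ : IsFlowOf Φ S.ξ) (s t : ℝ) (q : N)
    (u : EuclideanSpace ℝ (Fin (2 * n + 1))) :
    Φ.differential (n := n) (s + t) q u =
      Φ.differential (n := n) s (Φ t q) (Φ.differential (n := n) t q u) := by
  have h : (fun q => Φ (s + t) q) = (fun q => Φ s q) ∘ (fun q => Φ t q) :=
    funext fun q => Φ.map_add s t q
  rw [Flow.differential, h]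
  exact DFunLike.congr_fun (mfderiv_comp q ((hΦ.contMDiff_time s).mdifferentiableAt (by simp))
    ((hΦ.contMDiff_time t).mdifferentiableAt (by simp))) u

/-- The domain of the flow in the chart at `x₀`. -/
def _root_.Flow.chartDomain (Φ : Flow ℝ N) (x₀ : N) (s₀ : ℝ) :
    Set (ℝ × EuclideanSpace ℝ (Fin (2 * n + 1))) :=
  {w | w.2 ∈ (extChartAt (𝓡 (2 * n + 1)) x₀).target ∧
    Φ (w.1 - s₀) ((extChartAt (𝓡 (2 * n + 1)) x₀).symm w.2) ∈
      (extChartAt (𝓡 (2 * n + 1)) x₀).source}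

variable {x₀ : N} {s₀ : ℝ} {w : ℝ × EuclideanSpace ℝ (Fin (2 * n + 1))}

theorem _root_.IsFlowOf.contMDiffAt_flow_symm (hΦ : IsFlowOf Φ S.ξ)
    (hw : w.2 ∈ (extChartAt (𝓡 (2 * n + 1)) x₀).target) :
    ContMDiffAt 𝓘(ℝ, ℝ × EuclideanSpace ℝ (Fin (2 * n + 1))) (𝓡 (2 * n + 1)) ∞
      (fun w : ℝ × EuclideanSpace ℝ (Fin (2 * n + 1)) =>
        Φ (w.1 - s₀) ((extChartAt (𝓡 (2 * n + 1)) x₀).symm w.2)) w := by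
  have h1 : ContMDiffAt 𝓘(ℝ, ℝ × EuclideanSpace ℝ (Fin (2 * n + 1))) 𝓘(ℝ, ℝ) ∞
      (fun w : ℝ × EuclideanSpace ℝ (Fin (2 * n + 1)) => w.1 - s₀) w :=
    ContDiffAt.contMDiffAt (contDiffAt_fst.sub contDiffAt_const)
  have h2 : ContMDiffAt 𝓘(ℝ, ℝ × EuclideanSpace ℝ (Fin (2 * n + 1))) (𝓡 (2 * n + 1)) ∞
      (fun w : ℝ × EuclideanSpace ℝ (Fin (2 * n + 1)) =>
        (extChartAt (𝓡 (2 * n + 1)) x₀).symm w.2) w :=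
    ContMDiffAt.comp w (contMDiffAt_extChartAt_symm_of_mem hw)
      (ContDiffAt.contMDiffAt contDiffAt_snd)
  exact ContMDiffAt.comp w (g := fun z : ℝ × N => Φ z.1 z.2)
    (f := fun w : ℝ × EuclideanSpace ℝ (Fin (2 * n + 1)) =>
      (w.1 - s₀, (extChartAt (𝓡 (2 * n + 1)) x₀).symm w.2))
    hΦ.1.contMDiffAt (h1.prodMk h2)

theorem _root_.IsFlowOf.eventually_mem_chartDomain (hΦ : IsFlowOf Φ S.ξ)
    (hw : w ∈ Φ.chartDomain (n := n) x₀ s₀) : ∀ᶠ w' in 𝓝 w, w' ∈ Φ.chartDomain (n := n) x₀ s₀ := by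
  have h1 : ∀ᶠ w' in 𝓝 w, w'.2 ∈ (extChartAt (𝓡 (2 * n + 1)) x₀).target :=
    continuousAt_snd.eventually (eventually_mem_target hw.1)
  have h2 := (hΦ.contMDiffAt_flow_symm (s₀ := s₀) hw.1).continuousAt.eventually
    ((isOpen_extChartAt_source x₀).mem_nhds hw.2)
  filter_upwards [h1, h2] with w' h1 h2 using ⟨h1, h2⟩

theorem _root_.IsFlowOf.contDiffAt_inChart (hΦ : IsFlowOf Φ S.ξ)
    (hw : w ∈ Φ.chartDomain (n := n) x₀ s₀) : ContDiffAt ℝ ∞ (Φ.inChart (n := n) x₀ s₀) w :=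
  contMDiffAt_iff_contDiffAt.1 (ContMDiffAt.comp w (contMDiffAt_extChartAt_of_mem hw.2)
    (hΦ.contMDiffAt_flow_symm hw.1))

theorem _root_.Flow.symm_inChart (hw : w ∈ Φ.chartDomain (n := n) x₀ s₀) :
    (extChartAt (𝓡 (2 * n + 1)) x₀).symm (Φ.inChart (n := n) x₀ s₀ w) =
      Φ (w.1 - s₀) ((extChartAt (𝓡 (2 * n + 1)) x₀).symm w.2) :=
  (extChartAt (𝓡 (2 * n + 1)) x₀).left_inv hw.2

theorem _root_.Flow.inChart_mem_target (hw : w ∈ Φ.chartDomain (n := n) x₀ s₀) :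
    Φ.inChart (n := n) x₀ s₀ w ∈ (extChartAt (𝓡 (2 * n + 1)) x₀).target :=
  (extChartAt (𝓡 (2 * n + 1)) x₀).map_source hw.2

theorem _root_.IsFlowOf.chartFrame_fderiv_space (hΦ : IsFlowOf Φ S.ξ)
    (hw : w ∈ Φ.chartDomain (n := n) x₀ s₀) (u : EuclideanSpace ℝ (Fin (2 * n + 1))) :
    chartFrame (𝓡 (2 * n + 1)) x₀ (Φ.inChart (n := n) x₀ s₀ w)
      (fderiv ℝ (Φ.inChart (n := n) x₀ s₀) w (0, u)) =
    Φ.differential (n := n) (w.1 - s₀) ((extChartAt (𝓡 (2 * n + 1)) x₀).symm w.2)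
      (chartFrame (𝓡 (2 * n + 1)) x₀ w.2 u) := by
  obtain ⟨s, y⟩ := w
  rw [← fderiv_comp_mk_right ((hΦ.contDiffAt_inChart hw).differentiableAt (by simp))]
  exact chartFrame_fderiv hw.1 (hΦ.contMDiff_time (s - s₀)).contMDiffAt hw.2 u

/-- The curve `t ↦ Φ (t - s₀) p` is differentiated twice, as an integral curve and through the
chart; by uniqueness of the derivative and injectivity of the frame the two velocities agree. -/
theorem _root_.IsFlowOf.fderiv_inChart_time (hΦ : IsFlowOf Φ S.ξ)
    (hw : w ∈ Φ.chartDomain (n := n) x₀ s₀) :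
    fderiv ℝ (Φ.inChart (n := n) x₀ s₀) w (1, 0) =
      coordRep (𝓡 (2 * n + 1)) x₀ S.ξ (Φ.inChart (n := n) x₀ s₀ w) := by
  obtain ⟨s, y⟩ := w
  refine chartFrame_injective (Flow.inChart_mem_target hw) ?_
  rw [chartFrame_coordRep (Flow.inChart_mem_target hw)]
  set p := (extChartAt (𝓡 (2 * n + 1)) x₀).symm y with hp
  have d1 := (hΦ.contDiffAt_inChart hw).differentiableAt (by simp)
  have h1 : HasFDerivAt (fun t => Φ.inChart (n := n) x₀ s₀ (t, y))
      ((fderiv ℝ (Φ.inChart (n := n) x₀ s₀) (s, y)) ∘L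
        ContinuousLinearMap.inl ℝ ℝ (EuclideanSpace ℝ (Fin (2 * n + 1)))) s :=
    HasFDerivAt.comp s (f := fun t => (t, y)) d1.hasFDerivAt (hasFDerivAt_prodMk_left s y)
  have h2 : HasMFDerivAt 𝓘(ℝ, ℝ) (𝓡 (2 * n + 1)) (fun t => Φ (t - s₀) p) s
      ((1 : ℝ →L[ℝ] ℝ).smulRight (S.ξ (Φ (s - s₀) p))) := by
    have h3 : HasMFDerivAt 𝓘(ℝ, ℝ) 𝓘(ℝ, ℝ) (fun t : ℝ => t - s₀) s (1 : ℝ →L[ℝ] ℝ) :=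
      ((hasFDerivAt_id s).sub_const s₀).hasMFDerivAt
    exact HasMFDerivAt.comp s (hΦ.2 p (s - s₀)) h3
  have h3 : HasMFDerivAt 𝓘(ℝ, ℝ) (𝓡 (2 * n + 1))
      (fun t => (extChartAt (𝓡 (2 * n + 1)) x₀).symm (Φ.inChart (n := n) x₀ s₀ (t, y))) s
      ((mfderiv 𝓘(ℝ, EuclideanSpace ℝ (Fin (2 * n + 1))) (𝓡 (2 * n + 1))
        (extChartAt (𝓡 (2 * n + 1)) x₀).symm (Φ.inChart (n := n) x₀ s₀ (s, y))).comp
        ((fderiv ℝ (Φ.inChart (n := n) x₀ s₀) (s, y)) ∘L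
        ContinuousLinearMap.inl ℝ ℝ (EuclideanSpace ℝ (Fin (2 * n + 1))))) :=
    HasMFDerivAt.comp s (((contMDiffAt_extChartAt_symm_of_mem
      (Flow.inChart_mem_target hw)).mdifferentiableAt (by simp)).hasMFDerivAt) h1.hasMFDerivAt
  have h4 : (fun t => Φ (t - s₀) p) =ᶠ[𝓝 s]
      fun t => (extChartAt (𝓡 (2 * n + 1)) x₀).symm (Φ.inChart (n := n) x₀ s₀ (t, y)) := by
    have hc : ContinuousAt (fun t : ℝ => (t, y)) s := by fun_prop
    filter_upwards [hc.eventually (hΦ.eventually_mem_chartDomain hw)] with t ht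
    rw [Flow.symm_inChart ht]
  have h5 := hasMFDerivAt_unique h2 (h3.congr_of_eventuallyEq h4)
  have h6 := DFunLike.congr_fun h5 (1 : ℝ)
  rw [Flow.symm_inChart hw]
  refine Eq.trans ?_ (h6.symm.trans ?_)
  · rfl
  · exact one_smul ℝ _

theorem _root_.Flow.mk_mem_chartDomain (Φ : Flow ℝ N) {y : EuclideanSpace ℝ (Fin (2 * n + 1))}
    (hy : y ∈ (extChartAt (𝓡 (2 * n + 1)) x₀).target) :
    (s₀, y) ∈ Φ.chartDomain (n := n) x₀ s₀ := by
  refine ⟨hy, ?_⟩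
  rw [sub_self, Φ.map_zero_apply]
  exact (extChartAt (𝓡 (2 * n + 1)) x₀).map_target hy

theorem _root_.Flow.inChart_initial (Φ : Flow ℝ N) {y : EuclideanSpace ℝ (Fin (2 * n + 1))}
    (hy : y ∈ (extChartAt (𝓡 (2 * n + 1)) x₀).target) :
    Φ.inChart (n := n) x₀ s₀ (s₀, y) = y := by
  rw [Flow.inChart, sub_self, Φ.map_zero_apply]
  exact (extChartAt (𝓡 (2 * n + 1)) x₀).right_inv hy

/-- Near `t = 0` the orbit stays in the chart at its initial point, so the infinitesimal statement
for Killing fields applies. Other times are reached by the group law. -/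
theorem hasDerivAt_metricAt_flow (hS : S.IsSasakian) (hΦ : IsFlowOf Φ S.ξ) (q : N)
    (u v : EuclideanSpace ℝ (Fin (2 * n + 1))) :
    HasDerivAt (fun t => S.metricAt (Φ t q) (Φ.differential (n := n) t q u)
      (Φ.differential (n := n) t q v)) 0 0 := by
  set y := extChartAt (𝓡 (2 * n + 1)) q q with hy
  have hyt : y ∈ (extChartAt (𝓡 (2 * n + 1)) q).target := mem_extChartAt_target q
  have hq : (extChartAt (𝓡 (2 * n + 1)) q).symm y = q := extChartAt_to_inv q
  have hw : ((0 : ℝ), y) ∈ Φ.chartDomain (n := n) q 0 := Φ.mk_mem_chartDomain hyt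
  have hA := isInvertible_chartFrame (I := 𝓡 (2 * n + 1)) hyt
  have h1 := hasDerivAt_metric_flow (s := 0) (Ψ := Φ.inChart (n := n) q 0)
    (S.isMetricAt_chartMetric hyt) (contDiffAt_coordRep hyt (S.contMDiffAt_ξ _))
    (isKillingAt_of_isSasakianAt ((eventually_mem_target hyt).mono fun z hz =>
      S.isSasakianAt_chart hS hz)) (hΦ.contDiffAt_inChart hw)
    ((eventually_mem_target hyt).mono fun z hz => Φ.inChart_initial hz)
    ((hΦ.eventually_mem_chartDomain hw).mono fun w hw => hΦ.fderiv_inChart_time hw)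
    ((chartFrame (𝓡 (2 * n + 1)) q y).inverse u) ((chartFrame (𝓡 (2 * n + 1)) q y).inverse v)
  refine h1.congr_of_eventuallyEq ?_
  have hc : ContinuousAt (fun t : ℝ => (t, y)) 0 := by fun_prop
  filter_upwards [hc.eventually (hΦ.eventually_mem_chartDomain hw)] with t ht
  rw [S.chartMetric_apply, hΦ.chartFrame_fderiv_space ht, hΦ.chartFrame_fderiv_space ht,
    Flow.symm_inChart ht]
  simp only [sub_zero, hq, hA.self_apply_inverse]

/-- The flow of `ξ` consists of isometries. -/
theorem metricAt_flow (hS : S.IsSasakian) (hΦ : IsFlowOf Φ S.ξ) (t : ℝ) (q : N)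
    (u v : EuclideanSpace ℝ (Fin (2 * n + 1))) :
    S.metricAt (Φ t q) (Φ.differential (n := n) t q u) (Φ.differential (n := n) t q v) =
      S.metricAt q u v := by
  -- As `Φ_t = Φ_{t - t₀} ∘ Φ_{t₀}`, the derivative at `t₀` is the derivative at `0` for the point
  -- `Φ_{t₀} q` and the transported vectors.
  have h1 : ∀ t₀, HasDerivAt (fun t => S.metricAt (Φ t q) (Φ.differential (n := n) t q u)
      (Φ.differential (n := n) t q v)) 0 t₀ := by
    intro t₀
    have h2 := hasDerivAt_metricAt_flow hS hΦ (Φ t₀ q) (Φ.differential (n := n) t₀ q u)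
      (Φ.differential (n := n) t₀ q v)
    have h2' : HasDerivAt (fun t => S.metricAt (Φ t (Φ t₀ q))
        (Φ.differential (n := n) t (Φ t₀ q) (Φ.differential (n := n) t₀ q u))
        (Φ.differential (n := n) t (Φ t₀ q) (Φ.differential (n := n) t₀ q v))) 0 (t₀ - t₀) := by
      rwa [sub_self]
    have h3 := h2'.comp_sub_const t₀ t₀
    refine h3.congr_of_eventuallyEq (Filter.Eventually.of_forall fun t => ?_)
    simp only [← hΦ.differential_add, ← Φ.map_add, sub_add_cancel]
  have h2 := is_const_of_deriv_eq_zero (fun t => (h1 t).differentiableAt)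
    (fun t => (h1 t).deriv) t 0
  rw [h2, Φ.differential_zero, Φ.differential_zero, Φ.map_zero_apply]

theorem isGeodesicFlowAt_inChart (hS : S.IsSasakian) (hΦ : IsFlowOf Φ S.ξ)
    (hw : w ∈ Φ.chartDomain (n := n) x₀ s₀) :
    IsGeodesicFlowAt (S.chartMetric x₀) (coordRep (𝓡 (2 * n + 1)) x₀ S.ξ)
      (Φ.inChart (n := n) x₀ s₀) w where
  smooth := hΦ.contDiffAt_inChart hw
  dom := S.isMetricAt_chartMetric hw.1
  cod := S.isMetricAt_chartMetric (Flow.inChart_mem_target hw)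
  isometry u v := by
    rw [S.chartMetric_apply, hΦ.chartFrame_fderiv_space hw, hΦ.chartFrame_fderiv_space hw,
      Flow.symm_inChart hw, metricAt_flow hS hΦ, S.chartMetric_apply]
  velocity := hΦ.fderiv_inChart_time hw
  smooth_field := contDiffAt_coordRep (Flow.inChart_mem_target hw) (S.contMDiffAt_ξ _)
  geodesic := geodesic_of_isSasakianAt ((eventually_mem_target
    (Flow.inChart_mem_target hw)).mono fun z hz => S.isSasakianAt_chart hS hz)

/-- Two charts are allowed because for large `t` the image point need not lie in the chart of the
initial point. -/
theorem isSmoothIsometryAt_flow (hS : S.IsSasakian) (hΦ : IsFlowOf Φ S.ξ) (t : ℝ) {x₁ : N}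
    {y : EuclideanSpace ℝ (Fin (2 * n + 1))} (hy : y ∈ (extChartAt (𝓡 (2 * n + 1)) x₀).target)
    (hy' : Φ t ((extChartAt (𝓡 (2 * n + 1)) x₀).symm y) ∈
      (extChartAt (𝓡 (2 * n + 1)) x₁).source) :
    IsSmoothIsometryAt (S.chartMetric x₀) (S.chartMetric x₁)
      (fun z => extChartAt (𝓡 (2 * n + 1)) x₁
        (Φ t ((extChartAt (𝓡 (2 * n + 1)) x₀).symm z))) y where
  dom := S.isMetricAt_chartMetric hy
  cod := S.isMetricAt_chartMetric ((extChartAt (𝓡 (2 * n + 1)) x₁).map_source hy')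
  smooth := contDiffAt_written (f := fun q => Φ t q) hy (hΦ.contMDiff_time t).contMDiffAt hy'
  isometry u v := by
    have h : ∀ u, chartFrame (𝓡 (2 * n + 1)) x₁ (extChartAt (𝓡 (2 * n + 1)) x₁
        (Φ t ((extChartAt (𝓡 (2 * n + 1)) x₀).symm y)))
        (fderiv ℝ (fun z => extChartAt (𝓡 (2 * n + 1)) x₁
          (Φ t ((extChartAt (𝓡 (2 * n + 1)) x₀).symm z))) y u) =
        Φ.differential (n := n) t ((extChartAt (𝓡 (2 * n + 1)) x₀).symm y)
          (chartFrame (𝓡 (2 * n + 1)) x₀ y u) := fun u =>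
      chartFrame_fderiv (f := fun q => Φ t q) hy (hΦ.contMDiff_time t).contMDiffAt hy' u
    rw [S.chartMetric_apply, h, h, (extChartAt (𝓡 (2 * n + 1)) x₁).left_inv hy',
      metricAt_flow hS hΦ, S.chartMetric_apply]

end ContactMetricStructure

/-! ### Charts and metrics of a product manifold -/

section ProductCharts

variable {E : Type*} [NormedAddCommGroup E] [NormedSpace ℝ E]
  {H : Type*} [TopologicalSpace H] {I : ModelWithCorners ℝ E H}
  {M : Type*} [TopologicalSpace M] [ChartedSpace H M]
  {E' : Type*} [NormedAddCommGroup E'] [NormedSpace ℝ E']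
  {H' : Type*} [TopologicalSpace H'] {J : ModelWithCorners ℝ E' H'}
  {N : Type*} [TopologicalSpace N] [ChartedSpace H' N]

theorem productMetric_apply (g : MetricTensor I M) (h : MetricTensor J N) (z : M × N)
    (u v : E × E') : productMetric I J g h z u v = g z.1 u.1 v.1 + h z.2 u.2 v.2 := by
  simp only [productMetric, pullbackMetric, mfderiv_fst, mfderiv_snd]
  rfl

variable [I.Boundaryless] [IsManifold I ∞ M] [J.Boundaryless] [IsManifold J ∞ N]

theorem chartFrame_prod {z : M × N} {y : E × E'} (hy : y ∈ (extChartAt (I.prod J) z).target)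
    (u : E × E') :
    chartFrame (I.prod J) z y u = (chartFrame I z.1 y.1 u.1, chartFrame J z.2 y.2 u.2) := by
  have hy' : y.1 ∈ (extChartAt I z.1).target ∧ y.2 ∈ (extChartAt J z.2).target := by
    rwa [extChartAt_prod] at hy
  have h1 := (contMDiffAt_extChartAt_symm_of_mem hy'.1).mdifferentiableAt (n := ∞) (by simp)
  have h2 := (contMDiffAt_extChartAt_symm_of_mem hy'.2).mdifferentiableAt (n := ∞) (by simp)
  have f1 : HasMFDerivAt 𝓘(ℝ, E × E') 𝓘(ℝ, E) (fun y : E × E' => y.1) y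
      (ContinuousLinearMap.fst ℝ E E') := hasFDerivAt_fst.hasMFDerivAt
  have f2 : HasMFDerivAt 𝓘(ℝ, E × E') 𝓘(ℝ, E') (fun y : E × E' => y.2) y
      (ContinuousLinearMap.snd ℝ E E') := hasFDerivAt_snd.hasMFDerivAt
  have h3 := (HasMFDerivAt.comp y h1.hasMFDerivAt f1).prodMk
    (HasMFDerivAt.comp y h2.hasMFDerivAt f2)
  have h4 : ((extChartAt (I.prod J) z).symm : E × E' → M × N) = fun y =>
      (((extChartAt I z.1).symm ∘ fun y : E × E' => y.1) y,
        ((extChartAt J z.2).symm ∘ fun y : E × E' => y.2) y) := by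
    rw [extChartAt_prod]
    rfl
  rw [chartFrame, h4]
  exact DFunLike.congr_fun h3.mfderiv u

theorem metricInChart_productMetric (g : MetricTensor I M) (h : MetricTensor J N) {z : M × N}
    {y : E × E'} (hy : y ∈ (extChartAt (I.prod J) z).target) (u v : E × E') :
    metricInChart (I.prod J) (productMetric I J g h) z y u v =
      metricInChart I g z.1 y.1 u.1 v.1 + metricInChart J h z.2 y.2 u.2 v.2 := by
  have h1 : metricInChart (I.prod J) (productMetric I J g h) z y u v =
      productMetric I J g h ((extChartAt (I.prod J) z).symm y) (chartFrame (I.prod J) z y u)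
        (chartFrame (I.prod J) z y v) := rfl
  rw [h1, chartFrame_prod hy, chartFrame_prod hy, productMetric_apply, extChartAt_prod]
  rfl

end ProductCharts

theorem LocalRiem.contDiffAt_pullback_apply {E : Type*} [NormedAddCommGroup E] [NormedSpace ℝ E]
    {F : Type*} [NormedAddCommGroup F] [NormedSpace ℝ F] {K : F → F →L[ℝ] F →L[ℝ] ℝ} {f : E → F}
    {x : E} (hK : ContDiffAt ℝ ∞ K (f x)) (hf : ContDiffAt ℝ ∞ f x) (u v : E) :
    ContDiffAt ℝ ∞ (fun y => K (f y) (fderiv ℝ f y u) (fderiv ℝ f y v)) x :=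
  ((hK.comp x hf).clm_apply (contDiffAt_fderiv_apply hf contDiffAt_const)).clm_apply
    (contDiffAt_fderiv_apply hf contDiffAt_const)

/-! ### Invariance of `ξ` under its flow, and the immersion in charts -/

namespace ContactMetricStructure

open LocalRiem

variable {n : ℕ} {N : Type*} [TopologicalSpace N]
  [ChartedSpace (EuclideanSpace ℝ (Fin (2 * n + 1))) N] [IsManifold (𝓡 (2 * n + 1)) ∞ N]
  {S : ContactMetricStructure n N} {Φ : Flow ℝ N}
  {r : ℕ} {M : Type*} [TopologicalSpace M] [ChartedSpace (EuclideanSpace ℝ (Fin r)) M]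
  [IsManifold (𝓡 r) ∞ M] {i : M → N}

theorem _root_.IsFlowOf.mfderiv_time (hΦ : IsFlowOf Φ S.ξ) (t : ℝ) (q : N) (a : ℝ) :
    mfderiv 𝓘(ℝ, ℝ) (𝓡 (2 * n + 1)) (fun t => Φ t q) t a = a • S.ξAt (Φ t q) := by
  rw [(hΦ.2 q t).mfderiv]
  rfl

/-- The flow of `ξ` preserves `ξ`. -/
theorem _root_.IsFlowOf.differential_ξAt (hΦ : IsFlowOf Φ S.ξ) (t : ℝ) (q : N) :
    Φ.differential (n := n) t q (S.ξAt q) = S.ξAt (Φ t q) := by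
  have h1 : mfderiv 𝓘(ℝ, ℝ) (𝓡 (2 * n + 1)) (fun s => Φ t (Φ s q)) 0 (1 : ℝ) =
      Φ.differential (n := n) t (Φ 0 q)
        (mfderiv 𝓘(ℝ, ℝ) (𝓡 (2 * n + 1)) (fun s => Φ s q) 0 (1 : ℝ)) :=
    DFunLike.congr_fun (mfderiv_comp 0 ((hΦ.contMDiff_time t).mdifferentiableAt (by simp))
      (hΦ.2 q 0).mdifferentiableAt) (1 : ℝ)
  -- The flow maps commute, so `Φ_t` sends the orbit of `q` to the orbit of `Φ_t q` with its
  -- parametrization; the velocities at `s = 0` are compared.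
  have h2 : (fun s => Φ t (Φ s q)) = fun s => Φ s (Φ t q) := by
    funext s
    rw [← Φ.map_add, add_comm, Φ.map_add]
  have h3 := hΦ.mfderiv_time 0 (Φ t q) 1
  rw [← h2, one_smul, Φ.map_zero_apply] at h3
  rw [hΦ.mfderiv_time, one_smul, Φ.map_zero_apply] at h1
  exact h1.symm.trans h3

/-- The differential of a map into `N`, on the model spaces. -/
def differentialAt (i : M → N) (p : M) :
    EuclideanSpace ℝ (Fin r) →L[ℝ] EuclideanSpace ℝ (Fin (2 * n + 1)) :=
  mfderiv (𝓡 r) (𝓡 (2 * n + 1)) i p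

/-- The pullback of the metric under `i` in the preferred chart at `p`. -/
def pullbackForm (S : ContactMetricStructure n N) (i : M → N) (p : M)
    (y : EuclideanSpace ℝ (Fin r)) :
    EuclideanSpace ℝ (Fin r) →L[ℝ] EuclideanSpace ℝ (Fin r) →L[ℝ] ℝ :=
  (S.metricAt (i ((extChartAt (𝓡 r) p).symm y))).bilinearComp
    (differentialAt i ((extChartAt (𝓡 r) p).symm y) ∘L chartFrame (𝓡 r) p y)
    (differentialAt i ((extChartAt (𝓡 r) p).symm y) ∘L chartFrame (𝓡 r) p y)

theorem metricInChart_pullbackMetric (p : M) :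
    metricInChart (𝓡 r) (pullbackMetric (𝓡 r) (𝓡 (2 * n + 1)) S.metric i) p =
      ofForm (S.pullbackForm i p) := rfl

/-- A map into `N` in the preferred charts. -/
def inCharts (i : M → N) (p : M) (y : EuclideanSpace ℝ (Fin r)) :
    EuclideanSpace ℝ (Fin (2 * n + 1)) :=
  extChartAt (𝓡 (2 * n + 1)) (i p) (i ((extChartAt (𝓡 r) p).symm y))

theorem eventually_mem_charts (hi : ContMDiff (𝓡 r) (𝓡 (2 * n + 1)) ∞ i) (p : M) :
    ∀ᶠ y in 𝓝 (extChartAt (𝓡 r) p p), y ∈ (extChartAt (𝓡 r) p).target ∧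
      i ((extChartAt (𝓡 r) p).symm y) ∈ (extChartAt (𝓡 (2 * n + 1)) (i p)).source := by
  refine (eventually_mem_target (mem_extChartAt_target p)).and ?_
  have hc : ContinuousAt (fun y => i ((extChartAt (𝓡 r) p).symm y)) (extChartAt (𝓡 r) p p) :=
    hi.continuous.continuousAt.comp (continuousAt_extChartAt_symm p)
  refine hc.eventually ((isOpen_extChartAt_source (i p)).mem_nhds ?_)
  simpa only [extChartAt_to_inv] using mem_extChartAt_source (i p)

theorem pullbackForm_apply (hi : ContMDiff (𝓡 r) (𝓡 (2 * n + 1)) ∞ i) {p : M}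
    {y : EuclideanSpace ℝ (Fin r)} (hy : y ∈ (extChartAt (𝓡 r) p).target ∧
      i ((extChartAt (𝓡 r) p).symm y) ∈ (extChartAt (𝓡 (2 * n + 1)) (i p)).source)
    (u v : EuclideanSpace ℝ (Fin r)) :
    S.pullbackForm i p y u v = S.chartMetric (i p) (inCharts i p y)
      (fderiv ℝ (inCharts i p) y u) (fderiv ℝ (inCharts i p) y v) := by
  have h : ∀ u, chartFrame (𝓡 (2 * n + 1)) (i p) (inCharts i p y)
      (fderiv ℝ (inCharts i p) y u) =
      differentialAt i ((extChartAt (𝓡 r) p).symm y) (chartFrame (𝓡 r) p y u) := fun u =>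
    chartFrame_fderiv hy.1 hi.contMDiffAt hy.2 u
  rw [chartMetric_apply, h, h, inCharts, (extChartAt (𝓡 (2 * n + 1)) (i p)).left_inv hy.2]
  rfl

theorem eventually_isSmoothMapAt (hi : IsSmoothImmersion (𝓡 r) (𝓡 (2 * n + 1)) i) (p : M) :
    ∀ᶠ y in 𝓝 (extChartAt (𝓡 r) p p),
      IsSmoothMapAt (S.pullbackForm i p) (S.chartMetric (i p)) (inCharts i p) y := by
  filter_upwards [(eventually_mem_charts hi.1 p).eventually_nhds] with y hy
  have hy0 := hy.self_of_nhds
  have hs : ContDiffAt ℝ ∞ (inCharts i p) y :=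
    contDiffAt_written (f := i) hy0.1 hi.1.contMDiffAt hy0.2
  have hc : IsMetricAt (S.chartMetric (i p)) (inCharts i p y) :=
    S.isMetricAt_chartMetric ((extChartAt (𝓡 (2 * n + 1)) (i p)).map_source hy0.2)
  refine ⟨⟨?_, fun u v => S.metricAt_symm _ _ _, fun u hu => S.metricAt_pos _ fun h => hu ?_⟩,
    hc, hs⟩
  · obtain ⟨s, hs1, hso, hys⟩ := eventually_nhds_iff.1 hy
    -- Smoothness is tested on fixed vectors over an open set, where the form is the chart metric
    -- evaluated on derivatives of the immersion.
    refine contDiffAt_clm_of_forall_mem hso (fun u z hz => ?_) hys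
    refine contDiffAt_clm_of_forall_mem hso (fun v z hz => ?_) hz
    have hf : ContDiffAt ℝ ∞ (inCharts i p) z :=
      contDiffAt_written (f := i) (hs1 z hz).1 hi.1.contMDiffAt (hs1 z hz).2
    have hK : ContDiffAt ℝ ∞ (S.chartMetric (i p)) (inCharts i p z) :=
      S.contDiffAt_chartMetric ((extChartAt (𝓡 (2 * n + 1)) (i p)).map_source (hs1 z hz).2)
    have h1 := contDiffAt_pullback_apply hK hf u v
    exact h1.congr_of_eventuallyEq ((hso.eventually_mem hz).mono fun z' hz' =>
      pullbackForm_apply hi.1 (hs1 z' hz') u v)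
  -- Definiteness of `i^* g` comes from injectivity of `di` and invertibility of the chart frame.
  · have h2 := hi.2 _ (h.trans (map_zero (mfderiv (𝓡 r) (𝓡 (2 * n + 1)) i _)).symm)
    have hA := isInvertible_chartFrame (I := 𝓡 r) hy0.1
    have h3 := hA.inverse_apply_self u
    have h4 : chartFrame (𝓡 r) p y u = 0 := h2
    rw [h4, map_zero] at h3
    exact h3.symm

end ContactMetricStructure

/-! ### The one-dimensional factor: the line and the circles treated together -/

section Lines

variable {C : Type*} [TopologicalSpace C] [ChartedSpace ℝ C]

/-- The metric `dt²` on a 1-manifold. -/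
def unitMetric (C : Type*) [TopologicalSpace C] [ChartedSpace ℝ C] : MetricTensor 𝓘(ℝ, ℝ) C :=
  fun _ (a b : ℝ) => a * b

/-- `ρ` is inverse to all charts of the 1-manifold `C`, and its velocity is constantly `1`. -/
structure IsGlobalParametrization (ρ : ℝ → C) : Prop where
  symm_eq : ∀ (q : C) (s : ℝ), (extChartAt 𝓘(ℝ, ℝ) q).symm s = ρ s
  hasMFDerivAt : ∀ s, HasMFDerivAt 𝓘(ℝ, ℝ) 𝓘(ℝ, ℝ) ρ s (ContinuousLinearMap.id ℝ ℝ)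

variable {ρ : ℝ → C}

theorem IsGlobalParametrization.apply_chart (hρ : IsGlobalParametrization ρ) {q q' : C}
    (hq : q' ∈ (extChartAt 𝓘(ℝ, ℝ) q).source) : ρ (extChartAt 𝓘(ℝ, ℝ) q q') = q' := by
  rw [← hρ.symm_eq q, (extChartAt 𝓘(ℝ, ℝ) q).left_inv hq]

theorem IsGlobalParametrization.metricInChart (hρ : IsGlobalParametrization ρ) (q : C) (s a b : ℝ) :
    metricInChart 𝓘(ℝ, ℝ) (unitMetric C) q s a b = a * b := by
  have h : ((extChartAt 𝓘(ℝ, ℝ) q).symm : ℝ → C) = ρ := funext (hρ.symm_eq q)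
  rw [_root_.metricInChart, h]
  have h2 : ∀ a : ℝ, mfderiv 𝓘(ℝ, ℝ) 𝓘(ℝ, ℝ) ρ s a = a := fun a =>
    DFunLike.congr_fun (hρ.hasMFDerivAt s).mfderiv a
  exact congrArg₂ (· * ·) (h2 a) (h2 b)

end Lines

/-! ### Tension and bitension fields of the suspension on the manifold -/

namespace ContactMetricStructure

open LocalRiem

variable {n : ℕ} {N : Type*} [TopologicalSpace N]
  [ChartedSpace (EuclideanSpace ℝ (Fin (2 * n + 1))) N] [IsManifold (𝓡 (2 * n + 1)) ∞ N]
  {S : ContactMetricStructure n N} {Φ : Flow ℝ N}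
  {r : ℕ} {M : Type*} [TopologicalSpace M] [ChartedSpace (EuclideanSpace ℝ (Fin r)) M]
  [IsManifold (𝓡 r) ∞ M] {i : M → N}
  {C : Type*} [TopologicalSpace C] [ChartedSpace ℝ C] [IsManifold 𝓘(ℝ, ℝ) ∞ C] {ρ : ℝ → C}
  {F : C × M → N}

/-- The metric `dt² + i^* g`. -/
def suspensionMetric (S : ContactMetricStructure n N) (C : Type*) [TopologicalSpace C]
    [ChartedSpace ℝ C] (i : M → N) : MetricTensor (𝓘(ℝ, ℝ).prod (𝓡 r)) (C × M) :=
  productMetric 𝓘(ℝ, ℝ) (𝓡 r) (unitMetric C)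
    (pullbackMetric (𝓡 r) (𝓡 (2 * n + 1)) S.metric i)

theorem extChartAt_prod_apply (z : C × M) : extChartAt (𝓘(ℝ, ℝ).prod (𝓡 r)) z z =
    (extChartAt 𝓘(ℝ, ℝ) z.1 z.1, extChartAt (𝓡 r) z.2 z.2) := by
  rw [extChartAt_prod]
  rfl

theorem metricInChart_suspensionMetric (hρ : IsGlobalParametrization ρ) (z : C × M) :
    metricInChart (𝓘(ℝ, ℝ).prod (𝓡 r)) (S.suspensionMetric C i) z
      =ᶠ[𝓝 (extChartAt (𝓘(ℝ, ℝ).prod (𝓡 r)) z z)]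
      ofForm (prodForm (S.pullbackForm i z.2)) := by
  filter_upwards [eventually_mem_target (mem_extChartAt_target z)] with y hy
  funext u v
  rw [suspensionMetric, metricInChart_productMetric _ _ hy, hρ.metricInChart,
    metricInChart_pullbackMetric]
  rfl

/-- The time `s` map of the flow in the preferred charts at `q` and `Φ s q`. -/
def flowInCharts (Φ : Flow ℝ N) (s : ℝ) (q : N) (y : EuclideanSpace ℝ (Fin (2 * n + 1))) :
    EuclideanSpace ℝ (Fin (2 * n + 1)) :=
  extChartAt (𝓡 (2 * n + 1)) (Φ s q) (Φ s ((extChartAt (𝓡 (2 * n + 1)) q).symm y))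

theorem eventually_isSmoothIsometryAt_flowInCharts (hS : S.IsSasakian) (hΦ : IsFlowOf Φ S.ξ) (s : ℝ)
    (q : N) : ∀ᶠ y in 𝓝 (extChartAt (𝓡 (2 * n + 1)) q q),
      IsSmoothIsometryAt (S.chartMetric q) (S.chartMetric (Φ s q)) (flowInCharts Φ s q) y := by
  filter_upwards [eventually_mem_charts (hΦ.contMDiff_time s) q] with y hy
  exact isSmoothIsometryAt_flow hS hΦ s hy.1 hy.2

theorem flowInCharts_self (s : ℝ) (q : N) :
    flowInCharts Φ s q (extChartAt (𝓡 (2 * n + 1)) q q) =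
      extChartAt (𝓡 (2 * n + 1)) (Φ s q) (Φ s q) := by
  rw [flowInCharts, extChartAt_to_inv]

theorem inCharts_self (p : M) : inCharts (n := n) i p (extChartAt (𝓡 r) p p) =
    extChartAt (𝓡 (2 * n + 1)) (i p) (i p) := by
  rw [inCharts, extChartAt_to_inv]

/-- The splitting `Φ_t = Φ_{t - s} ∘ Φ_s`. The first factor stays in the chart at `Φ_s (i p)` for
`t` near `s`, and the second is the fixed isometry from the chart at `i p`. -/
theorem writtenInExtChartAt_suspension (hΦ : IsFlowOf Φ S.ξ)
    (hi : IsSmoothImmersion (𝓡 r) (𝓡 (2 * n + 1)) i) (hρ : IsGlobalParametrization ρ)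
    (hF : ∀ s p, F (ρ s, p) = Φ s (i p)) (s : ℝ) {z : C × M} (hz : ρ s = z.1) :
    writtenInExtChartAt (𝓘(ℝ, ℝ).prod (𝓡 r)) (𝓡 (2 * n + 1)) z F
      =ᶠ[𝓝 (s, extChartAt (𝓡 r) z.2 z.2)]
      fun y => Φ.inChart (n := n) (Φ s (i z.2)) s
        (y.1, flowInCharts (n := n) Φ s (i z.2) (inCharts i z.2 y.2)) := by
  have hFz : F z = Φ s (i z.2) := by rw [← hF, hz]
  have h1 := (continuousAt_snd (p := ((s, extChartAt (𝓡 r) z.2 z.2) :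
    ℝ × EuclideanSpace ℝ (Fin r)))).eventually ((eventually_mem_charts hi.1 z.2).and
      ((eventually_isSmoothMapAt (S := S) hi z.2).self_of_nhds.smooth.continuousAt.eventually
        (by rw [inCharts_self]; exact eventually_mem_charts (hΦ.contMDiff_time s) (i z.2))))
  filter_upwards [h1] with y hy
  have e1 : (extChartAt (𝓡 (2 * n + 1)) (i z.2)).symm (inCharts (n := n) i z.2 y.2) =
      i ((extChartAt (𝓡 r) z.2).symm y.2) :=
    (extChartAt (𝓡 (2 * n + 1)) (i z.2)).left_inv hy.1.2
  have e2 := (extChartAt (𝓡 (2 * n + 1)) (Φ s (i z.2))).left_inv hy.2.2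
  have e3 : writtenInExtChartAt (𝓘(ℝ, ℝ).prod (𝓡 r)) (𝓡 (2 * n + 1)) z F y =
      extChartAt (𝓡 (2 * n + 1)) (F z)
        (F ((extChartAt 𝓘(ℝ, ℝ) z.1).symm y.1, (extChartAt (𝓡 r) z.2).symm y.2)) := by
    rw [writtenInExtChartAt, extChartAt_prod]
    rfl
  rw [e3, hFz, hρ.symm_eq, hF, Flow.inChart, flowInCharts, e2, e1, ← Φ.map_add, sub_add_cancel]

variable (S) in
theorem eventually_isSmoothMapAt_flow (hS : S.IsSasakian) (hΦ : IsFlowOf Φ S.ξ)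
    (hi : IsSmoothImmersion (𝓡 r) (𝓡 (2 * n + 1)) i) (s : ℝ) (p : M) :
    ∀ᶠ y in 𝓝 (extChartAt (𝓡 r) p p), IsSmoothMapAt (S.pullbackForm i p)
      (S.chartMetric (Φ s (i p)))
      (fun y => flowInCharts (n := n) Φ s (i p) (inCharts i p y)) y := by
  have h1 := eventually_isSmoothMapAt (S := S) hi p
  have h2 := eventually_isSmoothIsometryAt_flowInCharts hS hΦ s (i p)
  rw [← inCharts_self (r := r)] at h2
  filter_upwards [h1, h1.self_of_nhds.smooth.continuousAt.eventually h2] with y hy hy2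
  exact hy.comp_isometry hy2

theorem eventually_isGeodesicFlowAt (hS : S.IsSasakian) (hΦ : IsFlowOf Φ S.ξ) (s : ℝ) (q : N) :
    ∀ᶠ w in 𝓝 (s, extChartAt (𝓡 (2 * n + 1)) q q), IsGeodesicFlowAt (S.chartMetric q)
      (coordRep (𝓡 (2 * n + 1)) q S.ξ) (Φ.inChart (n := n) q s) w :=
  (hΦ.eventually_mem_chartDomain (Φ.mk_mem_chartDomain (mem_extChartAt_target q))).mono
    fun _ hw => isGeodesicFlowAt_inChart hS hΦ hw

theorem eventually_inChart_initial (s : ℝ) (q : N) :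
    ∀ᶠ y in 𝓝 (extChartAt (𝓡 (2 * n + 1)) q q), Φ.inChart (n := n) q s (s, y) = y :=
  (eventually_mem_target (mem_extChartAt_target q)).mono fun _ hy => Φ.inChart_initial hy

/-- The tension field of the suspension is the image of the tension field of `i`. -/
theorem tensionField_suspension (hS : S.IsSasakian) (hΦ : IsFlowOf Φ S.ξ)
    (hi : IsSmoothImmersion (𝓡 r) (𝓡 (2 * n + 1)) i) (hρ : IsGlobalParametrization ρ)
    (hF : ∀ s p, F (ρ s, p) = Φ s (i p)) {s : ℝ} {z : C × M} (hz : ρ s = z.1)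
    (hs : extChartAt 𝓘(ℝ, ℝ) z.1 z.1 = s) :
    tensionField (𝓘(ℝ, ℝ).prod (𝓡 r)) (𝓡 (2 * n + 1)) (S.suspensionMetric C i) S.metric F z =
      fderiv ℝ (flowInCharts (n := n) Φ s (i z.2)) (inCharts i z.2 (extChartAt (𝓡 r) z.2 z.2))
        (tension (ofForm (S.pullbackForm i z.2)) (ofForm (S.chartMetric (i z.2)))
          (inCharts i z.2) (extChartAt (𝓡 r) z.2 z.2)) := by
  have hFz : F z = Φ s (i z.2) := by rw [← hF, hz]
  have hG := metricInChart_suspensionMetric (r := r) (S := S) (i := i) hρ z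
  have hw := writtenInExtChartAt_suspension (r := r) hΦ hi hρ hF s hz
  have hψ := eventually_isSmoothIsometryAt_flowInCharts hS hΦ s (i z.2)
  have hΨ := eventually_isGeodesicFlowAt hS hΦ s (Φ s (i z.2))
  have h0 := (eventually_inChart_initial (n := n) (Φ := Φ) s (Φ s (i z.2)))
  rw [← flowInCharts_self, ← inCharts_self (r := r)] at hΨ h0
  rw [← inCharts_self (r := r)] at hψ
  rw [tensionField, hFz, metricInChart_eq, extChartAt_prod_apply, hs]
  rw [extChartAt_prod_apply, hs] at hG
  rw [tension_congr hG Filter.EventuallyEq.rfl hw,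
    tension_suspension (j := fun y => flowInCharts (n := n) Φ s (i z.2) (inCharts i z.2 y))
      (Ψ := Φ.inChart (n := n) (Φ s (i z.2)) s)
      (S.eventually_isSmoothMapAt_flow hS hΦ hi s z.2) hΨ,
    tension_comp_isometry (f := inCharts i z.2) (ψ := flowInCharts (n := n) Φ s (i z.2))
      (eventually_isSmoothMapAt hi z.2) hψ]
  -- The remaining factor is the differential of the restarted flow at its initial time, which is
  -- the identity.
  have h1 := fderiv_comp_mk_right (hΨ.self_of_nhds.smooth.differentiableAt (by simp))
  rw [← h1]
  have h2 : (fun y => Φ.inChart (n := n) (Φ s (i z.2)) s (s, y)) =ᶠ[𝓝 (flowInCharts (n := n) Φ s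
      (i z.2) (inCharts i z.2 (extChartAt (𝓡 r) z.2 z.2)))] id := h0
  rw [h2.fderiv_eq, fderiv_id]
  rfl

/-- The bitension field of the suspension is the image of the bitension field of `i`. -/
theorem bitensionField_suspension (hS : S.IsSasakian) (hΦ : IsFlowOf Φ S.ξ)
    (hi : IsSmoothImmersion (𝓡 r) (𝓡 (2 * n + 1)) i) (hρ : IsGlobalParametrization ρ)
    (hF : ∀ s p, F (ρ s, p) = Φ s (i p)) {s : ℝ} {z : C × M} (hz : ρ s = z.1)
    (hs : extChartAt 𝓘(ℝ, ℝ) z.1 z.1 = s) :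
    bitensionField (𝓘(ℝ, ℝ).prod (𝓡 r)) (𝓡 (2 * n + 1)) (S.suspensionMetric C i) S.metric F z =
      fderiv ℝ (flowInCharts (n := n) Φ s (i z.2)) (inCharts i z.2 (extChartAt (𝓡 r) z.2 z.2))
        (bitension (ofForm (S.pullbackForm i z.2)) (ofForm (S.chartMetric (i z.2)))
          (inCharts i z.2) (extChartAt (𝓡 r) z.2 z.2)) := by
  have hFz : F z = Φ s (i z.2) := by rw [← hF, hz]
  have hG := metricInChart_suspensionMetric (r := r) (S := S) (i := i) hρ z
  have hw := writtenInExtChartAt_suspension (r := r) hΦ hi hρ hF s hz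
  have hψ := eventually_isSmoothIsometryAt_flowInCharts hS hΦ s (i z.2)
  have hΨ := eventually_isGeodesicFlowAt hS hΦ s (Φ s (i z.2))
  have h0 := (eventually_inChart_initial (n := n) (Φ := Φ) s (Φ s (i z.2)))
  have hK : ∀ᶠ y in 𝓝 (extChartAt (𝓡 (2 * n + 1)) (Φ s (i z.2)) (Φ s (i z.2))),
      IsMetricAt (S.chartMetric (Φ s (i z.2))) y :=
    (eventually_mem_target (mem_extChartAt_target _)).mono fun _ hy => S.isMetricAt_chartMetric hy
  rw [← flowInCharts_self, ← inCharts_self (r := r)] at hΨ h0 hK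
  rw [← inCharts_self (r := r)] at hψ
  have hj := S.eventually_isSmoothMapAt_flow hS hΦ hi s z.2
  rw [bitensionField, hFz, metricInChart_eq, extChartAt_prod_apply, hs]
  rw [extChartAt_prod_apply, hs] at hG
  rw [bitension_congr (ContinuousAt.congr (contDiffAt_suspension (z := (s, _))
      hj.self_of_nhds.smooth hΨ.self_of_nhds.smooth).continuousAt hw.symm) hG Filter.EventuallyEq.rfl hw,
    bitension_suspension (j := fun y => flowInCharts (n := n) Φ s (i z.2) (inCharts i z.2 y))
      (Ψ := Φ.inChart (n := n) (Φ s (i z.2)) s) hj hΨ h0,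
    bitension_comp_isometry (f := inCharts i z.2) (ψ := flowInCharts (n := n) Φ s (i z.2))
      (eventually_isSmoothMapAt hi z.2) hψ hK]

end ContactMetricStructure

/-! ### The equivalence for proper-biharmonicity and the Riemannian immersion -/

theorem LocalRiem.IsSmoothIsometryAt.fderiv_eq_zero_iff {F : Type*} [NormedAddCommGroup F]
    [NormedSpace ℝ F] {K K' : F → F →L[ℝ] F →L[ℝ] ℝ} {ψ : F → F} {y : F}
    (h : IsSmoothIsometryAt K K' ψ y) {u : F} : fderiv ℝ ψ y u = 0 ↔ u = 0 := by
  refine ⟨fun hu => ?_, fun hu => by rw [hu, map_zero]⟩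
  by_contra h0
  have := h.dom.pos u h0
  rw [← h.isometry u u, hu] at this
  simp at this

/-- Near `q` the composite of `ρ` with the chart is the identity, and `ρ` has derivative `1`. -/
theorem IsGlobalParametrization.mfderiv_extChartAt {C : Type*} [TopologicalSpace C]
    [ChartedSpace ℝ C] [IsManifold 𝓘(ℝ, ℝ) ∞ C] {ρ : ℝ → C} (hρ : IsGlobalParametrization ρ)
    (q : C) (a : ℝ) : mfderiv 𝓘(ℝ, ℝ) 𝓘(ℝ, ℝ) (extChartAt 𝓘(ℝ, ℝ) q) q a = a := by
  have h1 : MDifferentiableAt 𝓘(ℝ, ℝ) 𝓘(ℝ, ℝ) (extChartAt 𝓘(ℝ, ℝ) q) q :=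
    (contMDiffAt_extChartAt (n := ∞)).mdifferentiableAt (by simp)
  have h2 := HasMFDerivAt.comp q (hρ.hasMFDerivAt (extChartAt 𝓘(ℝ, ℝ) q q)) h1.hasMFDerivAt
  have h3 : (id : C → C) =ᶠ[𝓝 q] ρ ∘ extChartAt 𝓘(ℝ, ℝ) q := by
    filter_upwards [(isOpen_extChartAt_source (I := 𝓘(ℝ, ℝ)) q).mem_nhds (mem_extChartAt_source (I := 𝓘(ℝ, ℝ)) q)] with q' hq'
    exact (hρ.apply_chart hq').symm
  have h4 := hasMFDerivAt_unique (hasMFDerivAt_id q) (h2.congr_of_eventuallyEq h3)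
  exact (DFunLike.congr_fun h4 a).symm

namespace ContactMetricStructure

open LocalRiem

variable {n : ℕ} {N : Type*} [TopologicalSpace N]
  [ChartedSpace (EuclideanSpace ℝ (Fin (2 * n + 1))) N] [IsManifold (𝓡 (2 * n + 1)) ∞ N]
  {S : ContactMetricStructure n N} {Φ : Flow ℝ N}
  {r : ℕ} {M : Type*} [TopologicalSpace M] [ChartedSpace (EuclideanSpace ℝ (Fin r)) M]
  [IsManifold (𝓡 r) ∞ M] {i : M → N}
  {C : Type*} [TopologicalSpace C] [ChartedSpace ℝ C] [IsManifold 𝓘(ℝ, ℝ) ∞ C] {ρ : ℝ → C}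
  {F : C × M → N}

/-- At `z` both fields of `F` are images of the fields of `i` at `z.2` under the injective `dΦ_s`,
with `s` the chart coordinate of `z.1`. Every `p` occurs as the second component of `(ρ 0, p)`, so
vanishing everywhere is the same condition on both sides. -/
theorem isProperBiharmonicMap_suspension_iff (hS : S.IsSasakian) (hΦ : IsFlowOf Φ S.ξ)
    (hi : IsSmoothImmersion (𝓡 r) (𝓡 (2 * n + 1)) i) (hρ : IsGlobalParametrization ρ)
    (hF : ∀ s p, F (ρ s, p) = Φ s (i p)) :
    IsProperBiharmonicMap (𝓘(ℝ, ℝ).prod (𝓡 r)) (𝓡 (2 * n + 1)) (S.suspensionMetric C i)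
        S.metric F ↔
      IsProperBiharmonicMap (𝓡 r) (𝓡 (2 * n + 1))
        (pullbackMetric (𝓡 r) (𝓡 (2 * n + 1)) S.metric i) S.metric i := by
  have hψ : ∀ (s : ℝ) (p : M) (u : EuclideanSpace ℝ (Fin (2 * n + 1))),
      fderiv ℝ (flowInCharts (n := n) Φ s (i p)) (inCharts i p (extChartAt (𝓡 r) p p)) u = 0 ↔
        u = 0 := by
    intro s p u
    have h := eventually_isSmoothIsometryAt_flowInCharts hS hΦ s (i p)
    rw [← inCharts_self (r := r)] at h
    exact h.self_of_nhds.fderiv_eq_zero_iff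
  have h1 : ∀ z : C × M, tensionField (𝓘(ℝ, ℝ).prod (𝓡 r)) (𝓡 (2 * n + 1))
      (S.suspensionMetric C i) S.metric F z = 0 ↔
      tensionField (𝓡 r) (𝓡 (2 * n + 1)) (pullbackMetric (𝓡 r) (𝓡 (2 * n + 1)) S.metric i)
        S.metric i z.2 = 0 := by
    intro z
    have h := tensionField_suspension hS hΦ hi hρ hF
      (hρ.apply_chart (mem_extChartAt_source z.1)) rfl
    exact (Eq.congr_left h).trans (hψ _ _ _)
  have h2 : ∀ z : C × M, bitensionField (𝓘(ℝ, ℝ).prod (𝓡 r)) (𝓡 (2 * n + 1))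
      (S.suspensionMetric C i) S.metric F z = 0 ↔
      bitensionField (𝓡 r) (𝓡 (2 * n + 1)) (pullbackMetric (𝓡 r) (𝓡 (2 * n + 1)) S.metric i)
        S.metric i z.2 = 0 := by
    intro z
    have h := bitensionField_suspension hS hΦ hi hρ hF
      (hρ.apply_chart (mem_extChartAt_source z.1)) rfl
    exact (Eq.congr_left h).trans (hψ _ _ _)
  refine and_congr ?_ (not_congr ?_)
  · exact ⟨fun h p => (h2 (ρ 0, p)).1 (h _), fun h z => (h2 z).2 (h _)⟩
  · exact ⟨fun h p => (h1 (ρ 0, p)).1 (h _), fun h z => (h1 z).2 (h _)⟩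

/-- A chart of the one-dimensional factor is a local choice of time. On the circle there is no
global one, but this local form is enough for differentiation. -/
theorem suspension_eventuallyEq (hρ : IsGlobalParametrization ρ)
    (hF : ∀ s p, F (ρ s, p) = Φ s (i p)) (z : C × M) :
    F =ᶠ[𝓝 z] fun w => Φ (extChartAt 𝓘(ℝ, ℝ) z.1 w.1) (i w.2) := by
  filter_upwards [continuousAt_fst.eventually
    ((isOpen_extChartAt_source z.1).mem_nhds (mem_extChartAt_source (I := 𝓘(ℝ, ℝ)) z.1))] with w hw
  rw [← hF, hρ.apply_chart hw]

theorem contMDiffAt_suspension (hΦ : IsFlowOf Φ S.ξ)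
    (hi : ContMDiff (𝓡 r) (𝓡 (2 * n + 1)) ∞ i) (z : C × M) :
    ContMDiffAt (𝓘(ℝ, ℝ).prod (𝓡 r)) (𝓡 (2 * n + 1)) ∞
      (fun w : C × M => Φ (extChartAt 𝓘(ℝ, ℝ) z.1 w.1) (i w.2)) z :=
  ContMDiffAt.comp z (g := fun w : ℝ × N => Φ w.1 w.2)
    (f := fun w : C × M => (extChartAt 𝓘(ℝ, ℝ) z.1 w.1, i w.2)) hΦ.1.contMDiffAt
    ((contMDiffAt_extChartAt.comp z contMDiffAt_fst).prodMk (hi.contMDiffAt.comp z contMDiffAt_snd))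

theorem mfderiv_suspension (hΦ : IsFlowOf Φ S.ξ)
    (hi : ContMDiff (𝓡 r) (𝓡 (2 * n + 1)) ∞ i) (hρ : IsGlobalParametrization ρ)
    (hF : ∀ s p, F (ρ s, p) = Φ s (i p)) (z : C × M) (u : ℝ × EuclideanSpace ℝ (Fin r)) :
    mfderiv (𝓘(ℝ, ℝ).prod (𝓡 r)) (𝓡 (2 * n + 1)) F z u =
      u.1 • S.ξAt (Φ (extChartAt 𝓘(ℝ, ℝ) z.1 z.1) (i z.2))
        + Φ.differential (n := n) (extChartAt 𝓘(ℝ, ℝ) z.1 z.1) (i z.2)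
          (differentialAt i z.2 u.2) := by
  have h1 := DFunLike.congr_fun ((suspension_eventuallyEq hρ hF z).mfderiv_eq
    (I := 𝓘(ℝ, ℝ).prod (𝓡 r)) (I' := 𝓡 (2 * n + 1))) u
  refine h1.trans ((mfderiv_prod_eq_add_apply
    ((contMDiffAt_suspension hΦ hi z).mdifferentiableAt (by simp))).trans ?_)
  -- The differential on a product is the sum of the partial ones: the first is the velocity of an
  -- orbit, the second that of `Φ_t ∘ i` at fixed time.
  refine congrArg₂ (· + ·) ?_ ?_
  · have h2 := mfderiv_comp z.1 (I := 𝓘(ℝ, ℝ)) (I' := 𝓘(ℝ, ℝ)) (I'' := 𝓡 (2 * n + 1))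
      (g := fun t => Φ t (i z.2)) (f := extChartAt 𝓘(ℝ, ℝ) z.1)
      (hΦ.2 (i z.2) _).mdifferentiableAt
      ((contMDiffAt_extChartAt (n := ∞)).mdifferentiableAt (by simp))
    refine (DFunLike.congr_fun h2 u.1).trans ?_
    refine (congrArg _ (hρ.mfderiv_extChartAt z.1 u.1)).trans ?_
    exact hΦ.mfderiv_time _ _ _
  · exact DFunLike.congr_fun (mfderiv_comp z.2
      (g := fun q => Φ (extChartAt 𝓘(ℝ, ℝ) z.1 z.1) q) (f := i)
      ((hΦ.contMDiff_time _).mdifferentiableAt (by simp))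
      (hi.mdifferentiableAt (by simp))) u.2

/-- The cross terms vanish: `ξ` and `g` are invariant under the flow, so `g(ξ, dΦ_t di v) = g(ξ, di
v) = η(di v) = 0`. The diagonal terms are `g(ξ, ξ) = 1` and `i^* g`. Injectivity of `dF` then
follows from positivity of `dt² + i^* g`. -/
theorem isRiemannianImmersion_suspension (hS : S.IsSasakian) (hΦ : IsFlowOf Φ S.ξ)
    (hi : S.IsIntegralSubmanifold (r := r) i) (hρ : IsGlobalParametrization ρ)
    (hF : ∀ s p, F (ρ s, p) = Φ s (i p)) :
    IsRiemannianImmersion (𝓘(ℝ, ℝ).prod (𝓡 r)) (𝓡 (2 * n + 1)) (S.suspensionMetric C i)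
      S.metric F := by
  have hη : ∀ t p v, S.metricAt (Φ t (i p)) (S.ξAt (Φ t (i p)))
      (Φ.differential (n := n) t (i p) (differentialAt (r := r) i p v)) = 0 := by
    intro t p v
    rw [← hΦ.differential_ξAt, metricAt_flow hS hΦ, S.metricAt_ξAt]
    exact hi.2 p v
  have hFz : ∀ z, F z = Φ (extChartAt 𝓘(ℝ, ℝ) z.1 z.1) (i z.2) := fun z =>
    (suspension_eventuallyEq hρ hF z).self_of_nhds
  have key : ∀ (z : C × M) (u v : ℝ × EuclideanSpace ℝ (Fin r)),
      pullbackMetric (𝓘(ℝ, ℝ).prod (𝓡 r)) (𝓡 (2 * n + 1)) S.metric F z u v =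
        S.suspensionMetric C i z u v := by
    intro z u v
    have h1 : pullbackMetric (𝓘(ℝ, ℝ).prod (𝓡 r)) (𝓡 (2 * n + 1)) S.metric F z u v =
        S.metricAt (F z) (mfderiv (𝓘(ℝ, ℝ).prod (𝓡 r)) (𝓡 (2 * n + 1)) F z u)
          (mfderiv (𝓘(ℝ, ℝ).prod (𝓡 r)) (𝓡 (2 * n + 1)) F z v) := rfl
    have h2 : S.suspensionMetric C i z u v = u.1 * v.1 + S.metricAt (i z.2)
        (differentialAt i z.2 u.2) (differentialAt i z.2 v.2) := productMetric_apply _ _ z u v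
    rw [h1, h2, mfderiv_suspension hΦ hi.1.1 hρ hF, mfderiv_suspension hΦ hi.1.1 hρ hF, hFz z]
    simp only [map_add, map_smul, add_apply, smul_apply,
      hη, smul_eq_mul, metricAt_flow hS hΦ, S.metricAt_ξAt, S.ηAt_ξAt]
    rw [S.metricAt_symm _ _ (S.ξAt _), hη]
    ring
  refine ⟨⟨fun z => (contMDiffAt_suspension hΦ hi.1.1 z).congr_of_eventuallyEq
    (suspension_eventuallyEq hρ hF z), fun z => ?_⟩, key⟩
  rw [injective_iff_map_eq_zero]
  intro u hu
  have h1 : S.suspensionMetric C i z u u = 0 := by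
    refine (key z u u).symm.trans ?_
    rw [pullbackMetric, hu]
    exact (S.metricAt (F z) 0).map_zero
  have h2 : u.1 * u.1 + S.metricAt (i z.2) (differentialAt i z.2 u.2)
      (differentialAt i z.2 u.2) = 0 := (productMetric_apply _ _ z u u).symm.trans h1
  have h3 : differentialAt (n := n) i z.2 u.2 = 0 := by
    by_contra h0
    have := S.metricAt_pos (i z.2) h0
    nlinarith [mul_self_nonneg (u.1 : ℝ)]
  have h4 : u.2 = 0 := hi.1.2 z.2 (h3.trans (map_zero (differentialAt (n := n) i z.2)).symm)
  rw [h3, map_zero, add_zero] at h2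
  exact Prod.ext (mul_self_eq_zero.1 h2) h4

end ContactMetricStructure

/-! ### The two cases `I = ℝ` and `I = ℝ / Tℤ` -/

theorem isGlobalParametrization_id : IsGlobalParametrization (id : ℝ → ℝ) where
  symm_eq _ _ := rfl
  hasMFDerivAt s := hasMFDerivAt_id s

theorem AddCircle.isGlobalParametrization_coe (T : ℝ) :
    IsGlobalParametrization (fun t : ℝ => (t : AddCircle T)) where
  symm_eq q s := by
    rw [extChartAt_coe_symm]
    exact AddCircle.chart_symm_eq T (chart_mem_atlas ℝ q) s
  hasMFDerivAt t := by
    refine ⟨(AddCircle.continuous_mk' T).continuousAt, HasFDerivAt.hasFDerivWithinAt ?_⟩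
    have h : HasFDerivAt (fun s : ℝ => s + (chartAt ℝ (t : AddCircle T) (t : AddCircle T) - t))
        (ContinuousLinearMap.id ℝ ℝ) t := (hasFDerivAt_id t).add_const _
    exact h.congr_of_eventuallyEq (AddCircle.chart_coe_eventuallyEq T
      (chart_mem_atlas ℝ (t : AddCircle T)) (mem_chart_source ℝ (t : AddCircle T)))

theorem Flow.periodic_of_map_eq_id {N : Type*} [TopologicalSpace N] (Φ : Flow ℝ N) {T : ℝ}
    (h : ∀ q, Φ T q = q) : Periodic (fun t q => Φ t q) T := fun t => by
  funext q
  exact (Φ.map_add t T q).trans (congrArg (Φ t) (h q))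

end

theorem mainTheorem6 {n r : ℕ} (hr : 1 ≤ r) (hrn : r ≤ n)
    {N : Type*} [TopologicalSpace N] [T2Space N]
    [ChartedSpace (EuclideanSpace ℝ (Fin (2 * n + 1))) N] [IsManifold (𝓡 (2 * n + 1)) ∞ N]
    (S : ContactMetricStructure n N) (hS : S.IsSasakian)
    (c : ℝ) (hc : S.HasConstantPhiSectionalCurvature c)
    (hreg : IsStrictlyRegularField S.ξ)
    (Φ : Flow ℝ N) (hΦ : IsFlowOf Φ S.ξ)
    {M : Type*} [TopologicalSpace M] [ChartedSpace (EuclideanSpace ℝ (Fin r)) M]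
    [IsManifold (𝓡 r) ∞ M]
    (i : M → N) (hi : S.IsIntegralSubmanifold (r := r) i) :
    (IsRiemannianImmersion (𝓘(ℝ, ℝ).prod (𝓡 r)) (𝓡 (2 * n + 1))
        (productMetric 𝓘(ℝ, ℝ) (𝓡 r) lineMetric
          (pullbackMetric (𝓡 r) (𝓡 (2 * n + 1)) S.metric i)) S.metric
        (fun z : ℝ × M => Φ z.1 (i z.2)) ∧
      (IsProperBiharmonicMap (𝓘(ℝ, ℝ).prod (𝓡 r)) (𝓡 (2 * n + 1))
        (productMetric 𝓘(ℝ, ℝ) (𝓡 r) lineMetric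
          (pullbackMetric (𝓡 r) (𝓡 (2 * n + 1)) S.metric i)) S.metric
        (fun z : ℝ × M => Φ z.1 (i z.2)) ↔
        IsProperBiharmonicMap (𝓡 r) (𝓡 (2 * n + 1))
          (pullbackMetric (𝓡 r) (𝓡 (2 * n + 1)) S.metric i) S.metric i)) ∧
    (∀ T : ℝ, 0 < T → (∀ q : N, Φ T q = q) →
      ∃ F : AddCircle T × M → N, (∀ (t : ℝ) (p : M), F ((t : AddCircle T), p) = Φ t (i p)) ∧
      IsRiemannianImmersion (𝓘(ℝ, ℝ).prod (𝓡 r)) (𝓡 (2 * n + 1))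
        (productMetric 𝓘(ℝ, ℝ) (𝓡 r) (circleMetric T)
          (pullbackMetric (𝓡 r) (𝓡 (2 * n + 1)) S.metric i)) S.metric F ∧
      (IsProperBiharmonicMap (𝓘(ℝ, ℝ).prod (𝓡 r)) (𝓡 (2 * n + 1))
        (productMetric 𝓘(ℝ, ℝ) (𝓡 r) (circleMetric T)
          (pullbackMetric (𝓡 r) (𝓡 (2 * n + 1)) S.metric i)) S.metric F ↔
        IsProperBiharmonicMap (𝓡 r) (𝓡 (2 * n + 1))
          (pullbackMetric (𝓡 r) (𝓡 (2 * n + 1)) S.metric i) S.metric i)) := by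
  -- Both `lineMetric` and `circleMetric T` unfold to `unitMetric`, so the two cases differ only in
  -- `ρ`: the identity, or the projection to `ℝ / Tℤ`.
  refine ⟨⟨ContactMetricStructure.isRiemannianImmersion_suspension hS hΦ hi
    isGlobalParametrization_id fun _ _ => rfl,
    ContactMetricStructure.isProperBiharmonicMap_suspension_iff hS hΦ hi.1
    isGlobalParametrization_id fun _ _ => rfl⟩, fun T _ hT => ?_⟩
  -- From `Φ_{t+T} = Φ_t ∘ Φ_T = Φ_t` the flow is `T`-periodic in time and descends to the circle.
  have hF : ∀ (t : ℝ) (p : M), (Φ.periodic_of_map_eq_id hT).lift (t : AddCircle T) (i p) =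
      Φ t (i p) := fun _ _ => rfl
  exact ⟨fun z => (Φ.periodic_of_map_eq_id hT).lift z.1 (i z.2), hF,
    ContactMetricStructure.isRiemannianImmersion_suspension hS hΦ hi
      (AddCircle.isGlobalParametrization_coe T) hF,
    ContactMetricStructure.isProperBiharmonicMap_suspension_iff hS hΦ hi.1
      (AddCircle.isGlobalParametrization_coe T) hF⟩
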